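/- Let $N\ge 2$, $A\in\mathbb R^{q\times q}$, $0\ne B\in\mathbb R^{q\times 1}$, where all eigenvalues of $A$ are (algebraically) simple and have zero real parts and $(A,B)$ is stabilizable. Let $\mathcal G$ be a strongly connected directed graph on $\{1,\dots,N\}$ with weights $a_{ij}>0$ if there is an edge from $j$ to $i$ and $a_{ij}=0$ otherwise, and let $\mathcal L$ be its Laplacian, $l_{ii}=\sum_{j\ne i}a_{ij}$, $l_{ij}=-a_{ij}$ for $i\neq j$. Let $\mathbf r\in\mathbb R^N$ satisfy $\mathbf r^{T}\mathcal L=0$ and $\sum_i \mathbf r_i=1$ (then all $\mathbf r_i>0$), let $g_i\ge \mathbf r_i$, $R=\mathrm{diag}(\mathbf r_i)$, $G=\mathrm{diag}(g_i)$, and let $\lambda_2$ be the second smallest eigenvalue of $R\mathcal L+\mathcal L^{T}R$. Let $0<\lambda<\lambda_2/N$ and $\beta=1/\lambda_{\min}(GR)$. Vector norms are Euclidean and matrix norms are the induced (spectral) norms. (i) There is exactly one symmetric positive definite $P$ with $$PA+A^{T}P-\lambda PBB^{T}P+\beta I=0 .$$ (ii) For this $P$ put $$\rho=\frac{\|R\mathcal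 LG\otimes B^{T}P\|}{\sqrt{\lambda_2/N-\lambda}},\qquad b_1=\|A\|+\sigma\|BB^{T}P\|,\qquad b_2=\sigma\|BB^{T}P\|,$$ where $\sigma=\|\mathcal LG\|$ is the largest singular value of $\mathcal LG$. Let $\eta\ge\eta_i>0$ $(i=1,\dots,N)$ and $\phi>0$ satisfy $\rho^2\eta^2+N\rho^2\phi^2<1$, and let $$b=\frac{\ln(\phi+1)}{b_1+b_2\max\{\eta,\phi\}\sqrt N}.$$ Consider, for $t\ge 0$, the closed loop $$\dot v_i(t)=Av_i(t)+B\mu_i(t),\qquad \mu_i(t)=g_iB^{T}P\,p_i^{c}(t),\qquad p_i(t)=\sum_j a_{ij}(v_j(t)-v_i(t)),$$ where $p_i^{c}(t)=p_i(t_{ik})$ for $t\in[t_{ik},t_{i,k+1})$, with the distributed triggering mechanism $t_{i0}=0$, $t_{i,k+1}=t_{ik}+\max\{\tau_{ik},b\}$, where $$\tau_{ik}=\inf\Big\{t\ge 0:\int_{t_{ik}}^{t_{ik}+t}\big[\|A\|s_{ik}+w_{ik}+w_i(\tau)\big]\,d\tau=s_{ik}\Big\},$$ $$s_{ik}=\tfrac{\eta_i}{1+\eta_i}\|p_i(t_{ik})\|,\quad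 w_{ik}=\Big\|\Big(A-g_iBB^{T}P\sum_j a_{ij}\Big)p_i(t_{ik})\Big\|,\quad w_i(t)=\Big\|BB^{T}P\sum_j a_{ij}g_jp_j^{c}(t)\Big\|$$ ($\inf\emptyset=\infty$). Then $b>0$, and for every initial state the closed loop has a trajectory on $[0,\infty)$. For every such trajectory the reference models reach consensus: there is a differentiable $v_\infty:\mathbb R\to\mathbb R^q$ with $\dot v_\infty(t)-Av_\infty(t)\to 0$ and $\|v_i(t)-v_\infty(t)\|\to 0$ as $t\to\infty$ for all $i$. Moreover $t_{i,k+1}-t_{ik}\ge b$ for all $i$ and $k$, so there is no Zeno behavior. -/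

import Mathlib

open scoped Matrix ENNReal Kronecker Topology Matrix.Norms.L2Operator

noncomputable section

/-! Matrix norms below are the spectral (Euclidean operator) norms. -/

/-! ### Spectral notions -/

/-- All eigenvalues of the real square matrix `A` (the complex roots of its characteristic
polynomial) are simple and have zero real part. -/
def HasSimpleImaginarySpectrum {q : ℕ} (A : Matrix (Fin q) (Fin q) ℝ) : Prop :=
  ∀ z : ℂ, (A.map (algebraMap ℝ ℂ)).charpoly.IsRoot z →
    z.re = 0 ∧ (A.map (algebraMap ℝ ℂ)).charpoly.rootMultiplicity z = 1

/-- All eigenvalues of the real square matrix `M` have negative real part. -/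
def IsHurwitz {q : ℕ} (M : Matrix (Fin q) (Fin q) ℝ) : Prop :=
  ∀ z : ℂ, (M.map (algebraMap ℝ ℂ)).charpoly.IsRoot z → z.re < 0

/-- The pair `(A, B)` is stabilizable. -/
def IsStabilizable {q : ℕ} (A : Matrix (Fin q) (Fin q) ℝ) (B : Matrix (Fin q) (Fin 1) ℝ) : Prop :=
  ∃ F : Matrix (Fin 1) (Fin q) ℝ, IsHurwitz (A + B * F)

/-- The eigenvalues of a symmetric matrix, with multiplicity, in increasing order:
index `0` is the smallest one, index `1` the second smallest one. -/
def ascendingEigenvalues {N : ℕ} {M : Matrix (Fin N) (Fin N) ℝ} (hM : M.IsHermitian)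
    (k : Fin N) : ℝ :=
  hM.eigenvalues₀ (Fin.cast (Fintype.card_fin N).symm k.rev)

/-! ### Weighted directed graphs -/

/-- A weighted directed graph on `N` nodes. The number `weight i j` is the weight of the edge
from `j` to `i`; it is positive if this edge is present and `0` if it is absent. -/
structure WeightedDigraph (N : ℕ) where
  weight : Fin N → Fin N → ℝ
  weight_nonneg : ∀ i j, 0 ≤ weight i j

namespace WeightedDigraph

variable {N : ℕ} (𝒢 : WeightedDigraph N)

/-- There is an edge from `j` to `i`. -/
def Edge (j i : Fin N) : Prop := 0 < 𝒢.weight i j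

/-- There is a directed path from every node to every other node. -/
def IsStronglyConnected : Prop := ∀ i j : Fin N, Relation.ReflTransGen 𝒢.Edge i j

/-- The (asymmetric) Laplacian matrix. -/
def laplacian : Matrix (Fin N) (Fin N) ℝ :=
  Matrix.of fun i j =>
    if i = j then ∑ k ∈ Finset.univ.erase i, 𝒢.weight i k else -𝒢.weight i j

/-- The symmetrized Laplacian `R L + Lᵀ R` with `R = diag r`. -/
def symLaplacian (r : Fin N → ℝ) : Matrix (Fin N) (Fin N) ℝ :=
  Matrix.diagonal r * 𝒢.laplacian + 𝒢.laplacianᵀ * Matrix.diagonal r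

theorem symLaplacian_isHermitian (r : Fin N → ℝ) : (𝒢.symLaplacian r).IsHermitian := by
  rw [Matrix.IsHermitian, Matrix.conjTranspose_eq_transpose_of_trivial]
  simp [symLaplacian, Matrix.transpose_mul, add_comm]

end WeightedDigraph

/-- The second smallest eigenvalue of `R L + Lᵀ R`. -/
def lambdaTwo {N : ℕ} (hN : 2 ≤ N) (𝒢 : WeightedDigraph N) (r : Fin N → ℝ) : ℝ :=
  ascendingEigenvalues (𝒢.symLaplacian_isHermitian r) ⟨1, hN⟩

/-- The matrix `G R` with `G = diag g`, `R = diag r`. -/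
def gainMatrix {N : ℕ} (g r : Fin N → ℝ) : Matrix (Fin N) (Fin N) ℝ :=
  Matrix.diagonal g * Matrix.diagonal r

theorem gainMatrix_isHermitian {N : ℕ} (g r : Fin N → ℝ) : (gainMatrix g r).IsHermitian := by
  rw [gainMatrix, Matrix.diagonal_mul_diagonal]
  exact Matrix.isHermitian_diagonal _

/-! ### Design constants -/

/-- `β = 1 / λ_min(G R)`. -/
def riccatiBeta {N : ℕ} (hN : 2 ≤ N) (g r : Fin N → ℝ) : ℝ :=
  1 / ascendingEigenvalues (gainMatrix_isHermitian g r) ⟨0, by omega⟩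

/-- `P` solves the algebraic Riccati equation `P A + Aᵀ P - lam P B Bᵀ P + β I = 0`. -/
def SolvesRiccati {q : ℕ} (A : Matrix (Fin q) (Fin q) ℝ) (B : Matrix (Fin q) (Fin 1) ℝ)
    (lam β : ℝ) (P : Matrix (Fin q) (Fin q) ℝ) : Prop :=
  P * A + Aᵀ * P - lam • (P * B * Bᵀ * P) + β • (1 : Matrix (Fin q) (Fin q) ℝ) = 0

/-- `ρ = ‖R L G ⊗ Bᵀ P‖ / √(λ₂ / N - lam)`. -/
def rhoConst {N q : ℕ} (hN : 2 ≤ N) (𝒢 : WeightedDigraph N) (r g : Fin N → ℝ) (lam : ℝ)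
    (B : Matrix (Fin q) (Fin 1) ℝ) (P : Matrix (Fin q) (Fin q) ℝ) : ℝ :=
  ‖(Matrix.diagonal r * 𝒢.laplacian * Matrix.diagonal g) ⊗ₖ (Bᵀ * P)‖ /
    Real.sqrt (lambdaTwo hN 𝒢 r / N - lam)

/-- `b₂ = σ ‖B Bᵀ P‖`, with `σ = ‖L G‖` the largest singular value of `L G`. -/
def bTwo {N q : ℕ} (𝒢 : WeightedDigraph N) (g : Fin N → ℝ)
    (B : Matrix (Fin q) (Fin 1) ℝ) (P : Matrix (Fin q) (Fin q) ℝ) : ℝ :=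
  ‖𝒢.laplacian * Matrix.diagonal g‖ * ‖B * Bᵀ * P‖

/-- `b₁ = ‖A‖ + σ ‖B Bᵀ P‖`. -/
def bOne {N q : ℕ} (𝒢 : WeightedDigraph N) (g : Fin N → ℝ) (A : Matrix (Fin q) (Fin q) ℝ)
    (B : Matrix (Fin q) (Fin 1) ℝ) (P : Matrix (Fin q) (Fin q) ℝ) : ℝ :=
  ‖A‖ + ‖𝒢.laplacian * Matrix.diagonal g‖ * ‖B * Bᵀ * P‖

/-- The dwell time `b = ln(φ + 1) / (b₁ + b₂ max{η, φ} √N)`. -/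
def dwellTime {N q : ℕ} (𝒢 : WeightedDigraph N) (g : Fin N → ℝ) (A : Matrix (Fin q) (Fin q) ℝ)
    (B : Matrix (Fin q) (Fin 1) ℝ) (P : Matrix (Fin q) (Fin q) ℝ) (η φ : ℝ) : ℝ :=
  Real.log (φ + 1) / (bOne 𝒢 g A B P + bTwo 𝒢 g B P * max η φ * Real.sqrt N)

/-! ### The event-triggered closed loop -/

/-- The relative measurement `p_i(t) = ∑_j a_{ij} (v_j(t) - v_i(t))`. -/
def relMeas {N q : ℕ} (𝒢 : WeightedDigraph N) (v : Fin N → ℝ → EuclideanSpace ℝ (Fin q))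
    (i : Fin N) (t : ℝ) : EuclideanSpace ℝ (Fin q) :=
  ∑ j, 𝒢.weight i j • (v j t - v i t)

/-- The integrand `‖A‖ s_{ik} + w_{ik} + w_i(τ)` of the triggering mechanism, where
`x = p_i(t_{ik})`, `s_{ik} = η_i / (1 + η_i) ‖x‖`,
`w_{ik} = ‖(A - g_i B Bᵀ P ∑_j a_{ij}) x‖`, `w_i(τ) = ‖B Bᵀ P ∑_j a_{ij} g_j p_j^c(τ)‖`. -/
def triggerRate {N q : ℕ} (𝒢 : WeightedDigraph N) (g : Fin N → ℝ)
    (A : Matrix (Fin q) (Fin q) ℝ) (B : Matrix (Fin q) (Fin 1) ℝ) (P : Matrix (Fin q) (Fin q) ℝ)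
    (ηi : Fin N → ℝ) (pc : Fin N → ℝ → EuclideanSpace ℝ (Fin q)) (i : Fin N)
    (x : EuclideanSpace ℝ (Fin q)) (τ : ℝ) : ℝ :=
  ‖A‖ * (ηi i / (1 + ηi i) * ‖x‖)
    + ‖(A - (g i * ∑ j, 𝒢.weight i j) • (B * Bᵀ * P)).toEuclideanLin x‖
    + ‖(B * Bᵀ * P).toEuclideanLin (∑ j, (𝒢.weight i j * g j) • pc j τ)‖

/-- `τ_{ik} = inf {t ≥ 0 : ∫_T^{T+t} (‖A‖ s_{ik} + w_{ik} + w_i(τ)) dτ = s_{ik}}` for an event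
of agent `i` at time `T` with sample `x = p_i(T)`; it is `∞` if there is no such `t`. -/
def triggerDelay {N q : ℕ} (𝒢 : WeightedDigraph N) (g : Fin N → ℝ)
    (A : Matrix (Fin q) (Fin q) ℝ) (B : Matrix (Fin q) (Fin 1) ℝ) (P : Matrix (Fin q) (Fin q) ℝ)
    (ηi : Fin N → ℝ) (pc : Fin N → ℝ → EuclideanSpace ℝ (Fin q)) (i : Fin N)
    (T : ℝ) (x : EuclideanSpace ℝ (Fin q)) : ℝ≥0∞ :=
  sInf (ENNReal.ofReal '' {t : ℝ | 0 ≤ t ∧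
    ∫ τ in T..(T + t), triggerRate 𝒢 g A B P ηi pc i x τ = ηi i / (1 + ηi i) * ‖x‖})

/-- `(v, te, pc)` is a trajectory of the closed loop on `[0, ∞)`: `v i` is the state of the
reference model of agent `i`, `te i k` is its `k`-th event time (`∞` if there are at most `k`
events), and `pc i` is its sampled relative measurement `p_i^c`. -/
structure IsClosedLoop {N q : ℕ} (𝒢 : WeightedDigraph N) (g : Fin N → ℝ)
    (A : Matrix (Fin q) (Fin q) ℝ) (B : Matrix (Fin q) (Fin 1) ℝ) (P : Matrix (Fin q) (Fin q) ℝ)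
    (ηi : Fin N → ℝ) (b : ℝ) (v : Fin N → ℝ → EuclideanSpace ℝ (Fin q))
    (te : Fin N → ℕ → ℝ≥0∞) (pc : Fin N → ℝ → EuclideanSpace ℝ (Fin q)) : Prop where
  /-- The first event of every agent is at time `0`. -/
  event_zero : ∀ i, te i 0 = 0
  /-- The triggering mechanism `t_{i,k+1} = t_{ik} + max{τ_{ik}, b}`. -/
  event_succ : ∀ i k, te i (k + 1) = te i k +
    max (triggerDelay 𝒢 g A B P ηi pc i (te i k).toReal (relMeas 𝒢 v i (te i k).toReal))
      (ENNReal.ofReal b)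
  /-- `p_i^c(t) = p_i(t_{ik})` for `t ∈ [t_{ik}, t_{i,k+1})`. -/
  sampled : ∀ i k (t : ℝ), 0 ≤ t → te i k ≤ ENNReal.ofReal t → ENNReal.ofReal t < te i (k + 1) →
    pc i t = relMeas 𝒢 v i (te i k).toReal
  /-- The state is continuous. -/
  continuousOn : ∀ i, ContinuousOn (v i) (Set.Ici 0)
  /-- `v̇_i = A v_i + B μ_i` with `μ_i = g_i K p_i^c`, `K = Bᵀ P`; since `μ_i` is piecewise
  constant and right-continuous, the derivative is the right derivative. -/
  dynamics : ∀ i (t : ℝ), 0 ≤ t → HasDerivWithinAt (v i)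
    (A.toEuclideanLin (v i t) +
      B.toEuclideanLin (g i • (Bᵀ * P).toEuclideanLin (pc i t))) (Set.Ici t) t

/-- The reference models reach consensus on a trajectory `vinf` with `v̇inf - A vinf → 0`. -/
def ReachesConsensus {N q : ℕ} (A : Matrix (Fin q) (Fin q) ℝ)
    (v : Fin N → ℝ → EuclideanSpace ℝ (Fin q)) : Prop :=
  ∃ vinf : ℝ → EuclideanSpace ℝ (Fin q),
    Differentiable ℝ vinf ∧
    Filter.Tendsto (fun t => deriv vinf t - A.toEuclideanLin (vinf t)) Filter.atTop (𝓝 0) ∧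
    ∀ i, Filter.Tendsto (fun t => ‖v i t - vinf t‖) Filter.atTop (𝓝 0)

end

noncomputable section

/-! ### Spectral bounds for symmetric matrices -/

namespace Matrix.IsHermitian

variable {n : Type*} [Fintype n] [DecidableEq n] {M : Matrix n n ℝ}

/-! Write `p` for the stacked relative measurements, `e` for the sampling errors `p^c - p`, and
`|·|` for Euclidean norms. Then `p'` is `A p` minus the coupling `L G ⊗ B Bᵀ P` applied to `p + e`,
and `∑ r_i p_i = 0` because `r` is a left null vector of `L`.

Riccati equation. A stabilizing feedback yields some `P ≥ 0` at which the Riccati operator is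
negative semidefinite. By compactness the trace attains a minimum over such matrices of no larger
trace. The Newton step from a minimizer stays in this set and cannot increase the trace, so it is
zero and the minimizer is an exact solution. All order comparisons, uniqueness included, rest on one
fact: if `M` has a strict quadratic Lyapunov function, then `MᵀY + YM ≤ 0` forces `Y ≥ 0`
(`IsLyapunovStable.posSemidef`).

Lyapunov estimate. Take `V = ∑ r_i g_i p_iᵀ P p_i` and `z_i = g_i Bᵀ P p_i`. The Riccati equation
contributes at most `lam |z|²` (as `r_i ≤ g_i`) and `-|p|²` (by the choice of `β`). The coupling
contributes at most `-(λ₂/N)|z|²`, because `z` is orthogonal to the positive vector `r_i / g_i`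
(`lambdaTwo_div_mul_le`). The surplus `(λ₂/N - lam)|z|²` absorbs the cross term with `e`, which
leaves `V' ≤ -|p|² + ρ²|e|²` (`lyapunov_rate_le`).

Error bound. At any time agent `i` either has not reached its trigger threshold, so `|e_i| ≤ η_i
|p_i|`, or sampled less than `b` ago, so `|e_i| ≤ φ |p|`. The second bound integrates `p'` backwards
from the present and needs `|e_j| ≤ max{η, φ}|p|` at all earlier times; a continuation argument
closes this circle (`error_le_max`). Hence `|e|² ≤ (η² + Nφ²)|p|²` and `V` decays exponentially.

Consensus and existence. The mean of the `v_i` solves `m' = A m + f` with `f → 0`, but is only right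
differentiable, so it is smoothed over a unit window (`exists_differentiable_of_asymptotic`).
Trajectories are built by going from one global event to the next; the dwell time keeps the events
from accumulating. -/

theorem dotProduct_self_eq_sum_eigenvectorBasis (hM : M.IsHermitian) (x : n → ℝ) :
    x ⬝ᵥ x = ∑ k, ((hM.eigenvectorBasis k : n → ℝ) ⬝ᵥ x) ^ 2 := by
  have h := hM.eigenvectorBasis.sum_inner_mul_inner (WithLp.toLp 2 x) (WithLp.toLp 2 x)
  simp only [EuclideanSpace.inner_eq_star_dotProduct, star_trivial] at h
  rw [← h]
  refine Finset.sum_congr rfl fun k _ => ?_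
  rw [sq, dotProduct_comm x]

theorem dotProduct_mulVec_eq_sum_eigenvalues (hM : M.IsHermitian) (x : n → ℝ) :
    x ⬝ᵥ (M *ᵥ x) = ∑ k, hM.eigenvalues k * ((hM.eigenvectorBasis k : n → ℝ) ⬝ᵥ x) ^ 2 := by
  have h := hM.eigenvectorBasis.sum_inner_mul_inner (WithLp.toLp 2 x) (WithLp.toLp 2 (M *ᵥ x))
  simp only [EuclideanSpace.inner_eq_star_dotProduct, star_trivial] at h
  rw [dotProduct_comm, ← h]
  refine Finset.sum_congr rfl fun k _ => ?_
  have h2 : (M *ᵥ x) ⬝ᵥ (hM.eigenvectorBasis k : n → ℝ)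
      = hM.eigenvalues k * ((hM.eigenvectorBasis k : n → ℝ) ⬝ᵥ x) := by
    have hMt : Mᵀ = M := by
      rw [← Matrix.conjTranspose_eq_transpose_of_trivial]; exact hM
    rw [dotProduct_comm, Matrix.dotProduct_mulVec, ← Matrix.mulVec_transpose, hMt,
      hM.mulVec_eigenvectorBasis, smul_dotProduct, smul_eq_mul]
  rw [h2]; ring

end Matrix.IsHermitian

section Ascending

variable {N : ℕ} {M : Matrix (Fin N) (Fin N) ℝ}

theorem ascendingEigenvalues_zero_le (hM : M.IsHermitian) (h0 : 0 < N) (k : Fin N) :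
    ascendingEigenvalues hM ⟨0, h0⟩ ≤ hM.eigenvalues k := by
  unfold ascendingEigenvalues Matrix.IsHermitian.eigenvalues
  apply hM.eigenvalues₀_antitone
  rw [Fin.le_def]
  have h := ((Fintype.equivOfCardEq (Fintype.card_fin _)).symm k :
    Fin (Fintype.card (Fin N))).isLt
  simp only [Fintype.card_fin] at h
  simp only [Fin.val_cast, Fin.val_rev]
  omega

theorem ascendingEigenvalues_eq_eigenvalues (hM : M.IsHermitian) (k : Fin N) :
    ∃ j, ascendingEigenvalues hM k = hM.eigenvalues j := by
  refine ⟨(Fintype.equivOfCardEq (Fintype.card_fin _)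
    (Fin.cast (Fintype.card_fin N).symm k.rev)), ?_⟩
  simp [ascendingEigenvalues, Matrix.IsHermitian.eigenvalues]

theorem ascendingEigenvalues_zero_mul_le (hM : M.IsHermitian) (h0 : 0 < N) (x : Fin N → ℝ) :
    ascendingEigenvalues hM ⟨0, h0⟩ * (x ⬝ᵥ x) ≤ x ⬝ᵥ (M *ᵥ x) := by
  rw [hM.dotProduct_mulVec_eq_sum_eigenvalues, hM.dotProduct_self_eq_sum_eigenvectorBasis,
    Finset.mul_sum]
  exact Finset.sum_le_sum fun k _ =>
    mul_le_mul_of_nonneg_right (ascendingEigenvalues_zero_le hM h0 k) (sq_nonneg _)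

/-- Away from a bottom eigenvector, the quadratic form is bounded below by the second smallest
eigenvalue. -/
theorem exists_bottom_eigenvector (hM : M.IsHermitian) (h1 : 1 < N) :
    ∃ u : Fin N → ℝ, ∃ a : ℝ, u ⬝ᵥ u = 1 ∧ M *ᵥ u = a • u ∧ ∀ x : Fin N → ℝ,
      ascendingEigenvalues hM ⟨1, h1⟩ * (x ⬝ᵥ x - (u ⬝ᵥ x) ^ 2) + a * (u ⬝ᵥ x) ^ 2
        ≤ x ⬝ᵥ (M *ᵥ x) := by
  set e : Fin (Fintype.card (Fin N)) ≃ Fin N :=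
    Fintype.equivOfCardEq (Fintype.card_fin _) with he
  -- `eigenvalues₀` is listed in decreasing order, so the bottom eigenvalue sits at position `N -
  -- 1`, and every other position is at most `N - 2`, the place of the second smallest one.
  set j : Fin N := e (Fin.cast (Fintype.card_fin N).symm (Fin.rev ⟨0, by omega⟩)) with hj
  have hother : ∀ k, k ≠ j → ascendingEigenvalues hM ⟨1, h1⟩ ≤ hM.eigenvalues k := by
    intro k hk
    unfold ascendingEigenvalues Matrix.IsHermitian.eigenvalues
    apply hM.eigenvalues₀_antitone
    have hne : e.symm k ≠ Fin.cast (Fintype.card_fin N).symm (Fin.rev ⟨0, by omega⟩) := by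
      intro h
      exact hk (by rw [hj, ← h, Equiv.apply_symm_apply])
    have h := (e.symm k).isLt
    simp only [Fintype.card_fin] at h
    have hne' : ((e.symm k : Fin _) : ℕ) ≠ N - 1 := by
      intro h2
      apply hne
      apply Fin.ext
      simp only [Fin.val_cast, Fin.val_rev]
      omega
    rw [Fin.le_def]
    change ((e.symm k : Fin _) : ℕ) ≤ _
    simp only [Fin.val_cast, Fin.val_rev]
    omega
  refine ⟨(hM.eigenvectorBasis j : Fin N → ℝ), hM.eigenvalues j, ?_, ?_, fun x => ?_⟩
  · have h := hM.eigenvectorBasis.orthonormal.1 j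
    have h2 := real_inner_self_eq_norm_sq (hM.eigenvectorBasis j)
    rw [h, EuclideanSpace.inner_eq_star_dotProduct, star_trivial] at h2
    simpa using h2
  · exact hM.mulVec_eigenvectorBasis j
  · rw [hM.dotProduct_mulVec_eq_sum_eigenvalues, hM.dotProduct_self_eq_sum_eigenvectorBasis,
      ← Finset.add_sum_erase _ _ (Finset.mem_univ j),
      ← Finset.add_sum_erase _ (fun k => hM.eigenvalues k * _) (Finset.mem_univ j),
      add_sub_cancel_left, add_comm, Finset.mul_sum]
    gcongr with k hk
    exact hother k (Finset.ne_of_mem_erase hk)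

end Ascending

/-! ### The Laplacian -/

namespace WeightedDigraph

variable {N : ℕ} (𝒢 : WeightedDigraph N)

theorem laplacian_mulVec_apply (x : Fin N → ℝ) (i : Fin N) :
    (𝒢.laplacian *ᵥ x) i = ∑ j, 𝒢.weight i j * (x i - x j) := by
  rw [Matrix.mulVec, dotProduct, ← Finset.add_sum_erase _ _ (Finset.mem_univ i),
    ← Finset.add_sum_erase _ (fun j => 𝒢.weight i j * _) (Finset.mem_univ i)]
  simp only [laplacian, Matrix.of_apply, if_true, sub_self, mul_zero, zero_add, Finset.sum_mul,
    ← Finset.sum_add_distrib]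
  refine Finset.sum_congr rfl fun j hj => ?_
  rw [if_neg (Finset.ne_of_mem_erase hj).symm]
  ring

theorem laplacian_mulVec_one : 𝒢.laplacian *ᵥ 1 = 0 := by
  ext i
  simp [laplacian_mulVec_apply]

theorem symLaplacian_mulVec_one {r : Fin N → ℝ} (hr : r ᵥ* 𝒢.laplacian = 0) :
    𝒢.symLaplacian r *ᵥ 1 = 0 := by
  rw [symLaplacian, Matrix.add_mulVec, ← Matrix.mulVec_mulVec, ← Matrix.mulVec_mulVec,
    laplacian_mulVec_one, Matrix.mulVec_zero, zero_add, Matrix.mulVec_transpose]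
  have : Matrix.diagonal r *ᵥ 1 = r := by ext i; simp [Matrix.mulVec_diagonal]
  rw [this, hr]

theorem vecMul_laplacian_apply (x : Fin N → ℝ) (i : Fin N) :
    (x ᵥ* 𝒢.laplacian) i = x i * (∑ k ∈ Finset.univ.erase i, 𝒢.weight i k)
      - ∑ j ∈ Finset.univ.erase i, x j * 𝒢.weight j i := by
  rw [Matrix.vecMul, dotProduct, ← Finset.add_sum_erase _ _ (Finset.mem_univ i), sub_eq_add_neg,
    ← Finset.sum_neg_distrib]
  congr 1
  · simp [laplacian]
  · refine Finset.sum_congr rfl fun j hj => ?_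
    simp [laplacian, Finset.ne_of_mem_erase hj]

variable {𝒢}

/-- A nonnegative left null vector of the Laplacian with a zero entry vanishes. -/
theorem IsStronglyConnected.eq_zero_of_nonneg (h𝒢 : 𝒢.IsStronglyConnected) {s : Fin N → ℝ}
    (hs : s ᵥ* 𝒢.laplacian = 0) (h0 : ∀ i, 0 ≤ s i) {i : Fin N} (hi : s i = 0) : s = 0 := by
  ext j
  induction h𝒢 i j with
  | refl => exact hi
  | @tail c d _ hcd hc =>
    by_cases hne : d = c
    · rw [hne]; exact hc
    -- With `s c = 0`, column `c` of the null equation is a vanishing sum of the nonnegative terms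
    -- `s j * weight j c`, so `s` vanishes at every node reached by an edge from `c`.
    have h := congrFun hs c
    rw [vecMul_laplacian_apply, hc, Pi.zero_apply, zero_mul, zero_sub, neg_eq_zero,
      Finset.sum_eq_zero_iff_of_nonneg
        (fun j _ => mul_nonneg (h0 j) (𝒢.weight_nonneg j c))] at h
    have h2 := h d (Finset.mem_erase.2 ⟨hne, Finset.mem_univ _⟩)
    have hcd' : 0 < 𝒢.weight d c := hcd
    exact (mul_eq_zero.1 h2).resolve_right hcd'.ne'

/-- The triangle inequality makes every entry of the product nonpositive, and the entries add up to
zero because the Laplacian kills the all-ones vector. -/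
theorem abs_vecMul_laplacian {r : Fin N → ℝ} (hr : r ᵥ* 𝒢.laplacian = 0) :
    (fun i => |r i|) ᵥ* 𝒢.laplacian = 0 := by
  have hle : ∀ i, ((fun i => |r i|) ᵥ* 𝒢.laplacian) i ≤ 0 := by
    intro i
    have h := congrFun hr i
    rw [vecMul_laplacian_apply, Pi.zero_apply, sub_eq_zero] at h
    rw [vecMul_laplacian_apply, sub_nonpos]
    calc |r i| * ∑ k ∈ Finset.univ.erase i, 𝒢.weight i k
        = |r i * ∑ k ∈ Finset.univ.erase i, 𝒢.weight i k| := by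
          rw [abs_mul, abs_of_nonneg (a := ∑ k ∈ Finset.univ.erase i, 𝒢.weight i k)
            (Finset.sum_nonneg fun k _ => 𝒢.weight_nonneg i k)]
      _ ≤ ∑ j ∈ Finset.univ.erase i, |r j * 𝒢.weight j i| := by
          rw [h]; exact Finset.abs_sum_le_sum_abs _ _
      _ = _ := by
          refine Finset.sum_congr rfl fun j _ => ?_
          rw [abs_mul, abs_of_nonneg (𝒢.weight_nonneg j i)]
  have hsum : ∑ i, ((fun i => |r i|) ᵥ* 𝒢.laplacian) i = 0 := by
    have h : ((fun i => |r i|) ᵥ* 𝒢.laplacian) ⬝ᵥ 1 = 0 := by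
      rw [← Matrix.dotProduct_mulVec, laplacian_mulVec_one, dotProduct_zero]
    simpa [dotProduct] using h
  ext i
  exact (Finset.sum_eq_zero_iff_of_nonpos fun i _ => hle i).1 hsum i (Finset.mem_univ i)

/-- A Perron–Frobenius argument: `|r| - r` is a nonnegative left null vector that vanishes where `r`
is positive, hence everywhere, so `r ≥ 0`; a zero entry would then make all of `r` vanish. -/
theorem IsStronglyConnected.pos_of_vecMul_eq_zero (h𝒢 : 𝒢.IsStronglyConnected) {r : Fin N → ℝ}
    (hr : r ᵥ* 𝒢.laplacian = 0) (hr_sum : ∑ i, r i = 1) (i : Fin N) : 0 < r i := by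
  obtain ⟨k, -, hk⟩ : ∃ k ∈ Finset.univ, 0 < r k :=
    Finset.exists_lt_of_sum_lt (by simp [hr_sum])
  have habs := abs_vecMul_laplacian hr
  have hsub : (fun i => |r i| - r i) = 0 := by
    refine h𝒢.eq_zero_of_nonneg (i := k) ?_ (fun i => sub_nonneg.2 (le_abs_self _)) ?_
    · have : (fun i => |r i| - r i) = (fun i => |r i|) - r := rfl
      rw [this, Matrix.sub_vecMul, habs, hr, sub_zero]
    · simp [abs_of_pos hk]
  have hnonneg : ∀ j, 0 ≤ r j := fun j => by
    have := congrFun hsub j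
    simp only [Pi.zero_apply, sub_eq_zero] at this
    rw [← this]; exact abs_nonneg _
  refine lt_of_le_of_ne (hnonneg i) fun hi => ?_
  have := h𝒢.eq_zero_of_nonneg hr hnonneg hi.symm
  rw [this] at hk
  exact lt_irrefl _ hk

end WeightedDigraph

/-! ### Spectral gap of the symmetrized Laplacian and the constant `β` -/

section Bounds

variable {N : ℕ} {𝒢 : WeightedDigraph N} {r : Fin N → ℝ}

/-- Positivity of the second eigenvalue identifies the bottom eigenvector `u`. Testing with the null
vector `1` gives `N ≤ (∑ u_i)²`, Cauchy–Schwarz gives the converse, and equality makes `u` constant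
with eigenvalue zero. The subtracted square is thus the component of `x` along the constants. -/
theorem sq_sub_mean_le {hN : 2 ≤ N} (hr : r ᵥ* 𝒢.laplacian = 0) (hpos : 0 < lambdaTwo hN 𝒢 r)
    (x : Fin N → ℝ) :
    lambdaTwo hN 𝒢 r * (x ⬝ᵥ x - (∑ i, x i) ^ 2 / N) ≤ x ⬝ᵥ (𝒢.symLaplacian r *ᵥ x) := by
  obtain ⟨u, a, huu, hMu, hx⟩ := exists_bottom_eigenvector (𝒢.symLaplacian_isHermitian r) hN
  change ∀ x, lambdaTwo hN 𝒢 r * _ + _ ≤ _ at hx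
  set l2 := lambdaTwo hN 𝒢 r
  have hN0 : (0 : ℝ) < N := by exact_mod_cast (by omega : 0 < N)
  set s := ∑ i, u i with hs
  have hS1 := 𝒢.symLaplacian_mulVec_one hr
  have hu1 : u ⬝ᵥ 1 = s := by simp [dotProduct, hs]
  have h11 : (1 : Fin N → ℝ) ⬝ᵥ 1 = N := by simp [dotProduct]
  have h1 := hx 1
  rw [hS1, dotProduct_zero, hu1, h11] at h1
  have has : a * s = 0 := by
    have h : (1 : Fin N → ℝ) ⬝ᵥ (𝒢.symLaplacian r *ᵥ u) = 0 := by
      rw [Matrix.dotProduct_mulVec, ← Matrix.mulVec_transpose,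
        ← Matrix.conjTranspose_eq_transpose_of_trivial, 𝒢.symLaplacian_isHermitian r, hS1,
        zero_dotProduct]
    rw [hMu, dotProduct_smul, dotProduct_comm, hu1] at h
    simpa using h
  have has2 : a * s ^ 2 = 0 := by rw [sq, ← mul_assoc, has, zero_mul]
  rw [has2, add_zero] at h1
  have hsN : (N : ℝ) ≤ s ^ 2 := by
    by_contra! h
    exact absurd h1 (not_le.2 (mul_pos hpos (by linarith)))
  have hs0 : s ≠ 0 := by
    intro h; rw [h] at hsN; norm_num at hsN; linarith
  have ha : a = 0 := (mul_eq_zero.1 has).resolve_right hs0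
  have hdev : ∑ i, (u i - s / N) ^ 2 = 1 - s ^ 2 / N := by
    have : ∑ i, (u i - s / N) ^ 2 = ∑ i, u i * u i - 2 * (s / N) * ∑ i, u i
        + ∑ _i : Fin N, (s / N) ^ 2 := by
      rw [Finset.mul_sum, ← Finset.sum_sub_distrib, ← Finset.sum_add_distrib]
      exact Finset.sum_congr rfl fun i _ => by ring
    rw [this, ← hs, show ∑ i, u i * u i = 1 from huu]
    simp only [Finset.sum_const, Finset.card_univ, Fintype.card_fin, nsmul_eq_mul]
    field_simp
    ring
  have hdev0 : (0 : ℝ) ≤ 1 - s ^ 2 / N := by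
    rw [← hdev]; exact Finset.sum_nonneg fun i _ => sq_nonneg _
  have hsN' : s ^ 2 = N := by
    refine le_antisymm ?_ hsN
    rw [sub_nonneg, div_le_one hN0] at hdev0
    exact hdev0
  have hui : ∀ i, u i = s / N := by
    have h0 : ∑ i, (u i - s / N) ^ 2 = 0 := by rw [hdev, hsN', div_self hN0.ne', sub_self]
    intro i
    have := (Finset.sum_eq_zero_iff_of_nonneg fun i _ => sq_nonneg _).1 h0 i (Finset.mem_univ i)
    exact sub_eq_zero.1 (pow_eq_zero_iff two_ne_zero |>.1 this)
  have hux : (u ⬝ᵥ x) ^ 2 = (∑ i, x i) ^ 2 / N := by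
    have : u ⬝ᵥ x = s / N * ∑ i, x i := by
      rw [dotProduct, Finset.mul_sum]
      exact Finset.sum_congr rfl fun i _ => by rw [hui i]
    rw [this, mul_pow, div_pow, hsN']
    field_simp
  have := hx x
  rwa [ha, zero_mul, add_zero, hux] at this

/-- A vector orthogonal to a positive vector cannot be too close to constant: `(∑ y_i)² ≤ (N - 1)
|y|²`. This is where the factor `1 / N` in the condition on `lam` comes from. -/
theorem lambdaTwo_div_mul_le {hN : 2 ≤ N} (hr : r ᵥ* 𝒢.laplacian = 0)
    (hpos : 0 < lambdaTwo hN 𝒢 r) {c : Fin N → ℝ} (hc : ∀ i, 0 < c i) {y : Fin N → ℝ}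
    (hcy : ∑ i, c i * y i = 0) :
    lambdaTwo hN 𝒢 r / N * ∑ i, y i ^ 2 ≤ y ⬝ᵥ (𝒢.symLaplacian r *ᵥ y) := by
  refine le_trans ?_ (sq_sub_mean_le hr hpos y)
  have hN0 : (0 : ℝ) < N := by exact_mod_cast (by omega : 0 < N)
  rw [div_mul_eq_mul_div, mul_div_assoc]
  refine mul_le_mul_of_nonneg_left ?_ hpos.le
  have hyy : y ⬝ᵥ y = ∑ i, y i ^ 2 := Finset.sum_congr rfl fun i _ => (sq _).symm
  rw [hyy, div_le_iff₀ hN0, sub_mul, div_mul_cancel₀ _ hN0.ne']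
  set C2 := ∑ i, c i ^ 2
  set C := ∑ i, c i
  have hCpos : 0 < C2 := by
    refine Finset.sum_pos (fun i _ => pow_pos (hc i) 2) ⟨⟨0, by omega⟩, Finset.mem_univ _⟩
  have hCC : C2 ≤ C ^ 2 := by
    rw [sq, Finset.sum_mul]
    refine Finset.sum_le_sum fun i _ => ?_
    rw [sq]
    exact mul_le_mul_of_nonneg_left
      (Finset.single_le_sum (f := c) (fun j _ => (hc j).le) (Finset.mem_univ i)) (hc i).le
  -- Subtracting from `1` its projection onto `c` does not change the pairing with `y`, but lowers
  -- the squared norm from `N` to `N - C² / C2`, which is at most `N - 1`.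
  have hcs := Finset.sum_mul_sq_le_sq_mul_sq Finset.univ (fun i => 1 - C / C2 * c i) y
  have e1 : ∑ i, (1 - C / C2 * c i) * y i = ∑ i, y i := by
    simp only [sub_mul, one_mul, Finset.sum_sub_distrib, mul_assoc, ← Finset.mul_sum]
    rw [hcy]; ring
  have e2 : ∑ i, (1 - C / C2 * c i) ^ 2 = N - C ^ 2 / C2 := by
    have : ∀ i, (1 - C / C2 * c i) ^ 2 = 1 - 2 * (C / C2) * c i + (C / C2) ^ 2 * c i ^ 2 :=
      fun i => by ring
    simp only [this, Finset.sum_add_distrib, Finset.sum_sub_distrib, ← Finset.mul_sum]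
    simp only [Finset.sum_const, Finset.card_univ, Fintype.card_fin, nsmul_eq_mul, mul_one]
    change (N : ℝ) - 2 * (C / C2) * C + (C / C2) ^ 2 * C2 = _
    field_simp
    ring
  rw [e1, e2] at hcs
  have h1 : 1 ≤ C ^ 2 / C2 := (one_le_div hCpos).2 hCC
  have h2 : 0 ≤ ∑ i, y i ^ 2 := Finset.sum_nonneg fun i _ => sq_nonneg _
  nlinarith

theorem riccatiBeta_pos {hN : 2 ≤ N} {g : Fin N → ℝ} (hr : ∀ i, 0 < r i) (hg : ∀ i, 0 < g i) :
    0 < riccatiBeta hN g r := by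
  have hpd : (gainMatrix g r).PosDef := by
    rw [gainMatrix, Matrix.diagonal_mul_diagonal]
    exact Matrix.PosDef.diagonal fun i => mul_pos (hg i) (hr i)
  obtain ⟨j, hj⟩ := ascendingEigenvalues_eq_eigenvalues (gainMatrix_isHermitian g r) ⟨0, by omega⟩
  rw [riccatiBeta, hj]
  exact one_div_pos.2 (hpd.eigenvalues_pos j)

/-- Testing the smallest eigenvalue on a coordinate vector. It turns the weighted terms `r_i g_i β
‖p_i‖²` into at least `‖p_i‖²`. -/
theorem one_le_mul_riccatiBeta {hN : 2 ≤ N} {g : Fin N → ℝ} (hr : ∀ i, 0 < r i)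
    (hg : ∀ i, 0 < g i) (i : Fin N) : 1 ≤ r i * g i * riccatiBeta hN g r := by
  have hpos := riccatiBeta_pos (hN := hN) hr hg
  have h := ascendingEigenvalues_zero_mul_le (gainMatrix_isHermitian g r) (by omega)
    (Pi.single i 1)
  rw [riccatiBeta] at hpos ⊢
  have hm := one_div_pos.1 hpos
  rw [mul_one_div, le_div_iff₀ hm, one_mul]
  rw [mul_comm]
  simpa [gainMatrix, Matrix.diagonal_mul_diagonal] using h

end Bounds

/-! ### Lyapunov equations -/

namespace Matrix

section QuadraticForms

variable {n : Type*}

theorem isHermitian_iff_transpose {M : Matrix n n ℝ} : M.IsHermitian ↔ Mᵀ = M := by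
  rw [Matrix.IsHermitian, conjTranspose_eq_transpose_of_trivial]

variable [Fintype n]

theorem dotProduct_transpose_mulVec' {m : Type*} [Fintype m] (M : Matrix m n ℝ) (x : n → ℝ)
    (y : m → ℝ) :
    x ⬝ᵥ (Mᵀ *ᵥ y) = (M *ᵥ x) ⬝ᵥ y := by
  rw [dotProduct_mulVec, vecMul_transpose]

theorem posSemidef_iff_real {M : Matrix n n ℝ} :
    M.PosSemidef ↔ Mᵀ = M ∧ ∀ x : n → ℝ, 0 ≤ x ⬝ᵥ (M *ᵥ x) := by
  rw [posSemidef_iff_dotProduct_mulVec, isHermitian_iff_transpose]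
  simp

theorem posDef_iff_real {M : Matrix n n ℝ} :
    M.PosDef ↔ Mᵀ = M ∧ ∀ x : n → ℝ, x ≠ 0 → 0 < x ⬝ᵥ (M *ᵥ x) := by
  rw [posDef_iff_dotProduct_mulVec, isHermitian_iff_transpose]
  simp

theorem eq_zero_of_posSemidef_of_neg {M : Matrix n n ℝ} (h : M.PosSemidef)
    (h' : (-M).PosSemidef) : M = 0 := by
  classical
  rw [← h.trace_eq_zero_iff]
  refine le_antisymm ?_ h.trace_nonneg
  have := h'.trace_nonneg
  rw [trace_neg] at this
  linarith

end QuadraticForms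

end Matrix

variable {q : ℕ}

/-- `M` admits a strict quadratic Lyapunov function. -/
def IsLyapunovStable (M : Matrix (Fin q) (Fin q) ℝ) : Prop :=
  ∃ X : Matrix (Fin q) (Fin q) ℝ, X.PosDef ∧ (-(Mᵀ * X + X * M)).PosDef

theorem lyapunov_quadratic (M Y : Matrix (Fin q) (Fin q) ℝ) (hY : Yᵀ = Y) (x : Fin q → ℝ) :
    x ⬝ᵥ ((Mᵀ * Y + Y * M) *ᵥ x) = 2 * ((M *ᵥ x) ⬝ᵥ (Y *ᵥ x)) := by
  rw [Matrix.add_mulVec, dotProduct_add, ← Matrix.mulVec_mulVec, ← Matrix.mulVec_mulVec,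
    Matrix.dotProduct_transpose_mulVec', two_mul]
  congr 1
  conv_lhs => rw [← hY]
  rw [Matrix.dotProduct_transpose_mulVec', dotProduct_comm]

namespace IsLyapunovStable

variable {M : Matrix (Fin q) (Fin q) ℝ}

/-- Let `c` be the minimum of the Rayleigh quotient of `Y` relative to `X`, attained at `x₀`. Then
`Y - cX ≥ 0` annihilates `x₀`, so `Y x₀ = c X x₀`, and comparing the two Lyapunov forms at `x₀`
gives `c ≥ 0`. No flow or eigenvalue argument is needed. -/
theorem posSemidef (hM : IsLyapunovStable M) {Y : Matrix (Fin q) (Fin q) ℝ} (hY : Yᵀ = Y)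
    (hQ : (-(Mᵀ * Y + Y * M)).PosSemidef) : Y.PosSemidef := by
  obtain ⟨X, hX, hXM⟩ := hM
  have hXt : Xᵀ = X := (Matrix.posDef_iff_real.1 hX).1
  rcases isEmpty_or_nonempty (Fin q) with hq | hq
  · refine Matrix.posSemidef_iff_real.2 ⟨hY, fun x => ?_⟩
    simp [dotProduct]
  have hXpos := (Matrix.posDef_iff_real.1 hX).2
  have hne : (Metric.sphere (0 : Fin q → ℝ) 1).Nonempty := by
    obtain ⟨i⟩ := hq
    exact ⟨Pi.single i 1, by rw [mem_sphere_zero_iff_norm, Pi.norm_single]; simp⟩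
  have hsph : ∀ x ∈ Metric.sphere (0 : Fin q → ℝ) 1, x ≠ 0 := by
    rintro x hx rfl
    simp at hx
  obtain ⟨x₀, hx₀, hmin⟩ := (isCompact_sphere (0 : Fin q → ℝ) 1).exists_isMinOn hne
    (f := fun x => (x ⬝ᵥ (Y *ᵥ x)) / (x ⬝ᵥ (X *ᵥ x)))
    (ContinuousOn.div (by fun_prop) (by fun_prop) fun x hx => (hXpos x (hsph x hx)).ne')
  set c := (x₀ ⬝ᵥ (Y *ᵥ x₀)) / (x₀ ⬝ᵥ (X *ᵥ x₀)) with hc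
  have hx0 := hsph x₀ hx₀
  have hZ : (Y - c • X).PosSemidef := by
    refine Matrix.posSemidef_iff_real.2 ⟨by simp [hY, hXt], fun x => ?_⟩
    rw [Matrix.sub_mulVec, dotProduct_sub, Matrix.smul_mulVec, dotProduct_smul, smul_eq_mul,
      sub_nonneg]
    by_cases hx : x = 0
    · simp [hx]
    have hnx : ‖x‖ ≠ 0 := norm_ne_zero_iff.2 hx
    have h := hmin (a := ‖x‖⁻¹ • x) (by simp [norm_smul, hnx])
    change c ≤ ((‖x‖⁻¹ • x) ⬝ᵥ (Y *ᵥ (‖x‖⁻¹ • x))) / ((‖x‖⁻¹ • x) ⬝ᵥ (X *ᵥ (‖x‖⁻¹ • x))) at h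
    simp only [Matrix.mulVec_smul, dotProduct_smul, smul_dotProduct, smul_eq_mul] at h
    rw [mul_div_mul_left _ _ (inv_ne_zero hnx), mul_div_mul_left _ _ (inv_ne_zero hnx),
      le_div_iff₀ (hXpos x hx)] at h
    exact h
  have hZ0 : x₀ ⬝ᵥ ((Y - c • X) *ᵥ x₀) = 0 := by
    rw [Matrix.sub_mulVec, dotProduct_sub, Matrix.smul_mulVec, dotProduct_smul, smul_eq_mul, hc,
      div_mul_cancel₀ _ (hXpos x₀ hx0).ne', sub_self]
  have hker : (Y - c • X) *ᵥ x₀ = 0 := by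
    have := (hZ.dotProduct_mulVec_zero_iff x₀).1 (by simpa using hZ0)
    exact this
  have hYX : Y *ᵥ x₀ = c • (X *ᵥ x₀) := by
    rw [Matrix.sub_mulVec, Matrix.smul_mulVec, sub_eq_zero] at hker
    exact hker
  have h1 := (Matrix.posSemidef_iff_real.1 hQ).2 x₀
  have h2 := (Matrix.posDef_iff_real.1 hXM).2 x₀ hx0
  rw [Matrix.neg_mulVec, dotProduct_neg, lyapunov_quadratic _ _ hY, hYX, dotProduct_smul,
    smul_eq_mul] at h1
  rw [Matrix.neg_mulVec, dotProduct_neg, lyapunov_quadratic _ _ hXt] at h2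
  have hc0 : 0 ≤ c := by
    by_contra! hneg
    nlinarith
  have : Y = (Y - c • X) + c • X := by simp
  rw [this]
  exact hZ.add (hX.posSemidef.smul hc0)

/-- Applied to `Y` and `-Y`, `posSemidef` makes the Lyapunov operator injective on symmetric
matrices; in finite dimension it is then onto. -/
theorem exists_lyapunov (hM : IsLyapunovStable M) {Q : Matrix (Fin q) (Fin q) ℝ}
    (hQ : Q.PosSemidef) :
    ∃ Y : Matrix (Fin q) (Fin q) ℝ, Y.PosSemidef ∧ Mᵀ * Y + Y * M = -Q := by
  let S : Submodule ℝ (Matrix (Fin q) (Fin q) ℝ) :=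
    { carrier := {Y | Yᵀ = Y}
      add_mem' := fun {a b} ha hb => by
        rw [Set.mem_ofPred_eq] at *; rw [Matrix.transpose_add, ha, hb]
      zero_mem' := Matrix.transpose_zero
      smul_mem' := fun c a ha => by
        rw [Set.mem_ofPred_eq] at *; rw [Matrix.transpose_smul, ha] }
  let L : S →ₗ[ℝ] S :=
    { toFun := fun Y => ⟨Mᵀ * Y.1 + Y.1 * M, by
        change (Mᵀ * Y.1 + Y.1 * M)ᵀ = _
        rw [Matrix.transpose_add, Matrix.transpose_mul, Matrix.transpose_mul,
          Matrix.transpose_transpose, show Y.1ᵀ = Y.1 from Y.2, add_comm]⟩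
      map_add' := fun a b => by
        ext1; simp only [Submodule.coe_add, mul_add, add_mul]; abel
      map_smul' := fun c a => by
        ext1; simp [smul_add] }
  have hinj : Function.Injective L := by
    rw [← LinearMap.ker_eq_bot, LinearMap.ker_eq_bot']
    intro Y hY
    have hY0 : Mᵀ * Y.1 + Y.1 * M = 0 := congrArg Subtype.val hY
    have hYt : Y.1ᵀ = Y.1 := Y.2
    have h1 : Y.1.PosSemidef := hM.posSemidef hYt (by rw [hY0, neg_zero]; exact .zero)
    have h2 : (-Y.1).PosSemidef := hM.posSemidef (by rw [Matrix.transpose_neg, hYt]) (by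
      rw [mul_neg, neg_mul, ← neg_add, hY0, neg_zero, neg_zero]; exact .zero)
    exact Subtype.ext (Matrix.eq_zero_of_posSemidef_of_neg h1 h2)
  obtain ⟨Y, hY⟩ := LinearMap.surjective_of_injective hinj
    ⟨-Q, by
      change (-Q)ᵀ = -Q
      rw [Matrix.transpose_neg, (Matrix.posSemidef_iff_real.1 hQ).1]⟩
  have hY' : Mᵀ * Y.1 + Y.1 * M = -Q := congrArg Subtype.val hY
  exact ⟨Y.1, hM.posSemidef Y.2 (by rwa [hY', neg_neg]), hY'⟩

end IsLyapunovStable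

/-! ### Hurwitz matrices admit quadratic Lyapunov functions -/

/-- The square of the norm is `1 + ε (2 Re z + ε |z|²)`. -/
theorem eventually_norm_one_add_mul_lt_one {z : ℂ} (hz : z.re < 0) :
    ∀ᶠ ε : ℝ in 𝓝[>] 0, ‖1 + (ε : ℂ) * z‖ < 1 := by
  have h1 : ∀ᶠ ε : ℝ in 𝓝 0, 2 * z.re + ε * (z.re ^ 2 + z.im ^ 2) < 0 := by
    have : Filter.Tendsto (fun ε : ℝ => 2 * z.re + ε * (z.re ^ 2 + z.im ^ 2)) (𝓝 0)
        (𝓝 (2 * z.re + 0 * (z.re ^ 2 + z.im ^ 2))) := by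
      apply Continuous.tendsto; fun_prop
    exact this.eventually_lt_const (by linarith)
  filter_upwards [h1.filter_mono nhdsWithin_le_nhds, self_mem_nhdsWithin] with ε hε hpos
  have hpos : 0 < ε := hpos
  rw [← sq_lt_one_iff₀ (norm_nonneg _), Complex.sq_norm, Complex.normSq_apply]
  simp
  nlinarith

/-- The Euler step `1 + εM` moves the finite spectrum into the open unit disc for one common small
`ε`; Gelfand's formula then produces a power of norm below one. -/
theorem IsHurwitz.exists_norm_pow_lt_one [NeZero q] {M : Matrix (Fin q) (Fin q) ℝ}
    (hM : IsHurwitz M) :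
    ∃ ε : ℝ, 0 < ε ∧ ∃ n : ℕ, 0 < n ∧
      ‖((1 + ε • M).map (algebraMap ℝ ℂ)) ^ n‖ < 1 := by
  set MC := M.map (algebraMap ℝ ℂ) with hMC
  have hfin : (spectrum ℂ MC).Finite := by
    have : spectrum ℂ MC = {z | MC.charpoly.IsRoot z} := by
      ext z; exact Matrix.mem_spectrum_iff_isRoot_charpoly
    rw [this]
    exact Polynomial.finite_setOfPred_isRoot (Matrix.charpoly_monic MC).ne_zero
  have hev : ∀ᶠ ε : ℝ in 𝓝[>] 0, ∀ z ∈ spectrum ℂ MC, ‖1 + (ε : ℂ) * z‖ < 1 :=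
    (Filter.eventually_all_finite hfin).2 fun z hz =>
      eventually_norm_one_add_mul_lt_one (hM z (Matrix.mem_spectrum_iff_isRoot_charpoly.1 hz))
  obtain ⟨ε, hε, hpos⟩ := (hev.and self_mem_nhdsWithin).exists
  have hpos : 0 < ε := hpos
  refine ⟨ε, hpos, ?_⟩
  have hT : (1 + ε • M).map (algebraMap ℝ ℂ) = 1 + (ε : ℂ) • MC := by
    ext i j
    simp [hMC, Matrix.one_apply, apply_ite]
  rw [hT]
  set T := 1 + (ε : ℂ) • MC
  have hspec : ∀ k ∈ spectrum ℂ T, ‖k‖₊ < 1 := by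
    intro k hk
    have hε0 : (ε : ℂ) ≠ 0 := by exact_mod_cast hpos.ne'
    have h1 : (k - 1) / ε ∈ spectrum ℂ MC := by
      rw [spectrum.mem_iff] at hk ⊢
      intro hu
      apply hk
      have : algebraMap ℂ (Matrix (Fin q) (Fin q) ℂ) k - T
          = (ε : ℂ) • (algebraMap ℂ (Matrix (Fin q) (Fin q) ℂ) ((k - 1) / ε) - MC) := by
        simp only [T, smul_sub, Algebra.algebraMap_eq_smul_one, smul_smul,
          mul_div_cancel₀ _ hε0, sub_smul, one_smul]
        abel
      rw [this]
      exact hu.smul (Units.mk0 _ hε0)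
    have h2 := hε _ h1
    rw [mul_div_cancel₀ _ hε0] at h2
    simpa [← NNReal.coe_lt_coe] using h2
  have hrad : spectralRadius ℂ T < (1 : NNReal) := spectrum.spectralRadius_lt_of_forall_lt T hspec
  have hlim := (spectrum.pow_nnnorm_pow_one_div_tendsto_nhds_spectralRadius T).eventually_lt_const
    hrad
  obtain ⟨n, hn, hn0⟩ := (hlim.and (Filter.eventually_gt_atTop 0)).exists
  refine ⟨n, hn0, ?_⟩
  by_contra! hle
  refine absurd hn (not_lt.2 ?_)
  have h1 : (1 : ℝ≥0∞) ≤ ‖T ^ n‖₊ := by exact_mod_cast hle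
  exact_mod_cast ENNReal.one_le_rpow h1 (by positivity)

theorem dotProduct_mulVec_self_lt {W : Matrix (Fin q) (Fin q) ℝ}
    (hW : ‖W.map (algebraMap ℝ ℂ)‖ < 1) {x : Fin q → ℝ} (hx : x ≠ 0) :
    (W *ᵥ x) ⬝ᵥ (W *ᵥ x) < x ⬝ᵥ x := by
  have key : ∀ y : Fin q → ℝ, ‖WithLp.toLp 2 (fun i => (y i : ℂ))‖ ^ 2 = y ⬝ᵥ y := by
    intro y
    rw [EuclideanSpace.norm_sq_eq]
    exact Finset.sum_congr rfl fun i _ => by simp [sq]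
  have hpos : 0 < x ⬝ᵥ x := by
    have := Matrix.dotProduct_star_self_pos_iff.2 hx
    simpa using this
  have h := Matrix.l2_opNorm_mulVec (W.map (algebraMap ℝ ℂ))
    (WithLp.toLp 2 (fun i => (x i : ℂ)))
  have hmap : W.map (algebraMap ℝ ℂ) *ᵥ (fun i => (x i : ℂ)) = fun i => ((W *ᵥ x) i : ℂ) := by
    ext i
    simp [Matrix.mulVec, dotProduct]
  change ‖WithLp.toLp 2 (W.map (algebraMap ℝ ℂ) *ᵥ (fun i => (x i : ℂ)))‖ ≤ _ at h
  rw [hmap] at h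
  rw [← key, ← key]
  have hx' : 0 < ‖WithLp.toLp 2 (fun i => (x i : ℂ))‖ := by
    rw [← key] at hpos
    by_contra! h0
    rw [le_antisymm h0 (norm_nonneg _)] at hpos
    simp at hpos
  exact pow_lt_pow_left₀ (h.trans_lt (mul_lt_of_lt_one_left hx' hW)) (norm_nonneg _) two_ne_zero

/-- The discrete Lyapunov matrix `X = ∑_{k<n} (Tᵏ)ᵀ Tᵏ` of `T = 1 + εM` telescopes to `TᵀXT - X =
(Tⁿ)ᵀTⁿ - 1 < 0`. Expanding in `ε` gives the continuous Lyapunov form plus `ε² MᵀXM ≥ 0`, which has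
the favourable sign, so the same `X` works for `M`. -/
theorem IsHurwitz.isLyapunovStable [NeZero q] {M : Matrix (Fin q) (Fin q) ℝ} (hM : IsHurwitz M) :
    IsLyapunovStable M := by
  obtain ⟨ε, hε, n, hn, hpow⟩ := hM.exists_norm_pow_lt_one
  set T := 1 + ε • M with hT
  have hpow' : ‖(T ^ n).map (algebraMap ℝ ℂ)‖ < 1 := by rwa [Matrix.map_pow]
  set X := ∑ k ∈ Finset.range n, (T ^ k)ᵀ * T ^ k with hX
  have hpsd : ∀ k, ((T ^ k)ᵀ * T ^ k).PosSemidef := fun k => by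
    have := Matrix.posSemidef_conjTranspose_mul_self (T ^ k)
    rwa [Matrix.conjTranspose_eq_transpose_of_trivial] at this
  have hXpd : X.PosDef := by
    obtain ⟨m, rfl⟩ : ∃ m, n = m + 1 := ⟨n - 1, by omega⟩
    rw [hX, Finset.sum_range_succ', pow_zero, Matrix.transpose_one, one_mul]
    exact Matrix.PosDef.posSemidef_add (Matrix.posSemidef_sum _ fun k _ => hpsd _) Matrix.PosDef.one
  have hXt : Xᵀ = X := (Matrix.posDef_iff_real.1 hXpd).1
  have htel : Tᵀ * X * T - X = (T ^ n)ᵀ * T ^ n - 1 := by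
    have h1 : Tᵀ * X * T = ∑ k ∈ Finset.range n, (T ^ (k + 1))ᵀ * T ^ (k + 1) := by
      rw [hX, Finset.mul_sum, Finset.sum_mul]
      refine Finset.sum_congr rfl fun k _ => ?_
      rw [pow_succ, Matrix.transpose_mul]
      simp only [mul_assoc]
    rw [h1, hX, ← Finset.sum_sub_distrib, Finset.sum_range_sub (fun k => (T ^ k)ᵀ * T ^ k)]
    simp
  have hexp : Tᵀ * X * T - X = ε • (Mᵀ * X + X * M) + ε ^ 2 • (Mᵀ * X * M) := by
    rw [hT]
    simp only [Matrix.transpose_add, Matrix.transpose_one, Matrix.transpose_smul, add_mul, mul_add,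
      one_mul, mul_one, Matrix.smul_mul, Matrix.mul_smul, smul_add, smul_smul, sq]
    abel
  refine ⟨X, hXpd, Matrix.posDef_iff_real.2 ⟨?_, fun x hx => ?_⟩⟩
  · simp only [Matrix.transpose_neg, Matrix.transpose_add, Matrix.transpose_mul, hXt,
      Matrix.transpose_transpose]
    rw [add_comm]
  · have h1 := congrArg (fun Z => x ⬝ᵥ (Z *ᵥ x)) (hexp.symm.trans htel)
    simp only [Matrix.add_mulVec (ε • _), Matrix.sub_mulVec, dotProduct_add x (_ • _),
      dotProduct_sub, Matrix.smul_mulVec, dotProduct_smul, smul_eq_mul, Matrix.one_mulVec] at h1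
    have h2 : x ⬝ᵥ (((T ^ n)ᵀ * T ^ n) *ᵥ x) < x ⬝ᵥ x := by
      rw [← Matrix.mulVec_mulVec, Matrix.dotProduct_transpose_mulVec']
      exact dotProduct_mulVec_self_lt hpow' hx
    have h3 : 0 ≤ x ⬝ᵥ ((Mᵀ * X * M) *ᵥ x) := by
      rw [mul_assoc, ← Matrix.mulVec_mulVec, Matrix.dotProduct_transpose_mulVec',
        ← Matrix.mulVec_mulVec]
      exact (Matrix.posSemidef_iff_real.1 hXpd.posSemidef).2 _
    rw [Matrix.neg_mulVec, dotProduct_neg]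
    have h4 : 0 ≤ ε ^ 2 * (x ⬝ᵥ ((Mᵀ * X * M) *ᵥ x)) := by positivity
    by_contra! h5
    have h6 : 0 ≤ ε * (x ⬝ᵥ ((Mᵀ * X + X * M) *ᵥ x)) := mul_nonneg hε.le (by linarith)
    linarith

/-! ### The algebraic Riccati equation -/

/-- The Riccati operator `P A + Aᵀ P - lam P B Bᵀ P + β I`. -/
def riccatiMap (A : Matrix (Fin q) (Fin q) ℝ) (B : Matrix (Fin q) (Fin 1) ℝ) (lam β : ℝ)
    (P : Matrix (Fin q) (Fin q) ℝ) : Matrix (Fin q) (Fin q) ℝ :=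
  P * A + Aᵀ * P - lam • (P * B * Bᵀ * P) + β • (1 : Matrix (Fin q) (Fin q) ℝ)

section Riccati

variable {A : Matrix (Fin q) (Fin q) ℝ} {B : Matrix (Fin q) (Fin 1) ℝ} {lam β : ℝ}
  {P : Matrix (Fin q) (Fin q) ℝ}

theorem posSemidef_mul_transpose_mul {m : ℕ} (C : Matrix (Fin q) (Fin m) ℝ) :
    (C * Cᵀ).PosSemidef := by
  have := Matrix.posSemidef_self_mul_conjTranspose C
  rwa [Matrix.conjTranspose_eq_transpose_of_trivial] at this

theorem posSemidef_mul_mul_transpose_mul {D : Matrix (Fin q) (Fin q) ℝ} (hD : Dᵀ = D) :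
    (D * B * Bᵀ * D).PosSemidef := by
  have := posSemidef_mul_transpose_mul (D * B)
  rwa [Matrix.transpose_mul, hD, ← Matrix.mul_assoc] at this

/-- On a vector `x` in the kernel of `P` the Riccati form reduces to `β |x|²`, which is positive
unless `x = 0`. -/
theorem posDef_of_riccatiMap (hβ : 0 < β) (hP : P.PosSemidef)
    (hR : (-riccatiMap A B lam β P).PosSemidef) : P.PosDef := by
  obtain ⟨hPt, hP0⟩ := Matrix.posSemidef_iff_real.1 hP
  refine Matrix.posDef_iff_real.2 ⟨hPt, fun x hx => lt_of_le_of_ne (hP0 x) fun h0 => ?_⟩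
  have hPx : P *ᵥ x = 0 := (hP.dotProduct_mulVec_zero_iff x).1 (by simpa using h0.symm)
  have h1 := (Matrix.posSemidef_iff_real.1 hR).2 x
  have hxP : ∀ y, x ⬝ᵥ (P *ᵥ y) = 0 := fun y => by
    rw [← hPt, Matrix.dotProduct_transpose_mulVec', hPx, zero_dotProduct]
  have hpos : 0 < x ⬝ᵥ x := by
    have := Matrix.dotProduct_star_self_pos_iff.2 hx
    simpa using this
  simp only [riccatiMap, Matrix.neg_mulVec, Matrix.add_mulVec, Matrix.sub_mulVec, dotProduct_neg,
    dotProduct_add, dotProduct_sub, ← Matrix.mulVec_mulVec, hPx, Matrix.mulVec_zero, hxP,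
    Matrix.smul_mulVec, Matrix.one_mulVec, dotProduct_smul, smul_eq_mul, dotProduct_zero] at h1
  nlinarith

/-- `P` itself is the Lyapunov function: its form along the closed-loop matrix dominates `β I`. Only
the Riccati inequality is needed, so this also covers the matrices met during the minimization. -/
theorem isLyapunovStable_of_riccatiMap (hlam : 0 < lam) (hβ : 0 < β) (hP : P.PosDef)
    (hR : (-riccatiMap A B lam β P).PosSemidef) :
    IsLyapunovStable (A - lam • (B * Bᵀ * P)) := by
  have hPt : Pᵀ = P := (Matrix.posDef_iff_real.1 hP).1
  refine ⟨P, hP, ?_⟩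
  have h : -((A - lam • (B * Bᵀ * P))ᵀ * P + P * (A - lam • (B * Bᵀ * P)))
      = β • (1 : Matrix (Fin q) (Fin q) ℝ)
          + (lam • (P * B * Bᵀ * P) + -riccatiMap A B lam β P) := by
    simp only [riccatiMap, Matrix.transpose_sub, Matrix.transpose_smul, Matrix.transpose_mul, hPt,
      Matrix.transpose_transpose, Matrix.sub_mul, Matrix.mul_sub, Matrix.smul_mul,
      Matrix.mul_smul, Matrix.mul_assoc]
    abel
  rw [h]
  exact (Matrix.PosDef.one.smul hβ).add_posSemidef
    (((posSemidef_mul_mul_transpose_mul hPt).smul hlam.le).add hR)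

theorem riccati_unique (hlam : 0 < lam) (hβ : 0 < β) {P₁ P₂ : Matrix (Fin q) (Fin q) ℝ}
    (h₁ : P₁.PosDef) (h₂ : P₂.PosDef) (hR₁ : SolvesRiccati A B lam β P₁)
    (hR₂ : SolvesRiccati A B lam β P₂) : P₁ = P₂ := by
  have aux : ∀ {P₁ P₂ : Matrix (Fin q) (Fin q) ℝ}, P₁.PosDef → P₂.PosDef →
      riccatiMap A B lam β P₁ = 0 → riccatiMap A B lam β P₂ = 0 → (P₂ - P₁).PosSemidef := by
    intro P₁ P₂ h₁ h₂ hR₁ hR₂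
    have hPt₁ : P₁ᵀ = P₁ := (Matrix.posDef_iff_real.1 h₁).1
    have hPt₂ : P₂ᵀ = P₂ := (Matrix.posDef_iff_real.1 h₂).1
    have hst : IsLyapunovStable (A - lam • (B * Bᵀ * P₂)) :=
      isLyapunovStable_of_riccatiMap hlam hβ h₂ (by rw [hR₂, neg_zero]; exact .zero)
    have hDt : (P₂ - P₁)ᵀ = P₂ - P₁ := by rw [Matrix.transpose_sub, hPt₁, hPt₂]
    refine hst.posSemidef hDt ?_
    -- The quadratic term makes the difference of the two Riccati operators the linearization at
    -- `P₂` plus the signed square `lam D B Bᵀ D`, with `D = P₂ - P₁`.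
    have h : -((A - lam • (B * Bᵀ * P₂))ᵀ * (P₂ - P₁) + (P₂ - P₁) * (A - lam • (B * Bᵀ * P₂)))
        = lam • ((P₂ - P₁) * B * Bᵀ * (P₂ - P₁)) + (riccatiMap A B lam β P₁
          - riccatiMap A B lam β P₂) := by
      simp only [riccatiMap, Matrix.transpose_sub, Matrix.transpose_smul, Matrix.transpose_mul,
        hPt₂, Matrix.transpose_transpose, Matrix.sub_mul, Matrix.mul_sub, Matrix.smul_mul,
        Matrix.mul_smul,
        Matrix.mul_assoc, smul_sub]
      abel
    rw [h, hR₁, hR₂, sub_zero, add_zero]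
    exact (posSemidef_mul_mul_transpose_mul hDt).smul hlam.le
  have e := Matrix.eq_zero_of_posSemidef_of_neg (aux h₁ h₂ hR₁ hR₂) (by
    rw [neg_sub]; exact aux h₂ h₁ hR₂ hR₁)
  exact (sub_eq_zero.1 e).symm

/-- Solve the Lyapunov equation for the stabilized matrix `A + BF` with right-hand side `-(β I +
lam⁻¹ FᵀF)`; completing the square in `F` shows that replacing `F` by the feedback built from `P`
leaves only a square. -/
theorem exists_riccati_subsolution [NeZero q] (hAB : IsStabilizable A B) (hlam : 0 < lam)
    (hβ : 0 < β) :
    ∃ P : Matrix (Fin q) (Fin q) ℝ, P.PosSemidef ∧ (-riccatiMap A B lam β P).PosSemidef := by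
  obtain ⟨F, hF⟩ := hAB
  have hst := hF.isLyapunovStable
  have hFF : (Fᵀ * F).PosSemidef := by
    have := posSemidef_mul_transpose_mul Fᵀ
    rwa [Matrix.transpose_transpose] at this
  obtain ⟨P, hP, hPeq⟩ := hst.exists_lyapunov
    ((Matrix.PosSemidef.one.smul hβ.le).add (hFF.smul (inv_nonneg.2 hlam.le)))
  refine ⟨P, hP, ?_⟩
  have hPt : Pᵀ = P := (Matrix.posSemidef_iff_real.1 hP).1
  have h : -riccatiMap A B lam β P
      = lam⁻¹ • ((Fᵀ + lam • (P * B)) * (Fᵀ + lam • (P * B))ᵀ)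
        - ((A + B * F)ᵀ * P + P * (A + B * F) + (β • 1 + lam⁻¹ • (Fᵀ * F))) := by
    simp only [riccatiMap, Matrix.transpose_add, Matrix.transpose_smul, Matrix.transpose_mul, hPt,
      Matrix.transpose_transpose, Matrix.add_mul, Matrix.mul_add, Matrix.smul_mul,
      Matrix.mul_smul,
      smul_add, smul_smul, ← mul_assoc lam⁻¹, inv_mul_cancel₀ hlam.ne', one_mul, one_smul,
      Matrix.mul_assoc]
    abel
  rw [h, hPeq, neg_add_cancel, sub_zero]
  exact (posSemidef_mul_transpose_mul _).smul (inv_nonneg.2 hlam.le)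

/-- Test the form on `e_i ± e_j`. The trace bound thus confines the feasible matrices to a compact
box. -/
theorem Matrix.PosSemidef.abs_apply_le_trace (hP : P.PosSemidef) (i j : Fin q) :
    |P i j| ≤ P.trace := by
  obtain ⟨hPt, hP0⟩ := Matrix.posSemidef_iff_real.1 hP
  have hd : ∀ k, P k k ≤ P.trace := fun k =>
    Finset.single_le_sum (f := fun k => P k k) (fun k _ => hP.diag_nonneg) (Finset.mem_univ k)
  have hij : P j i = P i j := by rw [← hPt, Matrix.transpose_apply, hPt]
  have h1 := hP0 (Pi.single i 1 + Pi.single j 1)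
  have h2 := hP0 (Pi.single i 1 - Pi.single j 1)
  simp only [Matrix.mulVec_add, Matrix.mulVec_sub, Matrix.mulVec_single_one, dotProduct_add,
    add_dotProduct, dotProduct_sub, sub_dotProduct, single_one_dotProduct, Matrix.col_apply,
    hij] at h1 h2
  rw [abs_le]
  constructor <;> linarith [hd i, hd j]

theorem continuous_riccatiMap : Continuous (riccatiMap A B lam β) := by
  unfold riccatiMap
  fun_prop

theorem isClosed_posSemidef : IsClosed {P : Matrix (Fin q) (Fin q) ℝ | P.PosSemidef} := by
  simp only [Matrix.posSemidef_iff_real, Set.ofPred_and, Set.ofPred_forall]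
  refine (isClosed_eq (by fun_prop) continuous_id).inter (isClosed_iInter fun x => ?_)
  exact isClosed_le continuous_const (by fun_prop)

theorem exists_riccati_solution [NeZero q] (hAB : IsStabilizable A B) (hlam : 0 < lam)
    (hβ : 0 < β) : ∃ P : Matrix (Fin q) (Fin q) ℝ, P.PosDef ∧ SolvesRiccati A B lam β P := by
  obtain ⟨P₀, hP₀, hR₀⟩ := exists_riccati_subsolution (A := A) (B := B) hAB hlam hβ
  set c := P₀.trace
  set S : Set (Matrix (Fin q) (Fin q) ℝ) :=
    {P | P.PosSemidef} ∩ (riccatiMap A B lam β ⁻¹' {R | (-R).PosSemidef}) ∩ {P | P.trace ≤ c}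
    with hS
  have hclosed : IsClosed S := by
    refine (isClosed_posSemidef.inter ?_).inter (isClosed_le (by fun_prop) continuous_const)
    exact (isClosed_posSemidef.preimage continuous_neg).preimage continuous_riccatiMap
  have hK : IsCompact (Set.univ.pi fun _ : Fin q => Set.univ.pi fun _ : Fin q => Set.Icc (-c) c) :=
    isCompact_univ_pi fun _ => isCompact_univ_pi fun _ => isCompact_Icc
  have hcomp : IsCompact S := by
    refine hK.of_isClosed_subset hclosed ?_
    rintro P ⟨⟨hP, -⟩, ht⟩ i - j -
    exact abs_le.1 ((hP.abs_apply_le_trace i j).trans ht)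
  obtain ⟨P, ⟨⟨hP, hR⟩, ht⟩, hmin⟩ := hcomp.exists_isMinOn ⟨P₀, ⟨hP₀, hR₀⟩, le_refl c⟩
    (f := Matrix.trace) (by fun_prop)
  have hP : P.PosSemidef := hP
  have hR : (-riccatiMap A B lam β P).PosSemidef := hR
  have hPd := posDef_of_riccatiMap hβ hP hR
  have hPt : Pᵀ = P := (Matrix.posDef_iff_real.1 hPd).1
  refine ⟨P, hPd, ?_⟩
  have hst := isLyapunovStable_of_riccatiMap hlam hβ hPd hR
  -- `P - Y` is the Newton iterate for the Riccati equation: the linear part of the residual cancels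
  -- and only `-lam Y B Bᵀ Y` remains, so the Riccati inequality persists.
  obtain ⟨Y, hY, hYeq⟩ := hst.exists_lyapunov hR
  have hYt : Yᵀ = Y := (Matrix.posSemidef_iff_real.1 hY).1
  have hYeq' : (A - lam • (B * Bᵀ * P))ᵀ * Y + Y * (A - lam • (B * Bᵀ * P))
      - riccatiMap A B lam β P = 0 := by rw [hYeq, neg_neg, sub_self]
  have hstep : -riccatiMap A B lam β (P - Y) = lam • (Y * B * Bᵀ * Y) := by
    have h : -riccatiMap A B lam β (P - Y) = lam • (Y * B * Bᵀ * Y)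
        + ((A - lam • (B * Bᵀ * P))ᵀ * Y + Y * (A - lam • (B * Bᵀ * P))
          - riccatiMap A B lam β P) := by
      simp only [riccatiMap, Matrix.transpose_sub, Matrix.transpose_smul, Matrix.transpose_mul,
        hPt, Matrix.transpose_transpose, Matrix.sub_mul, Matrix.mul_sub, Matrix.smul_mul,
        Matrix.mul_smul, Matrix.mul_assoc, smul_sub]
      abel
    rw [h, hYeq', add_zero]
  have hPY : (P - Y).PosSemidef := by
    refine hst.posSemidef (by rw [Matrix.transpose_sub, hPt, hYt]) ?_
    have h : -((A - lam • (B * Bᵀ * P))ᵀ * (P - Y) + (P - Y) * (A - lam • (B * Bᵀ * P)))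
        = β • (1 : Matrix (Fin q) (Fin q) ℝ) + lam • (P * B * Bᵀ * P)
          + ((A - lam • (B * Bᵀ * P))ᵀ * Y + Y * (A - lam • (B * Bᵀ * P))
          - riccatiMap A B lam β P) := by
      simp only [riccatiMap, Matrix.transpose_sub, Matrix.transpose_smul, Matrix.transpose_mul,
        hPt, Matrix.transpose_transpose, Matrix.sub_mul, Matrix.mul_sub, Matrix.smul_mul,
        Matrix.mul_smul, Matrix.mul_assoc, smul_sub]
      abel
    rw [h, hYeq', add_zero]
    exact (Matrix.PosSemidef.one.smul hβ.le).add
      ((posSemidef_mul_mul_transpose_mul hPt).smul hlam.le)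
  have hYtr := hY.trace_nonneg
  have hPYS : P - Y ∈ S := by
    refine ⟨⟨hPY, ?_⟩, ?_⟩
    · change (-riccatiMap A B lam β (P - Y)).PosSemidef
      rw [hstep]
      exact (posSemidef_mul_mul_transpose_mul hYt).smul hlam.le
    · change (P - Y).trace ≤ c
      have ht : P.trace ≤ c := ht
      rw [Matrix.trace_sub]
      linarith
  -- Since `Y ≥ 0`, minimality of the trace forces `tr Y = 0`, hence `Y = 0`, and the Lyapunov
  -- equation for `Y` becomes the Riccati equation for `P`.
  have hle : P.trace ≤ (P - Y).trace := hmin hPYS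
  rw [Matrix.trace_sub] at hle
  have hY0 : Y = 0 := hY.trace_eq_zero_iff.1 (by linarith)
  rw [hY0, Matrix.mul_zero, Matrix.zero_mul, add_zero, zero_sub, neg_eq_zero] at hYeq'
  exact hYeq'

end Riccati

/-! ### Static estimates for the network -/

section Static

variable {N q : ℕ}

/-- The Euclidean norm of a stacked family of vectors. -/
def stackNorm (p : Fin N → EuclideanSpace ℝ (Fin q)) : ℝ := ‖WithLp.toLp 2 p‖

theorem stackNorm_nonneg (p : Fin N → EuclideanSpace ℝ (Fin q)) : 0 ≤ stackNorm p :=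
  norm_nonneg _

theorem stackNorm_sq (p : Fin N → EuclideanSpace ℝ (Fin q)) :
    stackNorm p ^ 2 = ∑ i, ‖p i‖ ^ 2 := by
  rw [stackNorm, PiLp.norm_sq_eq_of_L2]

theorem norm_le_stackNorm (p : Fin N → EuclideanSpace ℝ (Fin q)) (i : Fin N) :
    ‖p i‖ ≤ stackNorm p := PiLp.norm_apply_le (WithLp.toLp 2 p) i

theorem stackNorm_add_le (p y : Fin N → EuclideanSpace ℝ (Fin q)) :
    stackNorm (fun i => p i + y i) ≤ stackNorm p + stackNorm y :=
  norm_add_le (WithLp.toLp 2 p) (WithLp.toLp 2 y)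

theorem stackNorm_le_of_forall {p : Fin N → EuclideanSpace ℝ (Fin q)} {C : ℝ} (hC : 0 ≤ C)
    (h : ∀ i, ‖p i‖ ≤ C) : stackNorm p ≤ Real.sqrt N * C := by
  refine abs_le_of_sq_le_sq' ?_ (by positivity) |>.2
  rw [stackNorm_sq, mul_pow, Real.sq_sqrt (Nat.cast_nonneg N)]
  calc ∑ i, ‖p i‖ ^ 2 ≤ ∑ _i : Fin N, C ^ 2 :=
        Finset.sum_le_sum fun i _ => pow_le_pow_left₀ (norm_nonneg _) (h i) 2
    _ = N * C ^ 2 := by simp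

theorem stackNorm_comp_le {f : EuclideanSpace ℝ (Fin q) → EuclideanSpace ℝ (Fin q)} {C : ℝ}
    (hC : 0 ≤ C) (hf : ∀ x, ‖f x‖ ≤ C * ‖x‖) (p : Fin N → EuclideanSpace ℝ (Fin q)) :
    stackNorm (fun i => f (p i)) ≤ C * stackNorm p := by
  refine abs_le_of_sq_le_sq' ?_ (mul_nonneg hC (stackNorm_nonneg p)) |>.2
  rw [mul_pow, stackNorm_sq, stackNorm_sq, Finset.mul_sum]
  refine Finset.sum_le_sum fun i _ => ?_
  rw [← mul_pow]
  exact pow_le_pow_left₀ (norm_nonneg _) (hf _) 2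

theorem ofLp_toEuclideanLin {m n : ℕ} (M : Matrix (Fin m) (Fin n) ℝ)
    (x : EuclideanSpace ℝ (Fin n)) : (M.toEuclideanLin x).ofLp = M *ᵥ x.ofLp := rfl

theorem norm_toEuclideanLin_le {m n : ℕ} (M : Matrix (Fin m) (Fin n) ℝ)
    (x : EuclideanSpace ℝ (Fin n)) : ‖M.toEuclideanLin x‖ ≤ ‖M‖ * ‖x‖ :=
  Matrix.l2_opNorm_mulVec M x

theorem dotProduct_mulVec_self_le {m n : Type*} [Fintype m] [Fintype n] [DecidableEq n]
    (M : Matrix m n ℝ) (x : n → ℝ) : (M *ᵥ x) ⬝ᵥ (M *ᵥ x) ≤ ‖M‖ ^ 2 * (x ⬝ᵥ x) := by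
  have h := Matrix.l2_opNorm_mulVec M (WithLp.toLp 2 x)
  have h2 := pow_le_pow_left₀ (norm_nonneg _) h 2
  rw [mul_pow, EuclideanSpace.norm_sq_eq, EuclideanSpace.norm_sq_eq] at h2
  simpa [dotProduct, sq] using h2

variable (𝒢 : WeightedDigraph N) (g : Fin N → ℝ)

/-- The coupling term `∑_j a_{ij} (g_j y_j - g_i y_i)`. -/
def coupling (y : Fin N → EuclideanSpace ℝ (Fin q)) (i : Fin N) : EuclideanSpace ℝ (Fin q) :=
  ∑ j, 𝒢.weight i j • (g j • y j - g i • y i)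

theorem coupling_apply (y : Fin N → EuclideanSpace ℝ (Fin q)) (i : Fin N) (a : Fin q) :
    coupling 𝒢 g y i a = -((𝒢.laplacian * Matrix.diagonal g) *ᵥ fun j => y j a) i := by
  rw [← Matrix.mulVec_mulVec, WeightedDigraph.laplacian_mulVec_apply, ← Finset.sum_neg_distrib]
  simp only [coupling, Matrix.mulVec_diagonal, WithLp.ofLp_sum, Finset.sum_apply, PiLp.smul_apply,
    PiLp.sub_apply, smul_eq_mul]
  exact Finset.sum_congr rfl fun j _ => by ring

theorem stackNorm_coupling_le (y : Fin N → EuclideanSpace ℝ (Fin q)) :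
    stackNorm (coupling 𝒢 g y) ≤ ‖𝒢.laplacian * Matrix.diagonal g‖ * stackNorm y := by
  refine abs_le_of_sq_le_sq' ?_ (mul_nonneg (norm_nonneg _) (stackNorm_nonneg y)) |>.2
  rw [mul_pow, stackNorm_sq, stackNorm_sq]
  simp only [EuclideanSpace.norm_sq_eq, Real.norm_eq_abs, sq_abs]
  rw [Finset.sum_comm, Finset.sum_comm (f := fun i a => (y i a) ^ 2), Finset.mul_sum]
  refine Finset.sum_le_sum fun a _ => ?_
  have h := dotProduct_mulVec_self_le (𝒢.laplacian * Matrix.diagonal g) fun j => y j a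
  simpa [coupling_apply, dotProduct, sq] using h

/-- The rate of change of the relative measurements when `y` is the sampled measurement. -/
def relRate (A : Matrix (Fin q) (Fin q) ℝ) (B : Matrix (Fin q) (Fin 1) ℝ)
    (P : Matrix (Fin q) (Fin q) ℝ) (p y : Fin N → EuclideanSpace ℝ (Fin q)) (i : Fin N) :
    EuclideanSpace ℝ (Fin q) :=
  A.toEuclideanLin (p i) + coupling 𝒢 g (fun j => (B * Bᵀ * P).toEuclideanLin (y j)) i

variable {𝒢 g} {A : Matrix (Fin q) (Fin q) ℝ} {B : Matrix (Fin q) (Fin 1) ℝ}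
  {P : Matrix (Fin q) (Fin q) ℝ}

theorem stackNorm_relRate_le (p y : Fin N → EuclideanSpace ℝ (Fin q)) :
    stackNorm (relRate 𝒢 g A B P p y) ≤ ‖A‖ * stackNorm p + bTwo 𝒢 g B P * stackNorm y := by
  refine (stackNorm_add_le _ _).trans (add_le_add ?_ ?_)
  · exact stackNorm_comp_le (norm_nonneg _) (norm_toEuclideanLin_le A) p
  · refine (stackNorm_coupling_le 𝒢 g _).trans ?_
    rw [bTwo, mul_assoc]
    exact mul_le_mul_of_nonneg_left
      (stackNorm_comp_le (norm_nonneg _) (norm_toEuclideanLin_le (B * Bᵀ * P)) y) (norm_nonneg _)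

/-- The factor `√N` arises because each single error is compared with the norm of the whole stack.
The resulting constant is the denominator of the dwell time. -/
theorem stackNorm_relRate_le_of_error {p y : Fin N → EuclideanSpace ℝ (Fin q)} {m : ℝ}
    (hm : 0 ≤ m) (h : ∀ i, ‖y i - p i‖ ≤ m * stackNorm p) :
    stackNorm (relRate 𝒢 g A B P p y)
      ≤ (bOne 𝒢 g A B P + bTwo 𝒢 g B P * m * Real.sqrt N) * stackNorm p := by
  refine (stackNorm_relRate_le p y).trans ?_
  have hy : stackNorm y ≤ stackNorm p + Real.sqrt N * (m * stackNorm p) := by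
    have h1 := stackNorm_add_le p (fun i => y i - p i)
    simp only [add_sub_cancel] at h1
    exact h1.trans (add_le_add_right
      (stackNorm_le_of_forall (mul_nonneg hm (stackNorm_nonneg p)) h) _)
  have hb : 0 ≤ bTwo 𝒢 g B P := mul_nonneg (norm_nonneg _) (norm_nonneg _)
  have hb1 : bOne 𝒢 g A B P = ‖A‖ + bTwo 𝒢 g B P := rfl
  rw [hb1]
  calc _ ≤ ‖A‖ * stackNorm p + bTwo 𝒢 g B P * (stackNorm p + Real.sqrt N * (m * stackNorm p)) := by
        gcongr
    _ = _ := by ring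

/-- The scalar feedback `Bᵀ P x`. -/
def feedback (B : Matrix (Fin q) (Fin 1) ℝ) (P : Matrix (Fin q) (Fin q) ℝ)
    (x : EuclideanSpace ℝ (Fin q)) : ℝ := ((Bᵀ * P) *ᵥ x.ofLp) 0

theorem feedback_add (x y : EuclideanSpace ℝ (Fin q)) :
    feedback B P (x + y) = feedback B P x + feedback B P y := by
  simp [feedback, Matrix.mulVec_add]

theorem feedback_smul (c : ℝ) (x : EuclideanSpace ℝ (Fin q)) :
    feedback B P (c • x) = c * feedback B P x := by
  simp [feedback, Matrix.mulVec_smul]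

theorem feedback_sum (x : Fin N → EuclideanSpace ℝ (Fin q)) :
    feedback B P (∑ i, x i) = ∑ i, feedback B P (x i) :=
  map_sum (⟨⟨feedback B P, by simp [feedback]⟩, feedback_add⟩ : EuclideanSpace ℝ (Fin q) →+ ℝ) _ _

theorem inner_toEuclideanLin_input (x w : EuclideanSpace ℝ (Fin q)) :
    inner ℝ (P.toEuclideanLin x) ((B * Bᵀ * P).toEuclideanLin w)
      = feedback B P x * feedback B P w := by
  rw [EuclideanSpace.inner_eq_star_dotProduct, star_trivial, ofLp_toEuclideanLin,
    ofLp_toEuclideanLin, Matrix.mul_assoc, ← Matrix.mulVec_mulVec,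
    ← Matrix.dotProduct_transpose_mulVec', Matrix.mulVec_mulVec]
  simp [dotProduct, feedback, mul_comm]

theorem two_mul_inner_drift (hP : Pᵀ = P) {lam β : ℝ} (hR : SolvesRiccati A B lam β P)
    (x : EuclideanSpace ℝ (Fin q)) :
    2 * inner ℝ (P.toEuclideanLin x) (A.toEuclideanLin x)
      = lam * feedback B P x ^ 2 - β * ‖x‖ ^ 2 := by
  have hR' : Aᵀ * P + P * A = lam • (P * B * Bᵀ * P) - β • (1 : Matrix (Fin q) (Fin q) ℝ) := by
    rw [SolvesRiccati] at hR
    rw [← sub_eq_zero, ← hR]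
    abel
  have h := lyapunov_quadratic A P hP x.ofLp
  rw [hR', Matrix.sub_mulVec, dotProduct_sub, Matrix.smul_mulVec, Matrix.smul_mulVec,
    Matrix.one_mulVec, dotProduct_smul, dotProduct_smul, smul_eq_mul, smul_eq_mul] at h
  rw [EuclideanSpace.inner_eq_star_dotProduct, star_trivial, ofLp_toEuclideanLin,
    ofLp_toEuclideanLin, ← h, EuclideanSpace.norm_sq_eq]
  congr 2
  · rw [show P * B * Bᵀ * P = (Bᵀ * P)ᵀ * (Bᵀ * P) by
      rw [Matrix.transpose_mul, hP, Matrix.transpose_transpose]; simp only [Matrix.mul_assoc],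
      ← Matrix.mulVec_mulVec, Matrix.dotProduct_transpose_mulVec']
    simp [dotProduct, feedback, sq]
  · simp [dotProduct, sq]

theorem inner_coupling (x : EuclideanSpace ℝ (Fin q))
    (y : Fin N → EuclideanSpace ℝ (Fin q)) (i : Fin N) :
    inner ℝ (P.toEuclideanLin x) (coupling 𝒢 g (fun j => (B * Bᵀ * P).toEuclideanLin (y j)) i)
      = -(feedback B P x * (𝒢.laplacian *ᵥ fun j => g j * feedback B P (y j)) i) := by
  rw [coupling, inner_sum, WeightedDigraph.laplacian_mulVec_apply, Finset.mul_sum,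
    ← Finset.sum_neg_distrib]
  refine Finset.sum_congr rfl fun j _ => ?_
  rw [inner_smul_right, inner_sub_right, inner_smul_right, inner_smul_right,
    inner_toEuclideanLin_input, inner_toEuclideanLin_input]
  ring

theorem dotProduct_symLaplacian_mulVec (r z : Fin N → ℝ) :
    z ⬝ᵥ (𝒢.symLaplacian r *ᵥ z) = 2 * ∑ i, r i * z i * (𝒢.laplacian *ᵥ z) i := by
  have h := lyapunov_quadratic 𝒢.laplacian (Matrix.diagonal r) (Matrix.diagonal_transpose r) z
  rw [WeightedDigraph.symLaplacian, add_comm, h]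
  congr 1
  exact Finset.sum_congr rfl fun i _ => by rw [Matrix.mulVec_diagonal]; ring

/-- Cauchy–Schwarz after recognizing the vector paired with `z` as the Kronecker matrix in `ρ`
applied to the stacked errors. -/
theorem cross_term_le (r z : Fin N → ℝ) (e : Fin N → EuclideanSpace ℝ (Fin q)) :
    (∑ i, r i * z i * (𝒢.laplacian *ᵥ fun j => g j * feedback B P (e j)) i) ^ 2
      ≤ ‖(Matrix.diagonal r * 𝒢.laplacian * Matrix.diagonal g) ⊗ₖ (Bᵀ * P)‖ ^ 2
        * (∑ i, ‖e i‖ ^ 2) * ∑ i, z i ^ 2 := by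
  set K := (Matrix.diagonal r * 𝒢.laplacian * Matrix.diagonal g) ⊗ₖ (Bᵀ * P)
  set ε : Fin N × Fin q → ℝ := fun x => e x.1 x.2
  have hK : ∀ i, (K *ᵥ ε) (i, 0) = r i * (𝒢.laplacian *ᵥ fun j => g j * feedback B P (e j)) i := by
    intro i
    simp only [K, ε, Matrix.mulVec, dotProduct, Matrix.kroneckerMap_apply, Fintype.sum_prod_type,
      feedback, Finset.mul_sum, Matrix.mul_diagonal, Matrix.diagonal_mul]
    refine Finset.sum_congr rfl fun j _ => Finset.sum_congr rfl fun a _ => ?_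
    ring
  have h1 := dotProduct_mulVec_self_le K ε
  have h2 : (K *ᵥ ε) ⬝ᵥ (K *ᵥ ε)
      = ∑ i, (r i * (𝒢.laplacian *ᵥ fun j => g j * feedback B P (e j)) i) ^ 2 := by
    simp only [dotProduct, Fintype.sum_prod_type, Fin.sum_univ_one, Fin.isValue, hK, sq]
  have h3 : ε ⬝ᵥ ε = ∑ i, ‖e i‖ ^ 2 := by
    simp only [dotProduct, Fintype.sum_prod_type, EuclideanSpace.norm_sq_eq, ε, Real.norm_eq_abs,
      sq_abs]
    simp only [sq]
  rw [h2, h3] at h1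
  have h4 := Finset.sum_mul_sq_le_sq_mul_sq Finset.univ
    (fun i => r i * (𝒢.laplacian *ᵥ fun j => g j * feedback B P (e j)) i) z
  calc _ = (∑ i, r i * (𝒢.laplacian *ᵥ fun j => g j * feedback B P (e j)) i * z i) ^ 2 := by
        congr 1; exact Finset.sum_congr rfl fun i _ => by ring
    _ ≤ _ := h4.trans (mul_le_mul_of_nonneg_right h1 (Finset.sum_nonneg fun i _ => sq_nonneg _))

theorem lyapunov_rate_le {hN : 2 ≤ N} {r : Fin N → ℝ} (hr : r ᵥ* 𝒢.laplacian = 0)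
    (hr0 : ∀ i, 0 < r i) (hg : ∀ i, r i ≤ g i) {lam : ℝ} (hlam0 : 0 < lam)
    (hlam : lam < lambdaTwo hN 𝒢 r / N) (hP : Pᵀ = P)
    (hR : SolvesRiccati A B lam (riccatiBeta hN g r) P)
    {p y : Fin N → EuclideanSpace ℝ (Fin q)} (hp : ∑ i, r i • p i = 0) :
    ∑ i, r i * g i * (2 * inner ℝ (P.toEuclideanLin (p i)) (relRate 𝒢 g A B P p y i))
      ≤ -(∑ i, ‖p i‖ ^ 2) + rhoConst hN 𝒢 r g lam B P ^ 2 * ∑ i, ‖y i - p i‖ ^ 2 := by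
  have hg0 : ∀ i, 0 < g i := fun i => (hr0 i).trans_le (hg i)
  have hN0 : (0 : ℝ) < N := by exact_mod_cast (by omega : 0 < N)
  have hl2 : 0 < lambdaTwo hN 𝒢 r := by
    have := hlam0.trans hlam
    rwa [lt_div_iff₀ hN0, zero_mul] at this
  set k : Fin N → ℝ := fun i => feedback B P (p i) with hk
  set z : Fin N → ℝ := fun i => g i * k i with hz
  set e : Fin N → EuclideanSpace ℝ (Fin q) := fun i => y i - p i with he
  set ζ : Fin N → ℝ := fun j => g j * feedback B P (e j) with hζ
  have hy : (fun j => g j * feedback B P (y j)) = z + ζ := by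
    ext j
    have : y j = p j + e j := by simp [he]
    rw [this, feedback_add]
    simp only [hz, hk, hζ, Pi.add_apply]
    ring
  have hterm : ∀ i, r i * g i * (2 * inner ℝ (P.toEuclideanLin (p i)) (relRate 𝒢 g A B P p y i))
      = lam * (r i * g i * k i ^ 2) - (r i * g i * riccatiBeta hN g r) * ‖p i‖ ^ 2
        - 2 * (r i * z i * (𝒢.laplacian *ᵥ z) i) - 2 * (r i * z i * (𝒢.laplacian *ᵥ ζ) i) := by
    intro i
    rw [relRate, inner_add_right, mul_add, two_mul_inner_drift hP hR, inner_coupling, hy,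
      Matrix.mulVec_add, Pi.add_apply]
    simp only [hz, hk]
    ring
  simp only [hterm, Finset.sum_sub_distrib, ← Finset.mul_sum]
  have h1 : ∑ i, r i * g i * k i ^ 2 ≤ ∑ i, z i ^ 2 := by
    refine Finset.sum_le_sum fun i _ => ?_
    rw [hz, mul_pow, sq (g i)]
    have := mul_le_mul_of_nonneg_right (hg i) (hg0 i).le
    exact mul_le_mul_of_nonneg_right this (sq_nonneg _)
  have h2 : ∑ i, ‖p i‖ ^ 2 ≤ ∑ i, r i * g i * riccatiBeta hN g r * ‖p i‖ ^ 2 :=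
    Finset.sum_le_sum fun i _ =>
      le_mul_of_one_le_left (sq_nonneg _) (one_le_mul_riccatiBeta hr0 hg0 i)
  have h3 : lambdaTwo hN 𝒢 r / N * ∑ i, z i ^ 2 ≤ 2 * ∑ i, r i * z i * (𝒢.laplacian *ᵥ z) i := by
    rw [← dotProduct_symLaplacian_mulVec]
    -- The weights `r i / g i` undo the gains in `z`, so the pairing is the feedback of `∑ r_i p_i`,
    -- which is zero.
    refine lambdaTwo_div_mul_le hr hl2 (c := fun i => r i / g i)
      (fun i => div_pos (hr0 i) (hg0 i)) ?_
    have : ∑ i, r i / g i * z i = feedback B P (∑ i, r i • p i) := by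
      rw [feedback_sum]
      refine Finset.sum_congr rfl fun i _ => ?_
      rw [feedback_smul]
      simp only [hz, hk]
      field_simp [(hg0 i).ne']
    rw [this, hp]
    simp [feedback]
  have h4 := cross_term_le (𝒢 := 𝒢) (g := g) (B := B) (P := P) r z e
  change (∑ i, r i * z i * (𝒢.laplacian *ᵥ ζ) i) ^ 2 ≤ _ at h4
  set X := ∑ i, r i * z i * (𝒢.laplacian *ᵥ ζ) i
  set δ := lambdaTwo hN 𝒢 r / N - lam with hδ
  have hδ0 : 0 < δ := sub_pos.2 hlam
  have hρ : rhoConst hN 𝒢 r g lam B P ^ 2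
      = ‖(Matrix.diagonal r * 𝒢.laplacian * Matrix.diagonal g) ⊗ₖ (Bᵀ * P)‖ ^ 2 / δ := by
    rw [rhoConst, div_pow, Real.sq_sqrt hδ0.le]
  rw [hρ]
  set ν := ‖(Matrix.diagonal r * 𝒢.laplacian * Matrix.diagonal g) ⊗ₖ (Bᵀ * P)‖
  set Z := ∑ i, z i ^ 2 with hZ
  have hZ0 : 0 ≤ Z := Finset.sum_nonneg fun i _ => sq_nonneg _
  set W := ∑ i, ‖e i‖ ^ 2
  -- Young's inequality, weighted so that the `Z` part uses up exactly the surplus `δ = λ₂/N - lam`;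
  -- the other part is `ρ²` times the squared error.
  have h5 : -2 * X ≤ δ * Z + ν ^ 2 / δ * W := by
    have hW0 : 0 ≤ ν ^ 2 / δ * W :=
      mul_nonneg (by positivity) (Finset.sum_nonneg fun i _ => sq_nonneg _)
    refine abs_le_of_sq_le_sq' ?_ (by positivity) |>.2
    have h6 : ν ^ 2 * W * Z = (δ * Z) * (ν ^ 2 / δ * W) := by field_simp
    nlinarith [sq_nonneg (δ * Z - ν ^ 2 / δ * W)]
  have h7 : lam * ∑ i, r i * g i * k i ^ 2 ≤ lam * Z := mul_le_mul_of_nonneg_left h1 hlam0.le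
  have h8 : lambdaTwo hN 𝒢 r / N * Z = δ * Z + lam * Z := by rw [hδ]; ring
  linarith

/-- The relative measurements of a configuration `x`. -/
def relMap (𝒢 : WeightedDigraph N) (x : Fin N → EuclideanSpace ℝ (Fin q)) (i : Fin N) :
    EuclideanSpace ℝ (Fin q) := ∑ j, 𝒢.weight i j • (x j - x i)

theorem relMap_apply (x : Fin N → EuclideanSpace ℝ (Fin q)) (i : Fin N) (a : Fin q) :
    relMap 𝒢 x i a = -(𝒢.laplacian *ᵥ fun j => x j a) i := by
  rw [WeightedDigraph.laplacian_mulVec_apply, ← Finset.sum_neg_distrib]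
  simp only [relMap, WithLp.ofLp_sum, Finset.sum_apply, PiLp.smul_apply, PiLp.sub_apply,
    smul_eq_mul]
  exact Finset.sum_congr rfl fun j _ => by ring

theorem sum_smul_relMap {r : Fin N → ℝ} (hr : r ᵥ* 𝒢.laplacian = 0)
    (x : Fin N → EuclideanSpace ℝ (Fin q)) : ∑ i, r i • relMap 𝒢 x i = 0 := by
  ext a
  have h : r ⬝ᵥ (𝒢.laplacian *ᵥ fun j => x j a) = 0 := by
    rw [Matrix.dotProduct_mulVec, hr, zero_dotProduct]
  simp only [WithLp.ofLp_sum, Finset.sum_apply, PiLp.smul_apply, relMap_apply, smul_eq_mul,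
    mul_neg, Finset.sum_neg_distrib, PiLp.zero_apply, neg_eq_zero]
  exact h

/-- The mean of a configuration. -/
def configMean (x : Fin N → EuclideanSpace ℝ (Fin q)) : EuclideanSpace ℝ (Fin q) :=
  (N : ℝ)⁻¹ • ∑ i, x i

/-- The disagreement of a configuration is controlled by its relative measurements. -/
theorem stackNorm_sub_mean_le {hN : 2 ≤ N} {r : Fin N → ℝ} (hr : r ᵥ* 𝒢.laplacian = 0)
    (hr0 : ∀ i, 0 < r i) (hr1 : ∑ i, r i = 1) (hl2 : 0 < lambdaTwo hN 𝒢 r)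
    (x : Fin N → EuclideanSpace ℝ (Fin q)) :
    stackNorm (fun i => x i - configMean x)
      ≤ 2 / lambdaTwo hN 𝒢 r * stackNorm (relMap 𝒢 x) := by
  have hN0 : (0 : ℝ) < N := by exact_mod_cast (by omega : 0 < N)
  refine abs_le_of_sq_le_sq' ?_ (mul_nonneg (by positivity) (stackNorm_nonneg _)) |>.2
  rw [mul_pow, stackNorm_sq, stackNorm_sq]
  simp only [EuclideanSpace.norm_sq_eq, Real.norm_eq_abs, sq_abs]
  rw [Finset.sum_comm, Finset.sum_comm (f := fun i a => (relMap 𝒢 x i a) ^ 2), Finset.mul_sum]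
  refine Finset.sum_le_sum fun a _ => ?_
  set l2 := lambdaTwo hN 𝒢 r
  set y : Fin N → ℝ := fun i => (x i - configMean x) a with hy
  have hLy : 𝒢.laplacian *ᵥ y = fun i => -relMap 𝒢 x i a := by
    ext i
    rw [relMap_apply, neg_neg, WeightedDigraph.laplacian_mulVec_apply,
      WeightedDigraph.laplacian_mulVec_apply]
    exact Finset.sum_congr rfl fun j _ => by simp [hy]
  have hsum : ∑ i, y i = 0 := by
    simp only [hy, configMean, PiLp.sub_apply, PiLp.smul_apply, WithLp.ofLp_sum, Finset.sum_apply,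
      Finset.sum_sub_distrib, smul_eq_mul, Finset.sum_const, Finset.card_univ, Fintype.card_fin,
      nsmul_eq_mul]
    rw [← mul_assoc, mul_inv_cancel₀ hN0.ne', one_mul, sub_self]
  have h := sq_sub_mean_le hr hl2 y
  rw [hsum, dotProduct_symLaplacian_mulVec, hLy] at h
  have hrle : ∀ i, r i ≤ 1 := fun i => by
    rw [← hr1]
    exact Finset.single_le_sum (f := r) (fun j _ => (hr0 j).le) (Finset.mem_univ i)
  -- Young's inequality with weight `l2 / 2`, so that half of the spectral gap remains on the left;
  -- `r i ≤ 1` removes the weights.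
  have hcross : 2 * ∑ i, r i * y i * -relMap 𝒢 x i a
      ≤ l2 / 2 * ∑ i, y i ^ 2 + 2 / l2 * ∑ i, relMap 𝒢 x i a ^ 2 := by
    rw [Finset.mul_sum, Finset.mul_sum, Finset.mul_sum, ← Finset.sum_add_distrib]
    refine Finset.sum_le_sum fun i _ => ?_
    set u := y i
    set w := relMap 𝒢 x i a
    have h1 : 2 * (u * -w) ≤ l2 / 2 * u ^ 2 + 2 / l2 * w ^ 2 := by
      have : 0 ≤ (l2 * u + 2 * w) ^ 2 / (2 * l2) := by positivity
      have e : (l2 * u + 2 * w) ^ 2 / (2 * l2) = l2 / 2 * u ^ 2 + 2 / l2 * w ^ 2 + 2 * (u * w) := by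
        field_simp
        ring
      linarith
    have h0 : 0 ≤ l2 / 2 * u ^ 2 + 2 / l2 * w ^ 2 := by positivity
    have h2 := mul_le_mul_of_nonneg_left h1 (hr0 i).le
    have h3 := mul_le_mul_of_nonneg_right (hrle i) h0
    linarith
  have hyy : y ⬝ᵥ y = ∑ i, y i ^ 2 := Finset.sum_congr rfl fun i _ => (sq _).symm
  rw [hyy] at h
  have h2 : l2 / 2 * ∑ i, y i ^ 2 ≤ 2 / l2 * ∑ i, relMap 𝒢 x i a ^ 2 := by
    have : l2 * (∑ i, y i ^ 2 - 0 ^ 2 / (N : ℝ)) = l2 * ∑ i, y i ^ 2 := by simp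
    rw [this] at h
    linarith
  have h3 := mul_le_mul_of_nonneg_left h2 (by positivity : 0 ≤ 2 / l2)
  calc ∑ i, y i ^ 2 = 2 / l2 * (l2 / 2 * ∑ i, y i ^ 2) := by field_simp
    _ ≤ _ := h3
    _ = _ := by rw [← mul_assoc, ← sq]

end Static

/-! ### Right-continuous step functions -/

section Step

variable {E : Type*} [NormedAddCommGroup E]

/-- A function that is locally constant to the right of every `t ≥ 0` and integrable on bounded
intervals of `[0, ∞)`. -/
structure IsStep (f : ℝ → E) : Prop where
  eventually_eq : ∀ t, 0 ≤ t → ∀ᶠ s in 𝓝[≥] t, f s = f t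
  intervalIntegrable_zero : ∀ t, 0 ≤ t → IntervalIntegrable f MeasureTheory.volume 0 t

theorem intervalIntegrable_of_partition {f : ℝ → E} {τ : ℕ → ℝ} {n : ℕ}
    (hτ : ∀ k < n, τ k ≤ τ (k + 1)) (h : ∀ k < n, ∃ c, ∀ s ∈ Set.Ioo (τ k) (τ (k + 1)), f s = c) :
    IntervalIntegrable f MeasureTheory.volume (τ 0) (τ n) := by
  refine IntervalIntegrable.trans_iterate fun k hk => ?_
  obtain ⟨c, hc⟩ := h k hk
  refine (intervalIntegrable_const (c := c)).congr_uIoo fun s hs => ?_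
  rw [Set.uIoo_of_le (hτ k hk)] at hs
  exact (hc s hs).symm

namespace IsStep

theorem intervalIntegrable {f : ℝ → E} (hf : IsStep f) {a b : ℝ} (ha : 0 ≤ a) (hb : 0 ≤ b) :
    IntervalIntegrable f MeasureTheory.volume a b :=
  (hf.intervalIntegrable_zero a ha).symm.trans (hf.intervalIntegrable_zero b hb)

theorem hasDerivWithinAt_integral [NormedSpace ℝ E] [CompleteSpace E] {f : ℝ → E} (hf : IsStep f)
    {a t : ℝ} (ha : 0 ≤ a) (ht : 0 ≤ t) :
    HasDerivWithinAt (fun u => ∫ x in a..u, f x) (f t) (Set.Ici t) t := by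
  refine intervalIntegral.integral_hasDerivWithinAt_right (hf.intervalIntegrable ha ht)
    (t := Set.Ioi t) ?_ ?_
  · refine ⟨Set.Ioc t (t + 1), ?_, ?_⟩
    · exact Ioc_mem_nhdsGT (by linarith)
    · exact (hf.intervalIntegrable ht (by linarith : 0 ≤ t + 1)).1.aestronglyMeasurable
  · have h : ∀ᶠ s in 𝓝[>] t, f s = f t :=
      (hf.eventually_eq t ht).filter_mono (nhdsWithin_mono t Set.Ioi_subset_Ici_self)
    exact tendsto_nhds_of_eventually_eq h

theorem continuousOn_integral [NormedSpace ℝ E] {f : ℝ → E} (hf : IsStep f) {a b : ℝ}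
    (ha : 0 ≤ a) (hab : a ≤ b) : ContinuousOn (fun u => ∫ x in a..u, f x) (Set.Icc a b) := by
  have h := intervalIntegral.continuousOn_primitive_interval'
    (hf.intervalIntegrable ha (ha.trans hab)) (a := a) Set.left_mem_uIcc
  rwa [Set.uIcc_of_le hab] at h

end IsStep

/-- The first time at which the running integral of a nonnegative step function from `T` on
reaches `s` is at most `t - T` if and only if the integral up to `t` is at least `s`. -/
theorem sInf_integral_le_iff {f : ℝ → ℝ} (hf : IsStep f) (hf0 : ∀ x, 0 ≤ f x) {T t s : ℝ}
    (hT : 0 ≤ T) (hTt : T ≤ t) (hs : 0 ≤ s) :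
    sInf (ENNReal.ofReal '' {u : ℝ | 0 ≤ u ∧ ∫ τ in T..(T + u), f τ = s}) ≤ ENNReal.ofReal (t - T)
      ↔ s ≤ ∫ τ in T..t, f τ := by
  constructor
  · intro h
    by_contra! hlt
    have hcont := hf.continuousOn_integral hT (by linarith : T ≤ t + 1)
    -- A bound below `s` persists slightly beyond `t` by continuity. Since the running integral is
    -- nondecreasing, every hitting time exceeds a fixed `w - T > t - T`, and so does the infimum;
    -- this covers the empty set, where the infimum is `∞`.
    have hev : ∀ᶠ u in 𝓝[>] t, ∫ τ in T..u, f τ < s := by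
      have h1 : ContinuousWithinAt (fun u => ∫ τ in T..u, f τ) (Set.Icc T (t + 1)) t :=
        hcont t ⟨hTt, by linarith⟩
      have h2 : ∀ᶠ u in 𝓝[Set.Icc T (t + 1)] t, ∫ τ in T..u, f τ < s := h1.eventually_lt_const hlt
      refine h2.filter_mono ?_
      rw [← nhdsWithin_Ioc_eq_nhdsGT (by linarith : t < t + 1)]
      exact nhdsWithin_mono t fun x hx => ⟨hTt.trans hx.1.le, hx.2⟩
    obtain ⟨w, hw, htw⟩ := (hev.and self_mem_nhdsWithin).exists
    have htw : t < w := htw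
    have hle : ENNReal.ofReal (w - T)
        ≤ sInf (ENNReal.ofReal '' {u : ℝ | 0 ≤ u ∧ ∫ τ in T..(T + u), f τ = s}) := by
      refine le_sInf ?_
      rintro _ ⟨u, ⟨hu0, hu⟩, rfl⟩
      refine ENNReal.ofReal_le_ofReal ?_
      by_contra! hlt2
      have h3 := intervalIntegral.integral_add_adjacent_intervals
        (hf.intervalIntegrable hT (by linarith : 0 ≤ T + u))
        (hf.intervalIntegrable (by linarith : 0 ≤ T + u) (by linarith : 0 ≤ w))
      have h4 : 0 ≤ ∫ τ in (T + u)..w, f τ :=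
        intervalIntegral.integral_nonneg (by linarith) fun x _ => hf0 x
      linarith
    have := hle.trans h
    rw [ENNReal.ofReal_le_ofReal_iff (by linarith)] at this
    linarith
  · intro h
    have hivt := intermediate_value_Icc hTt (hf.continuousOn_integral hT hTt)
    obtain ⟨u, hu, hus⟩ := hivt (show s ∈ _ from ⟨by simpa using hs, h⟩)
    have hmem : u - T ∈ {u : ℝ | 0 ≤ u ∧ ∫ τ in T..(T + u), f τ = s} :=
      ⟨by linarith [hu.1], by simpa using hus⟩
    exact (sInf_le (Set.mem_image_of_mem ENNReal.ofReal hmem)).trans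
      (ENNReal.ofReal_le_ofReal (by linarith [hu.2]))

end Step

/-! ### The trigger rule as an integral inequality -/

section Trigger

variable {N q : ℕ} {𝒢 : WeightedDigraph N} {g : Fin N → ℝ} {A : Matrix (Fin q) (Fin q) ℝ}
  {B : Matrix (Fin q) (Fin 1) ℝ} {P : Matrix (Fin q) (Fin q) ℝ} {ηi : Fin N → ℝ}
  {pc : Fin N → ℝ → EuclideanSpace ℝ (Fin q)}

theorem triggerRate_nonneg (hη : ∀ i, 0 < ηi i) (i : Fin N) (x : EuclideanSpace ℝ (Fin q))
    (τ : ℝ) : 0 ≤ triggerRate 𝒢 g A B P ηi pc i x τ := by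
  have := hη i
  unfold triggerRate
  positivity

theorem isStep_triggerRate (hpc : ∀ i, IsStep (pc i)) (i : Fin N)
    (x : EuclideanSpace ℝ (Fin q)) : IsStep (triggerRate 𝒢 g A B P ηi pc i x) := by
  constructor
  · intro t ht
    have h : ∀ᶠ s in 𝓝[≥] t, ∀ j, pc j s = pc j t :=
      Filter.eventually_all.2 fun j => (hpc j).eventually_eq t ht
    filter_upwards [h] with s hs
    simp only [triggerRate, hs]
  · intro t ht
    refine intervalIntegrable_const.add (IntervalIntegrable.norm ?_)
    have h : IntervalIntegrable (fun τ => ∑ j, (𝒢.weight i j * g j) • pc j τ)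
        MeasureTheory.volume 0 t := by
      have := IntervalIntegrable.sum (μ := MeasureTheory.volume) (a := 0) (b := t) Finset.univ
        (f := fun j τ => (𝒢.weight i j * g j) • pc j τ)
        fun j _ => ((hpc j).intervalIntegrable_zero t ht).smul (𝒢.weight i j * g j)
      have e : (fun τ => ∑ j, (𝒢.weight i j * g j) • pc j τ)
          = ∑ j, fun τ => (𝒢.weight i j * g j) • pc j τ := by
        ext1 τ; rw [Finset.sum_apply]
      rw [e]
      exact this
    let Lc := LinearMap.toContinuousLinearMap (B * Bᵀ * P).toEuclideanLin
    exact ⟨Lc.integrable_comp h.1, Lc.integrable_comp h.2⟩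

/-- The next event after one at time `T` has occurred by time `t` if and only if the dwell time
has elapsed and the trigger integral has reached its threshold. -/
theorem next_event_le_iff (hpc : ∀ i, IsStep (pc i)) (hη : ∀ i, 0 < ηi i) (i : Fin N)
    (x : EuclideanSpace ℝ (Fin q)) {T t b : ℝ} (hT : 0 ≤ T) (hTt : T ≤ t) :
    ENNReal.ofReal T + max (triggerDelay 𝒢 g A B P ηi pc i T x) (ENNReal.ofReal b)
        ≤ ENNReal.ofReal t
      ↔ T + b ≤ t ∧ ηi i / (1 + ηi i) * ‖x‖ ≤ ∫ τ in T..t, triggerRate 𝒢 g A B P ηi pc i x τ := by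
  have hη' := hη i
  have ht : ENNReal.ofReal t = ENNReal.ofReal T + ENNReal.ofReal (t - T) := by
    rw [← ENNReal.ofReal_add hT (by linarith)]; congr 1; ring
  rw [ht, ENNReal.add_le_add_iff_left ENNReal.ofReal_ne_top, max_le_iff, triggerDelay,
    sInf_integral_le_iff (isStep_triggerRate hpc i x) (triggerRate_nonneg hη i x) hT hTt
      (by positivity), ENNReal.ofReal_le_ofReal_iff (by linarith), and_comm]
  exact and_congr_left' ⟨fun h => by linarith, fun h => by linarith⟩

end Trigger

/-! ### Trajectories of the closed loop -/

namespace IsClosedLoop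

variable {N q : ℕ} {𝒢 : WeightedDigraph N} {g : Fin N → ℝ} {A : Matrix (Fin q) (Fin q) ℝ}
  {B : Matrix (Fin q) (Fin 1) ℝ} {P : Matrix (Fin q) (Fin q) ℝ} {ηi : Fin N → ℝ} {b : ℝ}
  {v : Fin N → ℝ → EuclideanSpace ℝ (Fin q)} {te : Fin N → ℕ → ℝ≥0∞}
  {pc : Fin N → ℝ → EuclideanSpace ℝ (Fin q)}

section Events

variable (h : IsClosedLoop 𝒢 g A B P ηi b v te pc)

include h

theorem add_dwell_le (i : Fin N) (k : ℕ) : te i k + ENNReal.ofReal b ≤ te i (k + 1) := by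
  rw [h.event_succ]
  gcongr
  exact le_max_right _ _

theorem event_le_succ (i : Fin N) (k : ℕ) : te i k ≤ te i (k + 1) :=
  le_self_add.trans (h.add_dwell_le i k)

theorem mul_dwell_le (i : Fin N) (k : ℕ) : k * ENNReal.ofReal b ≤ te i k := by
  induction k with
  | zero => simp
  | succ k ih =>
    refine le_trans ?_ (h.add_dwell_le i k)
    rw [Nat.cast_succ, add_mul, one_mul]
    gcongr

theorem exists_lt_event (hb : 0 < b) (i : Fin N) {t : ℝ} (ht : 0 ≤ t) :
    ∃ k, ENNReal.ofReal t < te i k := by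
  obtain ⟨k, hk⟩ := exists_nat_gt (t / b)
  refine ⟨k, lt_of_lt_of_le ?_ (h.mul_dwell_le i k)⟩
  rw [div_lt_iff₀ hb] at hk
  rw [← ENNReal.ofReal_natCast, ← ENNReal.ofReal_mul (Nat.cast_nonneg k)]
  exact (ENNReal.ofReal_lt_ofReal_iff_of_nonneg ht).2 hk

theorem exists_index (hb : 0 < b) (i : Fin N) {t : ℝ} (ht : 0 ≤ t) :
    ∃ k, te i k ≤ ENNReal.ofReal t ∧ ENNReal.ofReal t < te i (k + 1) := by
  classical
  have hex := h.exists_lt_event hb i ht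
  have hne : Nat.find hex ≠ 0 := fun h0 => by
    have := Nat.find_spec hex
    rw [h0, h.event_zero] at this
    exact not_lt_bot this
  obtain ⟨k, hk⟩ := Nat.exists_eq_succ_of_ne_zero hne
  refine ⟨k, not_lt.1 (Nat.find_min hex (by omega)), ?_⟩
  have := Nat.find_spec hex
  rwa [hk] at this

theorem isStep_sampled (hb : 0 < b) (i : Fin N) : IsStep (pc i) := by
  constructor
  · intro t ht
    obtain ⟨k, hk1, hk2⟩ := h.exists_index hb i ht
    have hev : ∀ᶠ s in 𝓝[≥] t, ENNReal.ofReal s < te i (k + 1) :=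
      (ENNReal.continuous_ofReal.tendsto t).eventually_lt_const hk2 |>.filter_mono
        nhdsWithin_le_nhds
    filter_upwards [hev, self_mem_nhdsWithin] with s hs hts
    have hts : t ≤ s := hts
    rw [h.sampled i k t ht hk1 hk2,
      h.sampled i k s (ht.trans hts) (hk1.trans (ENNReal.ofReal_le_ofReal hts)) hs]
  · intro t ht
    obtain ⟨n, hn⟩ := h.exists_lt_event hb i ht
    -- Capping the event times at `t` makes them finite, so a last event time equal to `∞` needs no
    -- separate case.
    set τ : ℕ → ℝ := fun k => (min (te i k) (ENNReal.ofReal t)).toReal with hτ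
    have hfin : ∀ k, min (te i k) (ENNReal.ofReal t) ≠ ⊤ := fun k =>
      ne_top_of_le_ne_top ENNReal.ofReal_ne_top (min_le_right _ _)
    have h0 : τ 0 = 0 := by simp [hτ, h.event_zero]
    have hn' : τ n = t := by
      simp only [hτ]
      rw [min_eq_right hn.le, ENNReal.toReal_ofReal ht]
    rw [← h0, ← hn']
    refine intervalIntegrable_of_partition (fun k _ => ?_) fun k _ =>
      ⟨relMeas 𝒢 v i (te i k).toReal, fun s hs => ?_⟩
    · exact ENNReal.toReal_mono (hfin _) (min_le_min_right _ (h.event_le_succ i k))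
    · have hs0 : 0 ≤ s := ENNReal.toReal_nonneg.trans hs.1.le
      have h1 := (ENNReal.lt_ofReal_iff_toReal_lt (hfin k)).2 hs.1
      have h2 := (ENNReal.ofReal_lt_iff_lt_toReal hs0 (hfin (k + 1))).2 hs.2
      have h3 : te i k ≤ ENNReal.ofReal s := by
        rcases le_total (te i k) (ENNReal.ofReal t) with hle | hle
        · rw [min_eq_left hle] at h1; exact h1.le
        · rw [min_eq_right hle] at h1
          exact absurd (h2.trans_le (min_le_right _ _)) (not_lt.2 h1.le)
      exact h.sampled i k s hs0 h3 (h2.trans_le (min_le_left _ _))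

end Events

section Dynamics

variable (h : IsClosedLoop 𝒢 g A B P ηi b v te pc)

include h

theorem continuousOn_relMeas (i : Fin N) : ContinuousOn (relMeas 𝒢 v i) (Set.Ici 0) := by
  unfold relMeas
  exact continuousOn_finsetSum _ fun j _ =>
    ((h.continuousOn j).sub (h.continuousOn i)).const_smul (𝒢.weight i j)

theorem hasDerivWithinAt_state (i : Fin N) {t : ℝ} (ht : 0 ≤ t) :
    HasDerivWithinAt (v i) (A.toEuclideanLin (v i t)
      + g i • (B * Bᵀ * P).toEuclideanLin (pc i t)) (Set.Ici t) t := by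
  have h1 := h.dynamics i t ht
  have e : B.toEuclideanLin (g i • (Bᵀ * P).toEuclideanLin (pc i t))
      = g i • (B * Bᵀ * P).toEuclideanLin (pc i t) := by
    rw [map_smul, Matrix.mul_assoc]
    congr 1
    ext a
    simp only [ofLp_toEuclideanLin, Matrix.mulVec_mulVec]
  rwa [e] at h1

theorem hasDerivWithinAt_relMeas (i : Fin N) {t : ℝ} (ht : 0 ≤ t) :
    HasDerivWithinAt (relMeas 𝒢 v i)
      (relRate 𝒢 g A B P (fun j => relMeas 𝒢 v j t) (fun j => pc j t) i) (Set.Ici t) t := by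
  have h1 : HasDerivWithinAt (relMeas 𝒢 v i) (∑ j, 𝒢.weight i j •
      ((A.toEuclideanLin (v j t) + g j • (B * Bᵀ * P).toEuclideanLin (pc j t))
        - (A.toEuclideanLin (v i t) + g i • (B * Bᵀ * P).toEuclideanLin (pc i t))))
      (Set.Ici t) t := by
    unfold relMeas
    exact HasDerivWithinAt.fun_sum fun j _ =>
      ((h.hasDerivWithinAt_state j ht).sub (h.hasDerivWithinAt_state i ht)).const_smul
      (𝒢.weight i j)
  convert h1 using 1
  rw [relRate, coupling, relMeas, map_sum, ← Finset.sum_add_distrib]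
  refine Finset.sum_congr rfl fun j _ => ?_
  rw [map_smul, map_sub, ← smul_add]
  congr 1
  abel

/-- Before the trigger integral reaches its threshold, the sampling error is relatively small. -/
theorem error_le_of_integral_lt (hb : 0 < b) (hη : ∀ i, 0 < ηi i) (i : Fin N) (k : ℕ) {t : ℝ}
    (hk : te i k ≤ ENNReal.ofReal t) (hk' : ENNReal.ofReal t < te i (k + 1)) (ht : 0 ≤ t)
    (hint : ∫ τ in (te i k).toReal..t,
        triggerRate 𝒢 g A B P ηi pc i (relMeas 𝒢 v i (te i k).toReal) τ
      < ηi i / (1 + ηi i) * ‖relMeas 𝒢 v i (te i k).toReal‖) :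
    ‖pc i t - relMeas 𝒢 v i t‖ ≤ ηi i * ‖relMeas 𝒢 v i t‖ := by
  have hη' := hη i
  set T := (te i k).toReal with hT
  set x := relMeas 𝒢 v i T with hx
  set s := ηi i / (1 + ηi i) * ‖x‖ with hs
  have hT0 : 0 ≤ T := ENNReal.toReal_nonneg
  have hTtop : te i k ≠ ⊤ := ne_top_of_le_ne_top ENNReal.ofReal_ne_top hk
  have hTt : T ≤ t := by
    rw [hT, ← ENNReal.toReal_ofReal ht]
    exact ENNReal.toReal_mono ENNReal.ofReal_ne_top hk
  have hTe : te i k = ENNReal.ofReal T := (ENNReal.ofReal_toReal hTtop).symm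
  have hpcx : ∀ u ∈ Set.Icc T t, pc i u = x := fun u hu =>
    h.sampled i k u (hT0.trans hu.1) (by rw [hTe]; exact ENNReal.ofReal_le_ofReal hu.1)
      ((ENNReal.ofReal_le_ofReal hu.2).trans_lt hk')
  set F : ℝ → ℝ := triggerRate 𝒢 g A B P ηi pc i x with hF
  have hstep : IsStep F := isStep_triggerRate (fun j => h.isStep_sampled hb j) i x
  -- The slack makes the comparison of derivatives strict, and is small enough that the barrier
  -- stays below `s` up to time `t`. The strict comparison principle then needs the derivative bound
  -- only where the error norm meets the barrier; there the error is at most `s`, exactly what the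
  -- term `‖A‖ s` of the trigger rate presumes.
  obtain ⟨ε, hε0, hε⟩ : ∃ ε : ℝ, 0 < ε ∧ (∫ τ in T..t, F τ) + ε * (t - T) ≤ s := by
    refine ⟨(s - ∫ τ in T..t, F τ) / (t - T + 1), div_pos (by linarith) (by linarith), ?_⟩
    have h1 : (t - T) / (t - T + 1) ≤ 1 := (div_le_one (by linarith)).2 (by linarith)
    have h2 : 0 < s - ∫ τ in T..t, F τ := by linarith
    have h3 := mul_le_mul_of_nonneg_left h1 h2.le
    rw [div_mul_eq_mul_div, mul_div_assoc]
    linarith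
  have hF0 : ∀ τ, 0 ≤ F τ := triggerRate_nonneg hη i x
  have hmain : ∀ u ∈ Set.Icc T t, ‖relMeas 𝒢 v i u - x‖ ≤ (∫ τ in T..u, F τ) + ε * (u - T) := by
    refine image_norm_le_of_norm_deriv_right_lt_deriv_boundary'
      (f' := fun u => relRate 𝒢 g A B P (fun j => relMeas 𝒢 v j u) (fun j => pc j u) i)
      (B' := fun u => F u + ε) ?_ ?_ ?_ ?_ ?_ ?_
    · exact ((h.continuousOn_relMeas i).mono fun u hu => hT0.trans hu.1).sub continuousOn_const
    · intro u hu
      exact (h.hasDerivWithinAt_relMeas i (hT0.trans hu.1)).sub_const x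
    · simp [hx]
    · exact (hstep.continuousOn_integral hT0 hTt).add (by fun_prop)
    · intro u hu
      have h1 := hstep.hasDerivWithinAt_integral hT0 (hT0.trans hu.1)
      have h2 : HasDerivWithinAt (fun u => ε * (u - T)) ε (Set.Ici u) u := by
        simpa using ((hasDerivWithinAt_id u (Set.Ici u)).sub_const T).const_mul ε
      exact h1.add h2
    · intro u hu heq
      have hu' : u ∈ Set.Icc T t := ⟨hu.1, hu.2.le⟩
      have hle : ‖relMeas 𝒢 v i u - x‖ ≤ s := by
        rw [heq]
        have h1 := intervalIntegral.integral_add_adjacent_intervals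
          (hstep.intervalIntegrable hT0 (hT0.trans hu.1))
          (hstep.intervalIntegrable (hT0.trans hu.1) ht)
        have h2 : 0 ≤ ∫ τ in u..t, F τ :=
          intervalIntegral.integral_nonneg hu.2.le fun x _ => hF0 x
        have h3 : ε * (u - T) ≤ ε * (t - T) :=
          mul_le_mul_of_nonneg_left (by linarith [hu.2]) hε0.le
        linarith
      have hdec : relRate 𝒢 g A B P (fun j => relMeas 𝒢 v j u) (fun j => pc j u) i
          = A.toEuclideanLin (relMeas 𝒢 v i u - x)
            + (A - (g i * ∑ j, 𝒢.weight i j) • (B * Bᵀ * P)).toEuclideanLin x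
            + (B * Bᵀ * P).toEuclideanLin (∑ j, (𝒢.weight i j * g j) • pc j u) := by
        simp only [relRate, coupling, hpcx u hu', map_sub, LinearMap.sub_apply, map_smul,
          LinearMap.smul_apply, LinearMap.sum_apply, map_sum, smul_sub, Finset.sum_sub_distrib,
          smul_smul,
          mul_comm (g i), Finset.sum_mul, Finset.sum_smul]
        abel
      have hrate : F u = ‖A‖ * s + ‖(A - (g i * ∑ j, 𝒢.weight i j) • (B * Bᵀ * P)).toEuclideanLin x‖
          + ‖(B * Bᵀ * P).toEuclideanLin (∑ j, (𝒢.weight i j * g j) • pc j u)‖ := rfl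
      rw [hdec, hrate]
      have h4 : ‖A.toEuclideanLin (relMeas 𝒢 v i u - x)‖ ≤ ‖A‖ * s :=
        (norm_toEuclideanLin_le A _).trans (mul_le_mul_of_nonneg_left hle (norm_nonneg _))
      have h5 := norm_add₃_le (a := A.toEuclideanLin (relMeas 𝒢 v i u - x))
        (b := (A - (g i * ∑ j, 𝒢.weight i j) • (B * Bᵀ * P)).toEuclideanLin x)
        (c := (B * Bᵀ * P).toEuclideanLin (∑ j, (𝒢.weight i j * g j) • pc j u))
      linarith
  have h1 := (hmain t ⟨hTt, le_rfl⟩).trans hε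
  rw [hpcx t ⟨hTt, le_rfl⟩, norm_sub_rev]
  -- The threshold satisfies `s (1 + η_i) = η_i ‖x‖`, so `‖x‖ ≤ ‖p_i(t)‖ + s` converts a bound
  -- relative to the sample into one relative to the current measurement.
  have h2 : ‖x‖ ≤ ‖relMeas 𝒢 v i t‖ + s := by
    have := norm_sub_norm_le x (relMeas 𝒢 v i t)
    rw [norm_sub_rev] at this
    linarith
  have h3 : s * (1 + ηi i) = ηi i * ‖x‖ := by
    rw [hs]; field_simp
  have h4 : s ≤ ηi i * ‖relMeas 𝒢 v i t‖ := by nlinarith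
  exact h1.trans h4

end Dynamics

end IsClosedLoop

theorem le_of_hasDerivWithinAt_nonpos {f f' : ℝ → ℝ} {a b : ℝ} (hab : a ≤ b)
    (hf : ContinuousOn f (Set.Icc a b))
    (hf' : ∀ x ∈ Set.Ico a b, HasDerivWithinAt f (f' x) (Set.Ici x) x)
    (h : ∀ x ∈ Set.Ico a b, f' x ≤ 0) : f b ≤ f a :=
  image_le_of_deriv_right_le_deriv_boundary hf hf' (B := fun _ => f a) (B' := fun _ => 0) le_rfl
    continuousOn_const (fun _ _ => hasDerivWithinAt_const _ _ _) h ⟨hab, le_rfl⟩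

theorem abs_sum_inner_le {N q : ℕ} (x y : Fin N → EuclideanSpace ℝ (Fin q)) :
    |∑ i, inner ℝ (x i) (y i)| ≤ stackNorm x * stackNorm y := by
  have h := abs_real_inner_le_norm (WithLp.toLp 2 x) (WithLp.toLp 2 y)
  rwa [PiLp.inner_apply] at h

namespace IsClosedLoop

variable {N q : ℕ} {𝒢 : WeightedDigraph N} {g : Fin N → ℝ} {A : Matrix (Fin q) (Fin q) ℝ}
  {B : Matrix (Fin q) (Fin 1) ℝ} {P : Matrix (Fin q) (Fin q) ℝ} {ηi : Fin N → ℝ} {b : ℝ}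
  {v : Fin N → ℝ → EuclideanSpace ℝ (Fin q)} {te : Fin N → ℕ → ℝ≥0∞}
  {pc : Fin N → ℝ → EuclideanSpace ℝ (Fin q)}

/-! ### How fast the relative measurements can change -/

section Growth

variable (h : IsClosedLoop 𝒢 g A B P ηi b v te pc)

include h

theorem hasDerivWithinAt_sq_relMeas {t : ℝ} (ht : 0 ≤ t) :
    HasDerivWithinAt (fun u => stackNorm (fun i => relMeas 𝒢 v i u) ^ 2)
      (2 * ∑ i, inner ℝ (relMeas 𝒢 v i t)
        (relRate 𝒢 g A B P (fun j => relMeas 𝒢 v j t) (fun j => pc j t) i)) (Set.Ici t) t := by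
  simp only [stackNorm_sq, Finset.mul_sum]
  exact HasDerivWithinAt.fun_sum fun i _ => (h.hasDerivWithinAt_relMeas i ht).norm_sq

theorem continuousOn_stackNorm :
    ContinuousOn (fun u => stackNorm (fun i => relMeas 𝒢 v i u)) (Set.Ici 0) := by
  have e : (fun u => stackNorm (fun i => relMeas 𝒢 v i u))
      = fun u => Real.sqrt (∑ i, ‖relMeas 𝒢 v i u‖ ^ 2) := by
    ext u
    rw [← stackNorm_sq, Real.sqrt_sq (stackNorm_nonneg _)]
  rw [e]
  exact (continuousOn_finsetSum _ fun i _ => ((h.continuousOn_relMeas i).norm.pow 2)).sqrt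

/-- The derivative of `W²` is at least `-2c W²`, so `exp(2cu) W(u)²` is nondecreasing. The square is
used since `W` may fail to be differentiable where it vanishes. The past is bounded by the present,
because the errors must be compared with the current `p`. -/
theorem stackNorm_le_exp_mul {c s t : ℝ} (hs : 0 ≤ s) (hst : s ≤ t)
    (hc : ∀ u ∈ Set.Ico s t, stackNorm (relRate 𝒢 g A B P (fun j => relMeas 𝒢 v j u)
      (fun j => pc j u)) ≤ c * stackNorm (fun i => relMeas 𝒢 v i u)) :
    stackNorm (fun i => relMeas 𝒢 v i s)
      ≤ Real.exp (c * (t - s)) * stackNorm (fun i => relMeas 𝒢 v i t) := by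
  set W : ℝ → ℝ := fun u => stackNorm (fun i => relMeas 𝒢 v i u) with hW
  have hexp : ∀ u, HasDerivAt (fun u => Real.exp (2 * c * u)) (Real.exp (2 * c * u) * (2 * c)) u :=
    fun u => by
      have h1 : HasDerivAt (fun u : ℝ => 2 * c * u) (2 * c) u := by
        simpa using (hasDerivAt_id u).const_mul (2 * c)
      exact h1.exp
  have hmono : -(Real.exp (2 * c * t) * W t ^ 2) ≤ -(Real.exp (2 * c * s) * W s ^ 2) := by
    refine le_of_hasDerivWithinAt_nonpos (f := fun u => -(Real.exp (2 * c * u) * W u ^ 2)) hst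
      ?_ (fun u hu => ((hexp u).hasDerivWithinAt.mul
        (h.hasDerivWithinAt_sq_relMeas (hs.trans hu.1))).neg) fun u hu => ?_
    · exact ((by fun_prop : Continuous fun u : ℝ => Real.exp (2 * c * u)).continuousOn.mul
        ((h.continuousOn_stackNorm.mono fun u hu => hs.trans hu.1).pow 2)).neg
    · have h1 := abs_sum_inner_le (fun i => relMeas 𝒢 v i u)
        (relRate 𝒢 g A B P (fun j => relMeas 𝒢 v j u) (fun j => pc j u))
      have h2 := mul_le_mul_of_nonneg_left (hc u hu)
        (stackNorm_nonneg (fun i => relMeas 𝒢 v i u))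
      have h3 := (abs_le.1 (h1.trans h2)).1
      change -(_ * (2 * c) * W u ^ 2 + _ * _) ≤ 0
      rw [neg_nonpos, mul_assoc, ← mul_add]
      refine mul_nonneg (Real.exp_pos _).le ?_
      change -(W u * (c * W u)) ≤ _ at h3
      nlinarith
  have h1 : (Real.exp (c * s) * W s) ^ 2 ≤ (Real.exp (c * t) * W t) ^ 2 := by
    rw [mul_pow, mul_pow, ← Real.exp_nat_mul, ← Real.exp_nat_mul]
    push_cast
    rw [← mul_assoc, ← mul_assoc]
    linarith
  have h2 := abs_le_of_sq_le_sq' h1 (mul_nonneg (Real.exp_pos _).le (stackNorm_nonneg _)) |>.2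
  have h3 : Real.exp (c * t) = Real.exp (c * s) * Real.exp (c * (t - s)) := by
    rw [← Real.exp_add]; congr 1; ring
  rw [h3, mul_assoc] at h2
  exact le_of_mul_le_mul_left h2 (Real.exp_pos _)

/-- By `stackNorm_le_exp_mul` the speed at time `u` is at most `c exp(c (t - u))` times the final
norm; integrating this gives the factor. -/
theorem norm_relMeas_sub_le {c s t : ℝ} (hs : 0 ≤ s) (hst : s ≤ t) (hc0 : 0 ≤ c)
    (hc : ∀ u ∈ Set.Ico s t, stackNorm (relRate 𝒢 g A B P (fun j => relMeas 𝒢 v j u)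
      (fun j => pc j u)) ≤ c * stackNorm (fun i => relMeas 𝒢 v i u)) (i : Fin N) :
    ‖relMeas 𝒢 v i t - relMeas 𝒢 v i s‖
      ≤ (Real.exp (c * (t - s)) - 1) * stackNorm (fun i => relMeas 𝒢 v i t) := by
  set w := stackNorm (fun i => relMeas 𝒢 v i t)
  have hB : ∀ u, HasDerivAt (fun u => (Real.exp (c * (t - s)) - Real.exp (c * (t - u))) * w)
      (c * Real.exp (c * (t - u)) * w) u := fun u => by
    have h1 : HasDerivAt (fun u : ℝ => c * (t - u)) (-c) u := by
      simpa using ((hasDerivAt_id u).const_sub t).const_mul c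
    have h2 := (h1.exp.const_sub (Real.exp (c * (t - s)))).mul_const w
    rwa [show -(Real.exp (c * (t - u)) * -c) * w = c * Real.exp (c * (t - u)) * w by ring] at h2
  have := image_norm_le_of_norm_deriv_right_le_deriv_boundary
    (f := fun u => relMeas 𝒢 v i u - relMeas 𝒢 v i s)
    (f' := fun u => relRate 𝒢 g A B P (fun j => relMeas 𝒢 v j u) (fun j => pc j u) i)
    (((h.continuousOn_relMeas i).mono fun u (hu : u ∈ Set.Icc s t) => hs.trans hu.1).sub
      continuousOn_const)
    (fun u hu => (h.hasDerivWithinAt_relMeas i (hs.trans hu.1)).sub_const _)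
    (by simp) hB (fun u hu => ?_) ⟨hst, le_rfl⟩
  · simpa using this
  · have h1 := h.stackNorm_le_exp_mul (hs.trans hu.1) hu.2.le
      fun x hx => hc x ⟨hu.1.trans hx.1, hx.2⟩
    have h2 := mul_le_mul_of_nonneg_left h1 hc0
    rw [mul_assoc]
    exact ((norm_le_stackNorm _ i).trans (hc u hu)).trans h2

end Growth

/-! ### Sampling errors are small relative to the measurements -/

section Error

variable {η φ : ℝ}
  (h : IsClosedLoop 𝒢 g A B P ηi (dwellTime 𝒢 g A B P η φ) v te pc)

include h

/-- Since the next event is still to come, either the trigger integral is below its threshold or the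
dwell time has not elapsed. In the second case `t - T < b = ln(φ + 1) / c` makes `θ = exp(c (t - T))
- 1` strictly smaller than `φ`. Both cases leave room to the right of `t`, which the continuation
argument needs. -/
theorem error_le_of_forall_lt (hb : 0 < dwellTime 𝒢 g A B P η φ)
    (hη : ∀ i, 0 < ηi i ∧ ηi i ≤ η) (hφ : 0 < φ) {t : ℝ} (ht : 0 ≤ t)
    (hlt : ∀ u, 0 ≤ u → u < t → ∀ i, ‖pc i u - relMeas 𝒢 v i u‖
      ≤ max η φ * stackNorm (fun i => relMeas 𝒢 v i u)) (i : Fin N) :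
    (∀ᶠ s in 𝓝[≥] t, ‖pc i s - relMeas 𝒢 v i s‖ ≤ ηi i * ‖relMeas 𝒢 v i s‖) ∨
      ∃ θ < φ, 0 ≤ θ ∧ ‖pc i t - relMeas 𝒢 v i t‖
          ≤ θ * stackNorm (fun i => relMeas 𝒢 v i t) := by
  set b := dwellTime 𝒢 g A B P η φ with hbdef
  obtain ⟨k, hk, hk'⟩ := h.exists_index hb i ht
  set T := (te i k).toReal with hT
  have hT0 : 0 ≤ T := ENNReal.toReal_nonneg
  have hTtop : te i k ≠ ⊤ := ne_top_of_le_ne_top ENNReal.ofReal_ne_top hk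
  have hTe : te i k = ENNReal.ofReal T := (ENNReal.ofReal_toReal hTtop).symm
  have hTt : T ≤ t := by
    rw [hT, ← ENNReal.toReal_ofReal ht]
    exact ENNReal.toReal_mono ENNReal.ofReal_ne_top hk
  have hnot := not_le.2 hk'
  rw [h.event_succ, ← hT, hTe, next_event_le_iff (fun j => h.isStep_sampled hb j)
    (fun j => (hη j).1) i _ hT0 hTt, not_and_or, not_le, not_le] at hnot
  rcases hnot with hnot | hnot
  · right
    set c := bOne 𝒢 g A B P + bTwo 𝒢 g B P * max η φ * Real.sqrt N with hc
    have hbc : b = Real.log (φ + 1) / c := rfl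
    have hc0 : 0 < c := by
      by_contra! hneg
      have : b ≤ 0 := by
        rw [hbc]; exact div_nonpos_of_nonneg_of_nonpos (Real.log_nonneg (by linarith)) hneg
      linarith
    have hpc : pc i t = relMeas 𝒢 v i T := h.sampled i k t ht hk hk'
    refine ⟨Real.exp (c * (t - T)) - 1, ?_, ?_, ?_⟩
    · have : c * (t - T) < Real.log (φ + 1) := by
        have h1 : t - T < Real.log (φ + 1) / c := by rw [← hbc]; linarith
        rw [lt_div_iff₀ hc0] at h1
        linarith
      have h2 := Real.exp_lt_exp.2 this
      rw [Real.exp_log (by linarith)] at h2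
      linarith
    · have := Real.one_le_exp (mul_nonneg hc0.le (sub_nonneg.2 hTt))
      linarith
    · rw [hpc, norm_sub_rev]
      refine h.norm_relMeas_sub_le hT0 hTt hc0.le (fun u hu => ?_) i
      exact stackNorm_relRate_le_of_error (hφ.le.trans (le_max_right _ _))
        (hlt u (hT0.trans hu.1) hu.2)
  · left
    have hstep : IsStep (triggerRate 𝒢 g A B P ηi pc i (relMeas 𝒢 v i T)) :=
      isStep_triggerRate (fun j => h.isStep_sampled hb j) i _
    have h1 := (hstep.hasDerivWithinAt_integral hT0 ht).continuousWithinAt.eventually_lt_const hnot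
    have h2 : ∀ᶠ s in 𝓝[≥] t, ENNReal.ofReal s < te i (k + 1) :=
      ((ENNReal.continuous_ofReal.tendsto t).eventually_lt_const hk').filter_mono
        nhdsWithin_le_nhds
    filter_upwards [h1, h2, self_mem_nhdsWithin] with s hs1 hs2 hs3
    have hs3 : t ≤ s := hs3
    exact h.error_le_of_integral_lt hb (fun j => (hη j).1) i k
      (hk.trans (ENNReal.ofReal_le_ofReal hs3)) hs2 (ht.trans hs3) hs1

/-- The continuation step. When the stack is nonzero at `t`, `θ < φ` is a strict inequality and
survives by continuity. -/
theorem eventually_error_le (hb : 0 < dwellTime 𝒢 g A B P η φ)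
    (hη : ∀ i, 0 < ηi i ∧ ηi i ≤ η) (hφ : 0 < φ) {t : ℝ} (ht : 0 ≤ t)
    (hle : ∀ u, 0 ≤ u → u ≤ t → ∀ i, ‖pc i u - relMeas 𝒢 v i u‖
      ≤ max η φ * stackNorm (fun i => relMeas 𝒢 v i u)) :
    ∀ᶠ s in 𝓝[≥] t, ∀ i, ‖pc i s - relMeas 𝒢 v i s‖
      ≤ max η φ * stackNorm (fun i => relMeas 𝒢 v i s) := by
  set b := dwellTime 𝒢 g A B P η φ with hbdef
  have hm : 0 < max η φ := hφ.trans_le (le_max_right _ _)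
  rcases (stackNorm_nonneg (fun i => relMeas 𝒢 v i t)).eq_or_lt with hW | hW
  -- When the whole stack vanishes no strict room is left. But then all samples vanish and stay zero
  -- for a while, so `p' = A p` with `p(t) = 0`, and Grönwall keeps both `p` and the error at zero.
  · have hp0 : ∀ j, relMeas 𝒢 v j t = 0 := fun j => by
      have := norm_le_stackNorm (fun i => relMeas 𝒢 v i t) j
      rw [← hW] at this
      exact norm_le_zero_iff.1 this
    have hpc0 : ∀ j, pc j t = 0 := fun j => by
      have := hle t ht le_rfl j
      rw [← hW, mul_zero, hp0, sub_zero] at this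
      exact norm_le_zero_iff.1 this
    have hev : ∀ᶠ s in 𝓝[≥] t, ∀ j, pc j s = 0 := Filter.eventually_all.2 fun j => by
      filter_upwards [(h.isStep_sampled hb j).eventually_eq t ht] with s hs
      rw [hs, hpc0]
    obtain ⟨w, htw, hw⟩ := (mem_nhdsGE_iff_exists_Ico_subset).1 hev
    filter_upwards [Ico_mem_nhdsGE htw] with s hs i
    have hz : ∀ u ∈ Set.Icc t s, relMeas 𝒢 v i u = 0 := by
      refine eq_zero_of_abs_deriv_le_mul_abs_self_of_eq_zero_right (K := ‖A‖)
        ((h.continuousOn_relMeas i).mono fun u hu => ht.trans hu.1)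
        (fun u hu => h.hasDerivWithinAt_relMeas i (ht.trans hu.1)) (hp0 i) fun u hu => ?_
      have hu0 : ∀ j, pc j u = 0 := hw ⟨hu.1, hu.2.trans hs.2⟩
      have : relRate 𝒢 g A B P (fun j => relMeas 𝒢 v j u) (fun j => pc j u) i
          = A.toEuclideanLin (relMeas 𝒢 v i u) := by
        simp [relRate, coupling, hu0]
      rw [this]
      exact norm_toEuclideanLin_le A _
    have hs0 : ∀ j, pc j s = 0 := hw hs
    rw [hs0, hz s ⟨hs.1, le_rfl⟩, sub_zero, norm_zero]
    exact mul_nonneg hm.le (stackNorm_nonneg _)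
  · refine Filter.eventually_all.2 fun i => ?_
    have hge : Set.Ici t ∈ 𝓝[≥] t := self_mem_nhdsWithin
    have hcp : Filter.Tendsto (relMeas 𝒢 v i) (𝓝[≥] t) (𝓝 (relMeas 𝒢 v i t)) :=
      (h.continuousOn_relMeas i t ht).mono fun u hu => ht.trans hu
    have hcW : Filter.Tendsto (fun s => stackNorm (fun i => relMeas 𝒢 v i s)) (𝓝[≥] t)
        (𝓝 (stackNorm (fun i => relMeas 𝒢 v i t))) :=
      (h.continuousOn_stackNorm t ht).mono fun u hu => ht.trans hu
    have hpc := (h.isStep_sampled hb i).eventually_eq t ht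
    rcases h.error_le_of_forall_lt hb hη hφ ht (fun u hu hut => hle u hu hut.le) i with h1 | h1
    · filter_upwards [h1] with s hs
      exact hs.trans (mul_le_mul ((hη i).2.trans (le_max_left _ _))
        (norm_le_stackNorm (fun i => relMeas 𝒢 v i s) i) (norm_nonneg _) hm.le)
    · obtain ⟨θ, hθ, hθ0, hle1⟩ := h1
      have hlt : ‖pc i t - relMeas 𝒢 v i t‖
          < max η φ * stackNorm (fun i => relMeas 𝒢 v i t) :=
        hle1.trans_lt (mul_lt_mul_of_pos_right (hθ.trans_le (le_max_right _ _)) hW)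
      have hev := ((tendsto_const_nhds (x := pc i t)).sub hcp).norm.eventually_lt
        (hcW.const_mul (max η φ)) hlt
      filter_upwards [hev, hpc] with s hs1 hs2
      rw [hs2]
      exact hs1.le

/-- Continuation from the infimum of the failure times: the bound holds before the infimum, hence at
it by the dichotomy, hence a little beyond it, so no failure time exists. -/
theorem error_le_max (hb : 0 < dwellTime 𝒢 g A B P η φ)
    (hη : ∀ i, 0 < ηi i ∧ ηi i ≤ η) (hφ : 0 < φ) {t : ℝ} (ht : 0 ≤ t) (i : Fin N) :
    ‖pc i t - relMeas 𝒢 v i t‖ ≤ max η φ * stackNorm (fun i => relMeas 𝒢 v i t) := by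
  have hm : 0 < max η φ := hφ.trans_le (le_max_right _ _)
  have hpt : ∀ t, 0 ≤ t → (∀ u, 0 ≤ u → u < t → ∀ i, ‖pc i u - relMeas 𝒢 v i u‖
      ≤ max η φ * stackNorm (fun i => relMeas 𝒢 v i u)) → ∀ i, ‖pc i t - relMeas 𝒢 v i t‖
      ≤ max η φ * stackNorm (fun i => relMeas 𝒢 v i t) := by
    intro t ht hlt i
    rcases h.error_le_of_forall_lt hb hη hφ ht hlt i with h1 | ⟨θ, hθ, -, h1⟩
    · exact (h1.self_of_nhdsWithin (Set.mem_Ici.2 le_rfl)).trans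
        (mul_le_mul ((hη i).2.trans (le_max_left _ _))
          (norm_le_stackNorm (fun i => relMeas 𝒢 v i t) i) (norm_nonneg _) hm.le)
    · exact h1.trans (mul_le_mul_of_nonneg_right (hθ.le.trans (le_max_right _ _))
        (stackNorm_nonneg _))
  by_contra hcon
  set S : Set ℝ := {u | 0 ≤ u ∧ ¬ ∀ i, ‖pc i u - relMeas 𝒢 v i u‖
      ≤ max η φ * stackNorm (fun i => relMeas 𝒢 v i u)}
  have hne : S.Nonempty := ⟨t, ht, fun hall => hcon (hall i)⟩
  have hbdd : BddBelow S := ⟨0, fun u hu => hu.1⟩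
  have hs0 : 0 ≤ sInf S := le_csInf hne fun u hu => hu.1
  have hlt : ∀ u, 0 ≤ u → u < sInf S → ∀ i, ‖pc i u - relMeas 𝒢 v i u‖
      ≤ max η φ * stackNorm (fun i => relMeas 𝒢 v i u) := by
    intro u hu hus
    by_contra hnot
    exact absurd (csInf_le hbdd (show u ∈ S from ⟨hu, hnot⟩)) (not_le.2 hus)
  have hle : ∀ u, 0 ≤ u → u ≤ sInf S → ∀ i, ‖pc i u - relMeas 𝒢 v i u‖
      ≤ max η φ * stackNorm (fun i => relMeas 𝒢 v i u) := by
    intro u hu hus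
    rcases hus.lt_or_eq with h1 | h1
    · exact hlt u hu h1
    · rw [h1]; exact hpt _ hs0 hlt
  obtain ⟨w, hw, hsub⟩ := (mem_nhdsGE_iff_exists_Ico_subset).1
    (h.eventually_error_le hb hη hφ hs0 hle)
  have hw : sInf S < w := hw
  obtain ⟨u, hu, huw⟩ := exists_lt_of_csInf_lt hne hw
  exact hu.2 (hsub ⟨csInf_le hbdd hu, huw⟩)

/-- The sampling errors are dominated by the relative measurements. -/
theorem sum_sq_error_le (hb : 0 < dwellTime 𝒢 g A B P η φ)
    (hη : ∀ i, 0 < ηi i ∧ ηi i ≤ η) (hφ : 0 < φ) {t : ℝ} (ht : 0 ≤ t) :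
    ∑ i, ‖pc i t - relMeas 𝒢 v i t‖ ^ 2
      ≤ (η ^ 2 + N * φ ^ 2) * ∑ i, ‖relMeas 𝒢 v i t‖ ^ 2 := by
  have hi : ∀ i, ‖pc i t - relMeas 𝒢 v i t‖ ^ 2
      ≤ η ^ 2 * ‖relMeas 𝒢 v i t‖ ^ 2 + φ ^ 2 * ∑ i, ‖relMeas 𝒢 v i t‖ ^ 2 := by
    intro i
    have hη0 : 0 < η := (hη i).1.trans_le (hη i).2
    rw [← stackNorm_sq (fun i => relMeas 𝒢 v i t)]
    rcases h.error_le_of_forall_lt hb hη hφ ht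
      (fun u hu _ i => h.error_le_max hb hη hφ hu i) i with h1 | ⟨θ, hθ, hθ0, h1⟩
    · have h2 := (h1.self_of_nhdsWithin (Set.mem_Ici.2 le_rfl)).trans
        (mul_le_mul_of_nonneg_right (hη i).2 (norm_nonneg _))
      have h3 := pow_le_pow_left₀ (norm_nonneg _) h2 2
      rw [mul_pow] at h3
      have : 0 ≤ φ ^ 2 * stackNorm (fun i => relMeas 𝒢 v i t) ^ 2 := by positivity
      linarith
    · have h2 := h1.trans (mul_le_mul_of_nonneg_right hθ.le (stackNorm_nonneg _))
      have h3 := pow_le_pow_left₀ (norm_nonneg _) h2 2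
      rw [mul_pow] at h3
      have : 0 ≤ η ^ 2 * ‖relMeas 𝒢 v i t‖ ^ 2 := by positivity
      linarith
  refine (Finset.sum_le_sum fun i _ => hi i).trans (le_of_eq ?_)
  rw [Finset.sum_add_distrib, ← Finset.mul_sum, Finset.sum_const, Finset.card_univ,
    Fintype.card_fin, nsmul_eq_mul]
  ring

end Error

end IsClosedLoop

/-! ### Linear flows and smoothing -/

section Flow

variable {E : Type*} [NormedAddCommGroup E] [NormedSpace ℝ E]

/-- The flow of the linear vector field `L`. -/
def linearFlow (L : E →L[ℝ] E) (t : ℝ) : E →L[ℝ] E := NormedSpace.exp (t • L)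

theorem linearFlow_zero (L : E →L[ℝ] E) : linearFlow L 0 = 1 := by
  rw [linearFlow, zero_smul, NormedSpace.exp_zero]

variable [CompleteSpace E]

theorem hasDerivAt_linearFlow (L : E →L[ℝ] E) (t : ℝ) :
    HasDerivAt (linearFlow L) (L * linearFlow L t) t := hasDerivAt_exp_smul_const' L t

theorem hasDerivAt_linearFlow' (L : E →L[ℝ] E) (t : ℝ) :
    HasDerivAt (linearFlow L) (linearFlow L t * L) t := hasDerivAt_exp_smul_const L t

theorem continuous_linearFlow (L : E →L[ℝ] E) : Continuous (linearFlow L) :=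
  continuous_iff_continuousAt.2 fun t => (hasDerivAt_linearFlow L t).continuousAt

theorem linearFlow_add (L : E →L[ℝ] E) (s t : ℝ) :
    linearFlow L (s + t) = linearFlow L s * linearFlow L t := by
  let : NormedAlgebra ℚ (E →L[ℝ] E) := NormedAlgebra.restrictScalars ℚ ℝ (E →L[ℝ] E)
  rw [linearFlow, add_smul, NormedSpace.exp_add_of_commute]
  · rfl
  · exact ((Commute.refl L).smul_left s).smul_right t

/-- An asymptotic solution of a linear equation is asymptotic to a differentiable one. -/
theorem exists_differentiable_of_asymptotic {L : E →L[ℝ] E} {m f : ℝ → E}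
    (hm : ContinuousOn m (Set.Ici 0))
    (hm' : ∀ t, 0 ≤ t → HasDerivWithinAt m (L (m t) + f t) (Set.Ici t) t)
    (hf : Filter.Tendsto f Filter.atTop (𝓝 0)) :
    ∃ w : ℝ → E, Differentiable ℝ w ∧
      Filter.Tendsto (fun t => deriv w t - L (w t)) Filter.atTop (𝓝 0) ∧
      Filter.Tendsto (fun t => m t - w t) Filter.atTop (𝓝 0) := by
  -- Freezing `m` at its initial value for negative times gives a function that is continuous on the
  -- whole line.
  set M : ℝ → E := fun u => m (max u 0) with hM
  have hMc : Continuous M :=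
    continuousOn_univ.1 (hm.comp (by fun_prop) fun u _ => le_max_right u 0)
  set h : ℝ → E := fun u => linearFlow L (-u) (M u) with hh
  have hhc : Continuous h := ((continuous_linearFlow L).comp continuous_neg).clm_apply hMc
  set F : ℝ → E := fun t => ∫ u in (0 : ℝ)..t, h u with hF
  have hF' : ∀ t, HasDerivAt F (h t) t := fun t =>
    intervalIntegral.integral_hasDerivAt_right (hhc.intervalIntegrable _ _)
      hhc.stronglyMeasurable.stronglyMeasurableAtFilter hhc.continuousAt
  have hFs : ∀ t, HasDerivAt (fun t => F (t + 1)) (h (t + 1)) t := fun t =>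
    (hF' (t + 1)).comp_add_const t 1
  -- `w(t)` is the average over `u ∈ [t, t+1]` of `m(u)` transported back to time `t` by the flow.
  -- It is differentiable although `m` need not be, and its defect `w' - L w` is `exp(-L) m(t+1) -
  -- m(t)`.
  set w : ℝ → E := fun t => linearFlow L t (F (t + 1) - F t) with hw
  have hw' : ∀ t, HasDerivAt w (L (w t) + linearFlow L t (h (t + 1) - h t)) t := fun t =>
    (hasDerivAt_linearFlow L t).clm_apply ((hFs t).sub (hF' t))
  obtain ⟨C, hC⟩ := (isCompact_Icc (a := (-1 : ℝ)) (b := 0)).exists_bound_of_continuousOn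
    (continuous_linearFlow L).continuousOn
  have hC0 : 0 ≤ C := (norm_nonneg _).trans (hC 0 (by simp))
  have hkey : ∀ ε > 0, ∀ᶠ t in Filter.atTop, 0 ≤ t ∧ ∀ u ∈ Set.Icc t (t + 1),
      ‖linearFlow L (t - u) (m u) - m t‖ ≤ C * ε := by
    intro ε hε
    have h1 : ∀ᶠ t in Filter.atTop, ∀ u, t ≤ u → ‖f u‖ ≤ ε := by
      have := (Metric.tendsto_atTop.1 hf) ε hε
      obtain ⟨t₀, ht₀⟩ := this
      filter_upwards [Filter.eventually_ge_atTop t₀] with t ht u hu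
      have := ht₀ u (ht.trans hu)
      rw [dist_zero_right] at this
      exact this.le
    filter_upwards [h1, Filter.eventually_ge_atTop 0] with t ht ht0
    refine ⟨ht0, fun u hu => ?_⟩
    have hflow : ∀ u, HasDerivAt (fun u => linearFlow L (t - u)) (-(linearFlow L (t - u) * L)) u :=
      fun u => by
        have := (hasDerivAt_linearFlow' L (t - u)).scomp u ((hasDerivAt_id u).const_sub t)
        rwa [neg_one_smul] at this
    -- The transported curve has right derivative `exp(L (t - u)) f(u)`: the terms with `L` cancel,
    -- so over a unit window it moves by at most `C ε`. Both the defect of `w` and the distance from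
    -- `w` to `m` are controlled by this.
    have h2 := norm_image_sub_le_of_norm_deriv_right_le_segment
      (f := fun u => linearFlow L (t - u) (m u)) (a := t) (b := t + 1)
      (f' := fun u => -(linearFlow L (t - u) * L) (m u) + linearFlow L (t - u) (L (m u) + f u))
      (C := C * ε) ?_ ?_ ?_ u hu
    · simp only [sub_self, linearFlow_zero, one_apply_eq_self] at h2
      refine h2.trans (mul_le_of_le_one_right (mul_nonneg hC0 hε.le) ?_)
      linarith [hu.2]
    · exact ((continuous_linearFlow L).comp (by fun_prop)).continuousOn.clm_apply
        (hm.mono fun x hx => ht0.trans hx.1)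
    · intro x hx
      exact (hflow x).hasDerivWithinAt.clm_apply (hm' x (ht0.trans hx.1))
    · intro x hx
      rw [map_add, mul_apply_eq_comp, neg_add_cancel_left]
      exact ((linearFlow L (t - x)).le_opNorm _).trans (mul_le_mul
        (hC _ ⟨by linarith [hx.2], by linarith [hx.1]⟩) (ht x hx.1) (norm_nonneg _) hC0)
  have hmul : ∀ t u (x : E), linearFlow L t (linearFlow L (-u) x) = linearFlow L (t - u) x := by
    intro t u x
    rw [sub_eq_add_neg, linearFlow_add, mul_apply_eq_comp]
  have hMm : ∀ u, 0 ≤ u → M u = m u := fun u hu => by simp [hM, max_eq_left hu]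
  have hscale : ∀ {k : ℝ → E}, (∀ ε > 0, ∀ᶠ t in Filter.atTop, ‖k t‖ ≤ C * ε) →
      Filter.Tendsto k Filter.atTop (𝓝 0) := by
    intro k hk
    rw [Metric.tendsto_nhds]
    intro ε hε
    filter_upwards [hk (ε / (C + 1)) (by positivity)] with t ht
    rw [dist_zero_right]
    refine ht.trans_lt ?_
    rw [mul_div_assoc', div_lt_iff₀ (by positivity)]
    linarith
  refine ⟨w, fun t => (hw' t).differentiableAt, hscale fun ε hε => ?_, hscale fun ε hε => ?_⟩
  · filter_upwards [hkey ε hε] with t ht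
    have h1 := ht.2 (t + 1) ⟨by linarith, le_rfl⟩
    rw [(hw' t).deriv, add_sub_cancel_left, map_sub]
    simp only [hh, hmul, sub_self, linearFlow_zero, one_apply_eq_self]
    rwa [hMm _ ht.1, hMm _ (by linarith [ht.1])]
  · filter_upwards [hkey ε hε] with t ht
    have h1 : w t - m t = ∫ u in t..(t + 1), (linearFlow L t (h u) - m t) := by
      have hi : IntervalIntegrable (fun u => linearFlow L t (h u)) MeasureTheory.volume t (t + 1) :=
        ((linearFlow L t).continuous.comp hhc).intervalIntegrable _ _
      rw [intervalIntegral.integral_sub hi intervalIntegrable_const,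
        intervalIntegral.integral_const,
        ContinuousLinearMap.intervalIntegral_comp_comm _ (hhc.intervalIntegrable _ _)]
      simp only [add_sub_cancel_left, one_smul, hw, hF]
      rw [intervalIntegral.integral_interval_sub_left (hhc.intervalIntegrable _ _)
        (hhc.intervalIntegrable _ _)]
    rw [norm_sub_rev, h1]
    have h2 := intervalIntegral.norm_integral_le_of_norm_le_const (a := t) (b := t + 1)
      (C := C * ε) (f := fun u => linearFlow L t (h u) - m t) fun u hu => by
        rw [Set.uIoc_of_le (by linarith)] at hu
        have := ht.2 u ⟨hu.1.le, hu.2⟩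
        simp only [hh, hmul]
        rwa [hMm _ (ht.1.trans hu.1.le)]
    simpa using h2

end Flow

theorem Matrix.PosDef.exists_mul_norm_sq_le_inner {q : ℕ} [NeZero q]
    {P : Matrix (Fin q) (Fin q) ℝ} (hP : P.PosDef) :
    ∃ c : ℝ, 0 < c ∧ ∀ x : EuclideanSpace ℝ (Fin q),
      c * ‖x‖ ^ 2 ≤ inner ℝ (P.toEuclideanLin x) x := by
  have hq : 0 < q := Nat.pos_of_ne_zero (NeZero.ne q)
  obtain ⟨j, hj⟩ := ascendingEigenvalues_eq_eigenvalues hP.isHermitian ⟨0, hq⟩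
  refine ⟨_, (by rw [hj]; exact hP.eigenvalues_pos j :
    0 < ascendingEigenvalues hP.isHermitian ⟨0, hq⟩), fun x => ?_⟩
  have h := ascendingEigenvalues_zero_mul_le hP.isHermitian hq x.ofLp
  rw [EuclideanSpace.inner_eq_star_dotProduct, star_trivial, ofLp_toEuclideanLin,
    EuclideanSpace.norm_sq_eq]
  simpa [dotProduct, sq] using h

theorem inner_toEuclideanLin_comm {q : ℕ} {P : Matrix (Fin q) (Fin q) ℝ} (hP : Pᵀ = P)
    (x y : EuclideanSpace ℝ (Fin q)) :
    inner ℝ (P.toEuclideanLin x) y = inner ℝ (P.toEuclideanLin y) x := by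
  rw [EuclideanSpace.inner_eq_star_dotProduct, EuclideanSpace.inner_eq_star_dotProduct,
    star_trivial, star_trivial, ofLp_toEuclideanLin, ofLp_toEuclideanLin,
    dotProduct_comm, ← Matrix.dotProduct_transpose_mulVec', hP]

/-! ### Exponential decay and consensus -/

namespace IsClosedLoop

variable {N q : ℕ} {hN : 2 ≤ N} {𝒢 : WeightedDigraph N} {r g : Fin N → ℝ}
  {A : Matrix (Fin q) (Fin q) ℝ}
  {B : Matrix (Fin q) (Fin 1) ℝ} {P : Matrix (Fin q) (Fin q) ℝ} {ηi : Fin N → ℝ} {lam η φ : ℝ}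
  {v : Fin N → ℝ → EuclideanSpace ℝ (Fin q)} {te : Fin N → ℕ → ℝ≥0∞}
  {pc : Fin N → ℝ → EuclideanSpace ℝ (Fin q)}

/-- Inserting the error bound into `lyapunov_rate_le` gives `V' ≤ -κ |p|²`, where `κ > 0` is the
margin in the condition on `η` and `φ`. As `V` is comparable with `|p|²`, it decays like `exp(-(κ/C)
t)`. -/
theorem tendsto_stackNorm [NeZero q]
    (h : IsClosedLoop 𝒢 g A B P ηi (dwellTime 𝒢 g A B P η φ) v te pc)
    (hb : 0 < dwellTime 𝒢 g A B P η φ)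
    (hr : r ᵥ* 𝒢.laplacian = 0) (hr0 : ∀ i, 0 < r i) (hg : ∀ i, r i ≤ g i) (hlam0 : 0 < lam)
    (hlam : lam < lambdaTwo hN 𝒢 r / N) (hP : P.PosDef)
    (hR : SolvesRiccati A B lam (riccatiBeta hN g r) P)
    (hη : ∀ i, 0 < ηi i ∧ ηi i ≤ η) (hφ : 0 < φ)
    (hρ : rhoConst hN 𝒢 r g lam B P ^ 2 * η ^ 2
          + N * rhoConst hN 𝒢 r g lam B P ^ 2 * φ ^ 2 < 1) :
    Filter.Tendsto (fun t => stackNorm (fun i => relMeas 𝒢 v i t)) Filter.atTop (𝓝 0) := by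
  have hg0 : ∀ i, 0 < g i := fun i => (hr0 i).trans_le (hg i)
  have hPt : Pᵀ = P := (Matrix.posDef_iff_real.1 hP).1
  obtain ⟨c, hc0, hc⟩ := hP.exists_mul_norm_sq_le_inner
  set ρ := rhoConst hN 𝒢 r g lam B P
  set κ := 1 - (ρ ^ 2 * η ^ 2 + N * ρ ^ 2 * φ ^ 2) with hκ
  have hκ0 : 0 < κ := by linarith
  set β := riccatiBeta hN g r
  have hβ : 0 < β := riccatiBeta_pos hr0 hg0
  set V : ℝ → ℝ := fun t => ∑ i, r i * g i *
    inner ℝ (P.toEuclideanLin (relMeas 𝒢 v i t)) (relMeas 𝒢 v i t) with hV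
  set W : ℝ → ℝ := fun t => stackNorm (fun i => relMeas 𝒢 v i t) with hW
  -- The summand `1` only serves to make `C` visibly positive.
  set C := ∑ i, r i * g i * ‖P‖ + 1 with hC
  have hsum0 : 0 ≤ ∑ i, r i * g i * ‖P‖ := Finset.sum_nonneg fun i _ =>
    mul_nonneg (mul_nonneg (hr0 i).le (hg0 i).le) (norm_nonneg _)
  have hC0 : 0 < C := by linarith
  have hVW : ∀ t, V t ≤ C * W t ^ 2 := fun t => by
    simp only [hV, hW, stackNorm_sq, Finset.mul_sum]
    refine Finset.sum_le_sum fun i _ => ?_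
    have h1 : inner ℝ (P.toEuclideanLin (relMeas 𝒢 v i t)) (relMeas 𝒢 v i t)
        ≤ ‖P‖ * ‖relMeas 𝒢 v i t‖ ^ 2 := by
      refine (real_inner_le_norm _ _).trans ?_
      rw [sq, ← mul_assoc]
      exact mul_le_mul_of_nonneg_right (norm_toEuclideanLin_le P _) (norm_nonneg _)
    have h2 : r i * g i * ‖P‖ ≤ C := by
      have := Finset.single_le_sum (f := fun i => r i * g i * ‖P‖)
        (fun i _ => mul_nonneg (mul_nonneg (hr0 i).le (hg0 i).le) (norm_nonneg _))
        (Finset.mem_univ i)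
      linarith
    calc _ ≤ r i * g i * (‖P‖ * ‖relMeas 𝒢 v i t‖ ^ 2) :=
          mul_le_mul_of_nonneg_left h1 (mul_nonneg (hr0 i).le (hg0 i).le)
      _ = r i * g i * ‖P‖ * ‖relMeas 𝒢 v i t‖ ^ 2 := by ring
      _ ≤ _ := mul_le_mul_of_nonneg_right h2 (sq_nonneg _)
  have hWV : ∀ t, c / β * W t ^ 2 ≤ V t := fun t => by
    simp only [hV, hW, stackNorm_sq, Finset.mul_sum]
    refine Finset.sum_le_sum fun i _ => ?_
    have h1 := one_le_mul_riccatiBeta (hN := hN) hr0 hg0 i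
    have h2 : 1 / β ≤ r i * g i := (div_le_iff₀ hβ).2 h1
    have h3 := mul_le_mul h2 (hc (relMeas 𝒢 v i t)) (by positivity)
      (mul_nonneg (hr0 i).le (hg0 i).le)
    refine le_trans (le_of_eq ?_) h3
    ring
  have hV' : ∀ t, 0 ≤ t → HasDerivWithinAt V (∑ i, r i * g i * (2 * inner ℝ
      (P.toEuclideanLin (relMeas 𝒢 v i t)) (relRate 𝒢 g A B P (fun j => relMeas 𝒢 v j t)
        (fun j => pc j t) i))) (Set.Ici t) t := fun t ht => by
    refine HasDerivWithinAt.fun_sum fun i _ => ?_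
    have h1 := h.hasDerivWithinAt_relMeas i ht
    have h2 := (LinearMap.toContinuousLinearMap P.toEuclideanLin).hasFDerivAt.comp_hasDerivWithinAt
      t h1
    have h3 := (h2.inner ℝ h1).const_mul (r i * g i)
    refine h3.congr_deriv ?_
    rw [two_mul]
    congr 2
    exact inner_toEuclideanLin_comm hPt _ _
  have hrate : ∀ t, 0 ≤ t → ∑ i, r i * g i * (2 * inner ℝ
      (P.toEuclideanLin (relMeas 𝒢 v i t)) (relRate 𝒢 g A B P (fun j => relMeas 𝒢 v j t)
        (fun j => pc j t) i)) ≤ -(κ / C) * V t := fun t ht => by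
    have h1 := lyapunov_rate_le (A := A) hr hr0 hg hlam0 hlam hPt hR (p := fun i => relMeas 𝒢 v i t)
      (y := fun i => pc i t) (sum_smul_relMap hr fun i => v i t)
    have h2 := h.sum_sq_error_le hb hη hφ ht
    have h3 := mul_le_mul_of_nonneg_left h2 (sq_nonneg ρ)
    have h4 : W t ^ 2 = ∑ i, ‖relMeas 𝒢 v i t‖ ^ 2 := stackNorm_sq _
    have h5 := mul_le_mul_of_nonneg_left (hVW t) (div_pos hκ0 hC0).le
    have h6 : κ / C * (C * W t ^ 2) = κ * W t ^ 2 := by field_simp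
    rw [h6] at h5
    rw [← h4] at h1 h3
    rw [hκ] at h5
    linarith
  have hVc : ContinuousOn V (Set.Ici 0) := by
    refine continuousOn_finsetSum _ fun i _ => continuousOn_const.mul ?_
    exact ((LinearMap.toContinuousLinearMap P.toEuclideanLin).continuous.comp_continuousOn
      (h.continuousOn_relMeas i)).inner (h.continuousOn_relMeas i)
  set γ := κ / C with hγ
  have hγ0 : 0 < γ := div_pos hκ0 hC0
  have hdecay : ∀ t, 0 ≤ t → Real.exp (γ * t) * V t ≤ V 0 := fun t ht => by
    have hexp : ∀ u, HasDerivAt (fun u => Real.exp (γ * u)) (Real.exp (γ * u) * γ) u :=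
      fun u => by
        have h1 : HasDerivAt (fun u : ℝ => γ * u) γ u := by
          simpa using (hasDerivAt_id u).const_mul γ
        exact h1.exp
    have := le_of_hasDerivWithinAt_nonpos (f := fun u => Real.exp (γ * u) * V u) ht
      ((by fun_prop : Continuous fun u : ℝ => Real.exp (γ * u)).continuousOn.mul
        (hVc.mono fun u hu => hu.1))
      (fun u hu => (hexp u).hasDerivWithinAt.mul (hV' u hu.1)) (fun u hu => ?_)
    · simpa using this
    · have h1 := mul_le_mul_of_nonneg_left (hrate u hu.1) (Real.exp_pos (γ * u)).le
      have e : Real.exp (γ * u) * (-γ * V u) = -(Real.exp (γ * u) * γ * V u) := by ring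
      rw [e] at h1
      linarith
  have hbound : ∀ t, 0 ≤ t → W t ^ 2 ≤ β / c * (V 0 * Real.exp (-(γ * t))) := fun t ht => by
    have h1 := hdecay t ht
    have h2 : V t ≤ V 0 * Real.exp (-(γ * t)) := by
      rw [Real.exp_neg, ← div_eq_mul_inv, le_div_iff₀ (Real.exp_pos _), mul_comm]
      exact h1
    have h3 := mul_le_mul_of_nonneg_left ((hWV t).trans h2) (div_pos hβ hc0).le
    have h4 : β / c * (c / β * W t ^ 2) = W t ^ 2 := by field_simp
    rwa [h4] at h3
  have hlim : Filter.Tendsto (fun t => β / c * (V 0 * Real.exp (-(γ * t)))) Filter.atTop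
      (𝓝 0) := by
    have h1 : Filter.Tendsto (fun t => Real.exp (-(γ * t))) Filter.atTop (𝓝 0) :=
      Real.tendsto_exp_neg_atTop_nhds_zero.comp (Filter.tendsto_id.const_mul_atTop hγ0)
    simpa using (h1.const_mul (V 0)).const_mul (β / c)
  have hsq : Filter.Tendsto (fun t => W t ^ 2) Filter.atTop (𝓝 0) :=
    tendsto_of_tendsto_of_tendsto_of_le_of_le' tendsto_const_nhds hlim
      (Filter.Eventually.of_forall fun t => sq_nonneg _)
      ((Filter.eventually_ge_atTop 0).mono hbound)
  have := hsq.sqrt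
  rw [Real.sqrt_zero] at this
  refine this.congr fun t => Real.sqrt_sq (stackNorm_nonneg _)

/-- The samples tend to zero with the measurements, so the mean follows `A` up to a vanishing
forcing, while the spectral gap controls the distance of each agent to the mean. -/
theorem reachesConsensus_of_tendsto
    (h : IsClosedLoop 𝒢 g A B P ηi (dwellTime 𝒢 g A B P η φ) v te pc)
    (hb : 0 < dwellTime 𝒢 g A B P η φ)
    (hr : r ᵥ* 𝒢.laplacian = 0) (hr0 : ∀ i, 0 < r i) (hr1 : ∑ i, r i = 1)
    (hl2 : 0 < lambdaTwo hN 𝒢 r) (hη : ∀ i, 0 < ηi i ∧ ηi i ≤ η) (hφ : 0 < φ)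
    (hW : Filter.Tendsto (fun t => stackNorm (fun i => relMeas 𝒢 v i t)) Filter.atTop (𝓝 0)) :
    ReachesConsensus A v := by
  set m : ℝ → EuclideanSpace ℝ (Fin q) := fun t => configMean fun i => v i t with hm
  set f : ℝ → EuclideanSpace ℝ (Fin q) := fun t => (N : ℝ)⁻¹ • ∑ i, g i •
    (B * Bᵀ * P).toEuclideanLin (pc i t) with hf
  have hmc : ContinuousOn m (Set.Ici 0) :=
    (continuousOn_finsetSum _ fun i _ => h.continuousOn i).const_smul (N : ℝ)⁻¹
  have hN0 : (N : ℝ) ≠ 0 := by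
    have : 0 < N := by omega
    exact_mod_cast this.ne'
  have hm' : ∀ t, 0 ≤ t → HasDerivWithinAt m
      (LinearMap.toContinuousLinearMap A.toEuclideanLin (m t) + f t) (Set.Ici t) t := by
    intro t ht
    have h1 := (HasDerivWithinAt.fun_sum (u := Finset.univ)
      fun i _ => h.hasDerivWithinAt_state i ht).const_smul (N : ℝ)⁻¹
    refine h1.congr_deriv ?_
    rw [Finset.sum_add_distrib, smul_add]
    simp only [hm, configMean, map_smul, map_sum, LinearMap.coe_toContinuousLinearMap', hf]
  have hpc : ∀ i, Filter.Tendsto (pc i) Filter.atTop (𝓝 0) := fun i => by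
    rw [tendsto_zero_iff_norm_tendsto_zero]
    refine tendsto_of_tendsto_of_tendsto_of_le_of_le' tendsto_const_nhds
      (g := fun _ => (0 : ℝ)) (h := fun t => (max η φ + 1)
        * stackNorm (fun i => relMeas 𝒢 v i t)) (by simpa using hW.const_mul (max η φ + 1))
      (Filter.Eventually.of_forall fun t => norm_nonneg _) ?_
    filter_upwards [Filter.eventually_ge_atTop 0] with t ht
    have h1 := h.error_le_max hb hη hφ ht i
    have h2 := norm_le_stackNorm (fun i => relMeas 𝒢 v i t) i
    have h3 := norm_sub_norm_le (pc i t) (relMeas 𝒢 v i t)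
    linarith
  have hf0 : Filter.Tendsto f Filter.atTop (𝓝 0) := by
    have h1 : Filter.Tendsto f Filter.atTop (𝓝 ((N : ℝ)⁻¹ • ∑ i, g i •
        LinearMap.toContinuousLinearMap (B * Bᵀ * P).toEuclideanLin 0)) := by
      refine Filter.Tendsto.const_smul (tendsto_finsetSum _ fun i _ =>
        Filter.Tendsto.const_smul ?_ _) _
      exact ((LinearMap.toContinuousLinearMap (B * Bᵀ * P).toEuclideanLin).continuous.tendsto
        0).comp (hpc i)
    simpa using h1
  obtain ⟨w, hw, hw1, hw2⟩ := exists_differentiable_of_asymptotic hmc hm' hf0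
  refine ⟨w, hw, hw1, fun i => ?_⟩
  have h1 : Filter.Tendsto (fun t => v i t - m t) Filter.atTop (𝓝 0) := by
    rw [tendsto_zero_iff_norm_tendsto_zero]
    refine squeeze_zero (fun t => norm_nonneg _) (fun t => ?_)
      (by simpa using hW.const_mul (2 / lambdaTwo hN 𝒢 r))
    exact (norm_le_stackNorm (fun i => v i t - m t) i).trans
      (stackNorm_sub_mean_le hr hr0 hr1 hl2 fun i => v i t)
  have h2 := (h1.add hw2).norm
  simpa using h2

end IsClosedLoop

/-! ### Existence of trajectories -/

section AffineFlow

variable {E : Type*} [NormedAddCommGroup E] [NormedSpace ℝ E]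

/-- The vector field `(x, c) ↦ (L x + c, 0)`. -/
def affineField (L : E →L[ℝ] E) : (E × E) →L[ℝ] (E × E) :=
  (L.comp (ContinuousLinearMap.fst ℝ E E) + ContinuousLinearMap.snd ℝ E E).prod 0

/-- The solution of `x' = L x + c` that starts at `x₀`. -/
def affineFlow (L : E →L[ℝ] E) (c x₀ : E) (t : ℝ) : E := (linearFlow (affineField L) t (x₀, c)).1

theorem affineFlow_zero (L : E →L[ℝ] E) (c x₀ : E) : affineFlow L c x₀ 0 = x₀ := by
  simp [affineFlow, linearFlow_zero]

theorem hasDerivAt_affineFlow [CompleteSpace E] (L : E →L[ℝ] E) (c x₀ : E) (t : ℝ) :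
    HasDerivAt (affineFlow L c x₀) (L (affineFlow L c x₀ t) + c) t := by
  have h : ∀ t, HasDerivAt (fun t => linearFlow (affineField L) t (x₀, c))
      (affineField L (linearFlow (affineField L) t (x₀, c))) t := fun t => by
    simpa using (hasDerivAt_linearFlow (affineField L) t).clm_apply (hasDerivAt_const t (x₀, c))
  -- The second component has derivative zero, so the constant input is carried along unchanged and
  -- the augmented linear flow solves the affine equation.
  have hsnd : ∀ t, (linearFlow (affineField L) t (x₀, c)).2 = c := by
    have h2 : ∀ t, HasDerivAt (fun t => (linearFlow (affineField L) t (x₀, c)).2) 0 t := fun t =>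
      (ContinuousLinearMap.snd ℝ E E).hasFDerivAt.comp_hasDerivAt t (h t)
    intro t
    have := is_const_of_deriv_eq_zero (fun t => (h2 t).differentiableAt)
      (fun t => (h2 t).deriv) t 0
    simpa [linearFlow_zero] using this
  have h1 := (ContinuousLinearMap.fst ℝ E E).hasFDerivAt.comp_hasDerivAt t (h t)
  have e : (ContinuousLinearMap.fst ℝ E E) (affineField L (linearFlow (affineField L) t (x₀, c)))
      = L (affineFlow L c x₀ t) + c := by
    change L (affineFlow L c x₀ t) + (linearFlow (affineField L) t (x₀, c)).2 = _
    rw [hsnd]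
  rw [e] at h1
  exact h1

end AffineFlow

/-- The parameters of an event-triggered closed loop. -/
structure LoopData (N q : ℕ) where
  graph : WeightedDigraph N
  gain : Fin N → ℝ
  A : Matrix (Fin q) (Fin q) ℝ
  B : Matrix (Fin q) (Fin 1) ℝ
  P : Matrix (Fin q) (Fin q) ℝ
  thr : Fin N → ℝ
  dwell : ℝ

/-- The state of the closed loop right after a global event: the current time, the agents' states
and, for every agent, its last event time, its number of events so far, its current sample and its
accumulated trigger integral. -/
structure LoopState (N q : ℕ) where
  time : ℝ
  state : Fin N → EuclideanSpace ℝ (Fin q)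
  last : Fin N → ℝ
  count : Fin N → ℕ
  sample : Fin N → EuclideanSpace ℝ (Fin q)
  acc : Fin N → ℝ

/-! ### One step of the event-by-event construction -/

namespace LoopData

variable {N q : ℕ} (D : LoopData N q)

/-- The current trigger rate of agent `i`. -/
def rate (S : LoopState N q) (i : Fin N) : ℝ :=
  triggerRate D.graph D.gain D.A D.B D.P D.thr (fun j _ => S.sample j) i (S.sample i) 0

/-- Agent `i` is due for an event at time `t`. -/
def Due (S : LoopState N q) (i : Fin N) (t : ℝ) : Prop :=
  S.last i + D.dwell ≤ t ∧
    D.thr i / (1 + D.thr i) * ‖S.sample i‖ ≤ S.acc i + D.rate S i * (t - S.time)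

/-- The state of agent `i` at time `t` if no event occurs before `t`. -/
def evolve (S : LoopState N q) (i : Fin N) (t : ℝ) : EuclideanSpace ℝ (Fin q) :=
  affineFlow (LinearMap.toContinuousLinearMap D.A.toEuclideanLin)
    (D.B.toEuclideanLin (D.gain i • (D.Bᵀ * D.P).toEuclideanLin (S.sample i))) (S.state i)
    (t - S.time)

/-- The candidate times for the next global event. -/
def candidates (S : LoopState N q) : Set ℝ :=
  {t | S.time ≤ t ∧ ∃ i, D.Due S i t} ∪ {S.time + 1}

/-- The time of the next global event, at most one time unit ahead. -/
def nextTime (S : LoopState N q) : ℝ := sInf (D.candidates S)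

open Classical in
/-- The state after the next global event. -/
def step (S : LoopState N q) : LoopState N q where
  time := D.nextTime S
  state i := D.evolve S i (D.nextTime S)
  last i := if D.Due S i (D.nextTime S) then D.nextTime S else S.last i
  count i := if D.Due S i (D.nextTime S) then S.count i + 1 else S.count i
  sample i := if D.Due S i (D.nextTime S)
    then relMap D.graph (fun j => D.evolve S j (D.nextTime S)) i else S.sample i
  acc i := if D.Due S i (D.nextTime S) then 0
    else S.acc i + D.rate S i * (D.nextTime S - S.time)

/-- The sequence of states at the global events. -/
def run (v₀ : Fin N → EuclideanSpace ℝ (Fin q)) : ℕ → LoopState N q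
  | 0 => ⟨0, v₀, 0, 0, relMap D.graph v₀, 0⟩
  | n + 1 => D.step (run v₀ n)

section Step

variable {D} {S : LoopState N q}

theorem bddBelow_candidates : BddBelow (D.candidates S) := by
  refine ⟨S.time, ?_⟩
  rintro t (ht | ht)
  · exact ht.1
  · rw [Set.mem_singleton_iff.1 ht]; linarith

/-- The due times form a closed set, so the infimum is attained. The extra candidate `time + 1`
keeps the set nonempty when no agent is ever due again. -/
theorem nextTime_mem : D.nextTime S ∈ D.candidates S := by
  refine IsClosed.csInf_mem ?_ ⟨S.time + 1, Or.inr rfl⟩ bddBelow_candidates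
  refine IsClosed.union ?_ isClosed_singleton
  have e : {t | S.time ≤ t ∧ ∃ i, D.Due S i t}
      = Set.Ici S.time ∩ ⋃ i, ({t | S.last i + D.dwell ≤ t} ∩
        {t | D.thr i / (1 + D.thr i) * ‖S.sample i‖ ≤ S.acc i + D.rate S i * (t - S.time)}) := by
    ext t
    simp [Due]
  rw [e]
  refine isClosed_Ici.inter (isClosed_iUnion_of_finite fun i => ?_)
  exact (isClosed_le (by fun_prop) (by fun_prop)).inter (isClosed_le (by fun_prop) (by fun_prop))

theorem not_due_of_lt_nextTime {t : ℝ} (ht : S.time ≤ t) (ht' : t < D.nextTime S) (i : Fin N) :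
    ¬ D.Due S i t := fun hd =>
  absurd (csInf_le bddBelow_candidates (Or.inl ⟨ht, i, hd⟩)) (not_le.2 ht')

theorem time_lt_nextTime (h : ∀ i, ¬ D.Due S i S.time) : S.time < D.nextTime S := by
  rcases nextTime_mem (D := D) (S := S) with hm | hm
  · refine lt_of_le_of_ne hm.1 fun heq => ?_
    obtain ⟨i, hi⟩ := hm.2
    rw [← heq] at hi
    exact h i hi
  · rw [Set.mem_singleton_iff.1 hm]; linarith

/-- An agent that has just fired must wait for the dwell time; the data of any other agent are
unchanged and it was not due. -/
theorem not_due_step (hb : 0 < D.dwell) (i : Fin N) : ¬ D.Due (D.step S) i (D.step S).time := by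
  intro hd
  by_cases hf : D.Due S i (D.nextTime S)
  · have h1 := hd.1
    simp only [step, if_pos hf] at h1
    linarith
  · apply hf
    have h1 := hd.1
    have h2 := hd.2
    simp only [step, if_neg hf, sub_self, mul_zero, add_zero] at h1 h2
    exact ⟨h1, h2⟩

end Step

/-! ### Running to infinity and checking the trigger law -/

section Run

variable {D} {v₀ : Fin N → EuclideanSpace ℝ (Fin q)}

theorem not_due_run (hb : 0 < D.dwell) (n : ℕ) (i : Fin N) :
    ¬ D.Due (D.run v₀ n) i (D.run v₀ n).time := by
  cases n with
  | zero =>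
    intro hd
    have := hd.1
    simp only [run, Pi.zero_apply] at this
    linarith
  | succ n => exact not_due_step hb i

theorem time_lt_time_succ (hb : 0 < D.dwell) (n : ℕ) :
    (D.run v₀ n).time < (D.run v₀ (n + 1)).time := time_lt_nextTime (not_due_run hb n)

theorem strictMono_time (hb : 0 < D.dwell) : StrictMono fun n => (D.run v₀ n).time :=
  strictMono_nat_of_lt_succ (time_lt_time_succ hb)

theorem time_nonneg (hb : 0 < D.dwell) (n : ℕ) : 0 ≤ (D.run v₀ n).time :=
  (strictMono_time (v₀ := v₀) hb).monotone (Nat.zero_le n)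

theorem last_bounds (hb : 0 < D.dwell) (n : ℕ) (i : Fin N) :
    (D.run v₀ n).count i * D.dwell ≤ (D.run v₀ n).last i ∧
      (D.run v₀ n).last i ≤ (D.run v₀ n).time := by
  induction n with
  | zero => simp [run]
  | succ n ih =>
    have hlt := time_lt_time_succ (v₀ := v₀) hb n
    by_cases hf : D.Due (D.run v₀ n) i (D.nextTime (D.run v₀ n))
    · have h1 := hf.1
      simp only [run, step, if_pos hf, Nat.cast_add, Nat.cast_one, add_mul, one_mul]
      exact ⟨by linarith [ih.1], le_rfl⟩
    · simp only [run, step, if_neg hf]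
      exact ⟨ih.1, ih.2.trans hlt.le⟩

/-- Every global step either fires an agent or advances the clock by one unit. Since the counts are
at most `time / dwell`, the times cannot stay bounded. -/
theorem le_sum_count_add_time (hb : 0 < D.dwell) (n : ℕ) :
    (n : ℝ) ≤ ∑ i, ((D.run v₀ n).count i : ℝ) + (D.run v₀ n).time := by
  induction n with
  | zero => simp [run]
  | succ n ih =>
    have hlt := time_lt_time_succ (v₀ := v₀) hb n
    have hcount : ∀ i, ((D.run v₀ n).count i : ℝ) ≤ (D.run v₀ (n + 1)).count i := fun i => by
      simp only [run, step]
      split_ifs <;> simp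
    push_cast
    rcases nextTime_mem (D := D) (S := D.run v₀ n) with hm | hm
    · obtain ⟨i, hi⟩ := hm.2
      have : ∑ i, ((D.run v₀ n).count i : ℝ) + 1 ≤ ∑ i, ((D.run v₀ (n + 1)).count i : ℝ) := by
        rw [← Finset.add_sum_erase _ _ (Finset.mem_univ i),
          ← Finset.add_sum_erase _ (fun i => ((D.run v₀ (n + 1)).count i : ℝ)) (Finset.mem_univ i)]
        have h1 : ((D.run v₀ (n + 1)).count i : ℝ) = (D.run v₀ n).count i + 1 := by
          simp [run, step, if_pos hi]
        have h2 := Finset.sum_le_sum (s := Finset.univ.erase i) fun j _ => hcount j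
        linarith
      linarith
    · have h1 : (D.run v₀ (n + 1)).time = (D.run v₀ n).time + 1 := hm
      have h2 := Finset.sum_le_sum (s := Finset.univ) fun j _ => hcount j
      linarith

theorem exists_lt_time (hb : 0 < D.dwell) (t : ℝ) : ∃ n, t < (D.run v₀ n).time := by
  obtain ⟨n, hn⟩ := exists_nat_gt ((N / D.dwell + 1) * max t 0)
  refine ⟨n, ?_⟩
  by_contra! hle
  have h1 := le_sum_count_add_time (v₀ := v₀) hb n
  have hle' : (D.run v₀ n).time ≤ max t 0 := hle.trans (le_max_left _ _)
  have h2 : ∀ i, ((D.run v₀ n).count i : ℝ) ≤ max t 0 / D.dwell := fun i => by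
    have := last_bounds (v₀ := v₀) hb n i
    rw [le_div_iff₀ hb]
    linarith [this.1, this.2]
  have h3 : ∑ i, ((D.run v₀ n).count i : ℝ) ≤ N * (max t 0 / D.dwell) := by
    refine (Finset.sum_le_sum fun i _ => h2 i).trans (le_of_eq ?_)
    simp
  have h4 : (N / D.dwell + 1) * max t 0 = N * (max t 0 / D.dwell) + max t 0 := by ring
  linarith

variable (D v₀) in
/-- The index of the last global event up to time `t`. -/
def index (t : ℝ) : ℕ := sInf {n | t < (D.run v₀ (n + 1)).time}

theorem index_eq (hb : 0 < D.dwell) {n : ℕ} {t : ℝ} (h1 : (D.run v₀ n).time ≤ t)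
    (h2 : t < (D.run v₀ (n + 1)).time) : D.index v₀ t = n := by
  refine le_antisymm (Nat.sInf_le h2) ?_
  by_contra! hlt
  have hmem : D.index v₀ t ∈ {n | t < (D.run v₀ (n + 1)).time} := Nat.sInf_mem ⟨n, h2⟩
  have hmem : t < (D.run v₀ (D.index v₀ t + 1)).time := hmem
  have := (strictMono_time (v₀ := v₀) hb).monotone (Nat.succ_le_of_lt hlt)
  simp only [Nat.succ_eq_add_one] at this
  linarith

theorem exists_index (hb : 0 < D.dwell) {t : ℝ} (ht : 0 ≤ t) :
    ∃ n, (D.run v₀ n).time ≤ t ∧ t < (D.run v₀ (n + 1)).time := by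
  classical
  have hex := exists_lt_time (v₀ := v₀) hb t
  have hne : Nat.find hex ≠ 0 := fun h0 => by
    have := Nat.find_spec hex
    rw [h0] at this
    exact absurd this (not_lt.2 ht)
  obtain ⟨k, hk⟩ := Nat.exists_eq_succ_of_ne_zero hne
  refine ⟨k, not_lt.1 (Nat.find_min hex (by omega)), ?_⟩
  have := Nat.find_spec hex
  rwa [hk] at this

variable (D v₀)

/-- The trajectory of the agents' states. -/
def traj (i : Fin N) (t : ℝ) : EuclideanSpace ℝ (Fin q) :=
  D.evolve (D.run v₀ (D.index v₀ t)) i t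

/-- The sampled relative measurements along the trajectory. -/
def held (i : Fin N) (t : ℝ) : EuclideanSpace ℝ (Fin q) :=
  (D.run v₀ (D.index v₀ t)).sample i

/-- The event times along the trajectory. -/
def event (i : Fin N) : ℕ → ℝ≥0∞
  | 0 => 0
  | k + 1 => event i k + max (triggerDelay D.graph D.gain D.A D.B D.P D.thr (D.held v₀) i
      (event i k).toReal (relMeas D.graph (D.traj v₀) i (event i k).toReal))
      (ENNReal.ofReal D.dwell)

variable {D v₀}

theorem evolve_time (S : LoopState N q) (i : Fin N) : D.evolve S i S.time = S.state i := by
  rw [evolve, sub_self, affineFlow_zero]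

theorem hasDerivAt_evolve (S : LoopState N q) (i : Fin N) (t : ℝ) :
    HasDerivAt (D.evolve S i) (D.A.toEuclideanLin (D.evolve S i t) +
      D.B.toEuclideanLin (D.gain i • (D.Bᵀ * D.P).toEuclideanLin (S.sample i))) t :=
  (hasDerivAt_affineFlow _ _ _ (t - S.time)).comp_sub_const t S.time

theorem continuous_evolve (S : LoopState N q) (i : Fin N) : Continuous (D.evolve S i) :=
  continuous_iff_continuousAt.2 fun t => (hasDerivAt_evolve S i t).continuousAt

theorem held_eq (hb : 0 < D.dwell) {n : ℕ} {t : ℝ} (h1 : (D.run v₀ n).time ≤ t)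
    (h2 : t < (D.run v₀ (n + 1)).time) (i : Fin N) :
    D.held v₀ i t = (D.run v₀ n).sample i := by
  rw [held, index_eq hb h1 h2]

theorem traj_time (hb : 0 < D.dwell) (n : ℕ) (i : Fin N) :
    D.traj v₀ i (D.run v₀ n).time = (D.run v₀ n).state i := by
  rw [traj, index_eq hb le_rfl (time_lt_time_succ hb n), evolve_time]

theorem traj_eq (hb : 0 < D.dwell) {n : ℕ} {t : ℝ} (h1 : (D.run v₀ n).time ≤ t)
    (h2 : t ≤ (D.run v₀ (n + 1)).time) (i : Fin N) :
    D.traj v₀ i t = D.evolve (D.run v₀ n) i t := by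
  rcases h2.lt_or_eq with h2 | h2
  · rw [traj, index_eq hb h1 h2]
  · rw [h2, traj_time hb]
    rfl

theorem isStep_held (hb : 0 < D.dwell) (i : Fin N) : IsStep (D.held v₀ i) := by
  constructor
  · intro t ht
    obtain ⟨n, h1, h2⟩ := exists_index (v₀ := v₀) hb ht
    filter_upwards [Ico_mem_nhdsGE h2] with s hs
    rw [held_eq hb h1 h2, held_eq hb (h1.trans hs.1) hs.2]
  · intro t ht
    obtain ⟨n, hn⟩ := exists_lt_time (D := D) (v₀ := v₀) hb t
    have h : IntervalIntegrable (D.held v₀ i) MeasureTheory.volume 0 (D.run v₀ n).time :=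
      intervalIntegrable_of_partition (τ := fun n => (D.run v₀ n).time)
        (fun k _ => (time_lt_time_succ hb k).le)
        fun k _ => ⟨(D.run v₀ k).sample i, fun s hs => held_eq hb hs.1.le hs.2 i⟩
    refine h.mono_set ?_
    rw [Set.uIcc_of_le ht, Set.uIcc_of_le (ht.trans hn.le)]
    exact Set.Icc_subset_Icc_right hn.le

theorem continuousOn_traj (hb : 0 < D.dwell) (i : Fin N) :
    ContinuousOn (D.traj v₀ i) (Set.Ici 0) := by
  have h : ∀ n, ContinuousOn (D.traj v₀ i) (Set.Icc 0 (D.run v₀ n).time) := by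
    intro n
    induction n with
    | zero =>
      have : Set.Icc 0 (D.run v₀ 0).time = {0} := Set.Icc_self 0
      rw [this]
      exact continuousOn_singleton _ _
    | succ n ih =>
      rw [← Set.Icc_union_Icc_eq_Icc (time_nonneg hb n) (time_lt_time_succ (v₀ := v₀) hb n).le]
      refine ih.union_of_isClosed ?_ isClosed_Icc isClosed_Icc
      exact (continuous_evolve (D.run v₀ n) i).continuousOn.congr fun t ht =>
        traj_eq hb ht.1 ht.2 i
  intro t ht
  obtain ⟨n, hn⟩ := exists_lt_time (D := D) (v₀ := v₀) hb t
  refine (h n t ⟨ht, hn.le⟩).mono_of_mem_nhdsWithin ?_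
  rw [← Set.Ici_inter_Iic]
  exact Filter.inter_mem self_mem_nhdsWithin (mem_nhdsWithin_of_mem_nhds (Iic_mem_nhds hn))

theorem hasDerivWithinAt_traj (hb : 0 < D.dwell) (i : Fin N) {t : ℝ} (ht : 0 ≤ t) :
    HasDerivWithinAt (D.traj v₀ i) (D.A.toEuclideanLin (D.traj v₀ i t) +
      D.B.toEuclideanLin (D.gain i • (D.Bᵀ * D.P).toEuclideanLin (D.held v₀ i t)))
      (Set.Ici t) t := by
  obtain ⟨n, h1, h2⟩ := exists_index (v₀ := v₀) hb ht
  rw [traj_eq hb h1 h2.le, held_eq hb h1 h2]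
  refine (hasDerivAt_evolve (D.run v₀ n) i t).hasDerivWithinAt.congr_of_eventuallyEq ?_
    (traj_eq hb h1 h2.le i)
  filter_upwards [Ico_mem_nhdsGE h2] with s hs
  exact traj_eq hb (h1.trans hs.1) hs.2.le i

/-- The recorded data of agent `i` after `n` global events agree with its event times. -/
structure Consistent (D : LoopData N q) (v₀ : Fin N → EuclideanSpace ℝ (Fin q)) (n : ℕ)
    (i : Fin N) : Prop where
  event_eq : D.event v₀ i ((D.run v₀ n).count i) = ENNReal.ofReal ((D.run v₀ n).last i)
  sample_eq : (D.run v₀ n).sample i = relMeas D.graph (D.traj v₀) i ((D.run v₀ n).last i)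
  acc_eq : (D.run v₀ n).acc i = ∫ τ in (D.run v₀ n).last i..(D.run v₀ n).time,
    triggerRate D.graph D.gain D.A D.B D.P D.thr (D.held v₀) i ((D.run v₀ n).sample i) τ

theorem last_nonneg (hb : 0 < D.dwell) (n : ℕ) (i : Fin N) : 0 ≤ (D.run v₀ n).last i :=
  le_trans (by positivity) (last_bounds hb n i).1

namespace Consistent

variable {n : ℕ} {i : Fin N}

/-- Between global events all samples are held, so the trigger rate is constant and its integral
grows linearly; the right endpoint, where samples may jump, has measure zero. -/
theorem integral_eq (hb : 0 < D.dwell) (h : Consistent D v₀ n i) {t : ℝ}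
    (h1 : (D.run v₀ n).time ≤ t) (h2 : t ≤ (D.run v₀ (n + 1)).time) :
    ∫ τ in (D.run v₀ n).last i..t,
        triggerRate D.graph D.gain D.A D.B D.P D.thr (D.held v₀) i ((D.run v₀ n).sample i) τ
      = (D.run v₀ n).acc i + D.rate (D.run v₀ n) i * (t - (D.run v₀ n).time) := by
  have hstep : IsStep (triggerRate D.graph D.gain D.A D.B D.P D.thr (D.held v₀) i
      ((D.run v₀ n).sample i)) := isStep_triggerRate (fun j => isStep_held hb j) i _
  have h0 := time_nonneg (v₀ := v₀) hb n
  rw [h.acc_eq, ← intervalIntegral.integral_add_adjacent_intervals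
    (hstep.intervalIntegrable (last_nonneg hb n i) h0)
    (hstep.intervalIntegrable h0 (h0.trans h1))]
  congr 1
  have hc : ∫ τ in (D.run v₀ n).time..t, triggerRate D.graph D.gain D.A D.B D.P D.thr (D.held v₀)
      i ((D.run v₀ n).sample i) τ = ∫ _ in (D.run v₀ n).time..t, D.rate (D.run v₀ n) i := by
    refine intervalIntegral.integral_congr_ae ?_
    have hne : ∀ᵐ τ : ℝ, τ ≠ t := by simp [MeasureTheory.ae_iff]
    filter_upwards [hne] with τ hτ hmem
    rw [Set.uIoc_of_le h1] at hmem
    have hτ2 : τ < (D.run v₀ (n + 1)).time := (lt_of_le_of_ne hmem.2 hτ).trans_le h2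
    simp only [rate, triggerRate, held_eq hb hmem.1.le hτ2]
  rw [hc, intervalIntegral.integral_const, smul_eq_mul, mul_comm]

/-- This links the literal trigger law, which defines `event` from the whole trajectory, with the
condition `Due`, which sees only the current state. -/
theorem event_succ_le_iff (hb : 0 < D.dwell) (hthr : ∀ i, 0 < D.thr i) (h : Consistent D v₀ n i)
    {t : ℝ} (h1 : (D.run v₀ n).time ≤ t) (h2 : t ≤ (D.run v₀ (n + 1)).time) :
    D.event v₀ i ((D.run v₀ n).count i + 1) ≤ ENNReal.ofReal t ↔ D.Due (D.run v₀ n) i t := by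
  have hl := last_nonneg (v₀ := v₀) hb n i
  rw [event, h.event_eq, ENNReal.toReal_ofReal hl, ← h.sample_eq,
    next_event_le_iff (fun j => isStep_held hb j) hthr i _ hl
      ((last_bounds hb n i).2.trans h1), h.integral_eq hb h1 h2]
  rfl

theorem lt_event_succ (hb : 0 < D.dwell) (hthr : ∀ i, 0 < D.thr i) (h : Consistent D v₀ n i)
    {t : ℝ} (h1 : (D.run v₀ n).time ≤ t) (h2 : t < (D.run v₀ (n + 1)).time) :
    ENNReal.ofReal t < D.event v₀ i ((D.run v₀ n).count i + 1) := by
  rw [← not_le, h.event_succ_le_iff hb hthr h1 h2.le]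
  exact not_due_of_lt_nextTime h1 h2 i

theorem event_succ_eq (hb : 0 < D.dwell) (hthr : ∀ i, 0 < D.thr i) (h : Consistent D v₀ n i)
    (hd : D.Due (D.run v₀ n) i (D.run v₀ (n + 1)).time) :
    D.event v₀ i ((D.run v₀ n).count i + 1) = ENNReal.ofReal (D.run v₀ (n + 1)).time := by
  have hlt := time_lt_time_succ (v₀ := v₀) hb n
  refine le_antisymm ((h.event_succ_le_iff hb hthr hlt.le le_rfl).2 hd) ?_
  by_contra! hcon
  have hfin : D.event v₀ i ((D.run v₀ n).count i + 1) ≠ ⊤ := hcon.ne_top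
  set x := (D.event v₀ i ((D.run v₀ n).count i + 1)).toReal
  have hx : D.event v₀ i ((D.run v₀ n).count i + 1) = ENNReal.ofReal x :=
    (ENNReal.ofReal_toReal hfin).symm
  have hx2 : x < (D.run v₀ (n + 1)).time := by
    rw [hx, ENNReal.ofReal_lt_ofReal_iff_of_nonneg ENNReal.toReal_nonneg] at hcon
    exact hcon
  -- A priori `x` could precede the current global time, where `lt_event_succ` says nothing; the
  -- maximum moves it into the admissible interval.
  have h3 := h.lt_event_succ hb hthr (le_max_right x (D.run v₀ n).time) (max_lt hx2 hlt)
  rw [hx] at h3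
  exact absurd h3 (not_lt.2 (ENNReal.ofReal_le_ofReal (le_max_left _ _)))

theorem succ (hb : 0 < D.dwell) (hthr : ∀ i, 0 < D.thr i) (h : Consistent D v₀ n i) :
    Consistent D v₀ (n + 1) i := by
  have hlt := time_lt_time_succ (v₀ := v₀) hb n
  by_cases hf : D.Due (D.run v₀ n) i (D.nextTime (D.run v₀ n))
  · have hcount : (D.run v₀ (n + 1)).count i = (D.run v₀ n).count i + 1 := by
      simp only [run, step, if_pos hf]
    have hlast : (D.run v₀ (n + 1)).last i = (D.run v₀ (n + 1)).time := by
      simp only [run, step, if_pos hf]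
    refine ⟨?_, ?_, ?_⟩
    · rw [hcount, hlast, h.event_succ_eq hb hthr hf]
    · rw [hlast]
      have : (D.run v₀ (n + 1)).sample i = relMap D.graph (D.run v₀ (n + 1)).state i := by
        simp only [run, step, if_pos hf]
      rw [this, relMap, relMeas]
      simp only [traj_time hb]
    · rw [hlast, intervalIntegral.integral_same]
      simp only [run, step, if_pos hf]
  · have hcount : (D.run v₀ (n + 1)).count i = (D.run v₀ n).count i := by
      simp only [run, step, if_neg hf]
    have hlast : (D.run v₀ (n + 1)).last i = (D.run v₀ n).last i := by
      simp only [run, step, if_neg hf]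
    have hsample : (D.run v₀ (n + 1)).sample i = (D.run v₀ n).sample i := by
      simp only [run, step, if_neg hf]
    refine ⟨?_, ?_, ?_⟩
    · rw [hcount, hlast, h.event_eq]
    · rw [hsample, hlast, h.sample_eq]
    · rw [hsample, hlast, h.integral_eq hb hlt.le le_rfl]
      simp only [run, step, if_neg hf]

end Consistent

theorem traj_zero (hb : 0 < D.dwell) (i : Fin N) : D.traj v₀ i 0 = v₀ i :=
  traj_time (D := D) (v₀ := v₀) hb 0 i

theorem consistent_run (hb : 0 < D.dwell) (hthr : ∀ i, 0 < D.thr i) (n : ℕ) (i : Fin N) :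
    Consistent D v₀ n i := by
  induction n with
  | zero =>
    refine ⟨by simp [run, event], ?_, by simp [run]⟩
    simp only [run, relMap, relMeas, Pi.zero_apply, traj_zero hb]
  | succ n ih => exact ih.succ hb hthr

theorem event_mono (i : Fin N) : Monotone (D.event v₀ i) :=
  monotone_nat_of_le_succ fun k => by rw [event]; exact le_self_add

theorem isClosedLoop (hb : 0 < D.dwell) (hthr : ∀ i, 0 < D.thr i) :
    IsClosedLoop D.graph D.gain D.A D.B D.P D.thr D.dwell (D.traj v₀) (D.event v₀) (D.held v₀)
    where
  event_zero _ := rfl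
  event_succ _ _ := rfl
  sampled i k t ht h1 h2 := by
    obtain ⟨n, hn1, hn2⟩ := exists_index (v₀ := v₀) hb ht
    have hc := consistent_run (v₀ := v₀) hb hthr n i
    have h3 : D.event v₀ i ((D.run v₀ n).count i) ≤ ENNReal.ofReal t := by
      rw [hc.event_eq]
      exact ENNReal.ofReal_le_ofReal ((last_bounds hb n i).2.trans hn1)
    have h4 := hc.lt_event_succ hb hthr hn1 hn2
    -- Event times are monotone, so if both `k` and the recorded count have `t` between their event
    -- and the next one, they coincide.
    have hk : k = (D.run v₀ n).count i := by
      refine le_antisymm ?_ ?_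
      · by_contra! hlt
        exact absurd (h4.trans_le (event_mono i (Nat.succ_le_of_lt hlt))) (not_lt.2 h1)
      · by_contra! hlt
        exact absurd (h2.trans_le (event_mono i (Nat.succ_le_of_lt hlt))) (not_lt.2 h3)
    rw [held_eq hb hn1 hn2, hc.sample_eq, hk, hc.event_eq,
      ENNReal.toReal_ofReal (last_nonneg hb n i)]
  continuousOn i := continuousOn_traj hb i
  dynamics i _ ht := hasDerivWithinAt_traj hb i ht

end Run

end LoopData

/-! ### Positivity of the dwell time -/

section DwellTime

variable {N q : ℕ} {𝒢 : WeightedDigraph N} {r g : Fin N → ℝ} {A P : Matrix (Fin q) (Fin q) ℝ}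
  {B : Matrix (Fin q) (Fin 1) ℝ}

theorem WeightedDigraph.laplacian_ne_zero {hN : 2 ≤ N} (hpos : 0 < lambdaTwo hN 𝒢 r) :
    𝒢.laplacian ≠ 0 := by
  intro h0
  have hM := 𝒢.symLaplacian_isHermitian r
  obtain ⟨j, hj⟩ := ascendingEigenvalues_eq_eigenvalues hM ⟨1, hN⟩
  have hz : 𝒢.symLaplacian r = 0 := by simp [WeightedDigraph.symLaplacian, h0]
  have := congrFun (hM.eigenvalues_eq_zero_iff.2 hz) j
  rw [lambdaTwo, hj, this] at hpos
  exact lt_irrefl _ hpos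

/-- `λ₂ > 0` excludes a zero Laplacian, and the invertible factors `G` and `P` preserve
non-vanishing; positivity thus holds even if `A = 0`. -/
theorem bOne_pos {hN : 2 ≤ N} (hB : B ≠ 0) (hpos : 0 < lambdaTwo hN 𝒢 r) (hg : ∀ i, 0 < g i)
    (hP : P.PosDef) : 0 < bOne 𝒢 g A B P := by
  have h1 : 𝒢.laplacian * Matrix.diagonal g ≠ 0 := by
    have hu : IsUnit (Matrix.diagonal g) := (Matrix.PosDef.diagonal hg).isUnit
    rw [Ne, hu.mul_left_eq_zero]
    exact 𝒢.laplacian_ne_zero hpos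
  have h2 : B * Bᵀ * P ≠ 0 := by
    rw [Ne, hP.isUnit.mul_left_eq_zero, ← Matrix.conjTranspose_eq_transpose_of_trivial,
      Matrix.self_mul_conjTranspose_eq_zero]
    exact hB
  exact add_pos_of_nonneg_of_pos (norm_nonneg _)
    (mul_pos (norm_pos_iff.2 h1) (norm_pos_iff.2 h2))

theorem dwellTime_pos {hN : 2 ≤ N} {η φ : ℝ} (hB : B ≠ 0) (hpos : 0 < lambdaTwo hN 𝒢 r)
    (hg : ∀ i, 0 < g i) (hP : P.PosDef) (hφ : 0 < φ) : 0 < dwellTime 𝒢 g A B P η φ := by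
  refine div_pos (Real.log_pos (by linarith)) (add_pos_of_pos_of_nonneg
    (bOne_pos hB hpos hg hP) (mul_nonneg (mul_nonneg ?_ (hφ.le.trans (le_max_right _ _)))
      (Real.sqrt_nonneg _)))
  exact mul_nonneg (norm_nonneg _) (norm_nonneg _)

end DwellTime

end

theorem theorem2 {N q : ℕ} (hN : 2 ≤ N)
    (A : Matrix (Fin q) (Fin q) ℝ) (B : Matrix (Fin q) (Fin 1) ℝ) (hB : B ≠ 0)
    (hA : HasSimpleImaginarySpectrum A) (hAB : IsStabilizable A B)
    (𝒢 : WeightedDigraph N) (h𝒢 : 𝒢.IsStronglyConnected)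
    (r : Fin N → ℝ) (hr : r ᵥ* 𝒢.laplacian = 0) (hr_sum : ∑ i, r i = 1)
    (g : Fin N → ℝ) (hg : ∀ i, r i ≤ g i)
    (lam : ℝ) (hlam_pos : 0 < lam) (hlam : lam < lambdaTwo hN 𝒢 r / N) :
    (∃! P : Matrix (Fin q) (Fin q) ℝ,
      P.PosDef ∧ SolvesRiccati A B lam (riccatiBeta hN g r) P) ∧
    ∀ P : Matrix (Fin q) (Fin q) ℝ,
      P.PosDef → SolvesRiccati A B lam (riccatiBeta hN g r) P →
      ∀ (η : ℝ) (ηi : Fin N → ℝ) (φ : ℝ),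
        (∀ i, 0 < ηi i ∧ ηi i ≤ η) → 0 < φ →
        rhoConst hN 𝒢 r g lam B P ^ 2 * η ^ 2
          + N * rhoConst hN 𝒢 r g lam B P ^ 2 * φ ^ 2 < 1 →
        0 < dwellTime 𝒢 g A B P η φ ∧
        (∀ v₀ : Fin N → EuclideanSpace ℝ (Fin q),
          ∃ v te pc, IsClosedLoop 𝒢 g A B P ηi (dwellTime 𝒢 g A B P η φ) v te pc ∧
            ∀ i, v i 0 = v₀ i) ∧
        ∀ v te pc, IsClosedLoop 𝒢 g A B P ηi (dwellTime 𝒢 g A B P η φ) v te pc →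
          ReachesConsensus A v ∧
          ∀ i k, te i k + ENNReal.ofReal (dwellTime 𝒢 g A B P η φ) ≤ te i (k + 1) := by
  have hr0 : ∀ i, 0 < r i := h𝒢.pos_of_vecMul_eq_zero hr hr_sum
  have hg0 : ∀ i, 0 < g i := fun i => (hr0 i).trans_le (hg i)
  have hβ : 0 < riccatiBeta hN g r := riccatiBeta_pos hr0 hg0
  have hN0 : (0 : ℝ) < N := by exact_mod_cast (by omega : 0 < N)
  have hl2 : 0 < lambdaTwo hN 𝒢 r := by
    have := hlam_pos.trans hlam
    rwa [lt_div_iff₀ hN0, zero_mul] at this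
  -- In dimension zero every `B` vanishes, so `B ≠ 0` provides the nontrivial dimension required by
  -- the Riccati and eigenvalue arguments.
  have : NeZero q := ⟨by rintro rfl; exact hB (Subsingleton.elim _ _)⟩
  refine ⟨?_, fun P hP hR η ηi φ hη hφ hρ => ?_⟩
  · obtain ⟨P, hP, hR⟩ := exists_riccati_solution hAB hlam_pos hβ
    exact ⟨P, ⟨hP, hR⟩, fun Q hQ => riccati_unique hlam_pos hβ hQ.1 hP hQ.2 hR⟩
  have hb : 0 < dwellTime 𝒢 g A B P η φ := dwellTime_pos hB hl2 hg0 hP hφ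
  refine ⟨hb, fun v₀ => ?_, fun v te pc h => ⟨?_, h.add_dwell_le⟩⟩
  · let D : LoopData N q := ⟨𝒢, g, A, B, P, ηi, dwellTime 𝒢 g A B P η φ⟩
    exact ⟨D.traj v₀, D.event v₀, D.held v₀, D.isClosedLoop hb fun i => (hη i).1,
      fun i => D.traj_zero hb i⟩
  · exact h.reachesConsensus_of_tendsto hb hr hr0 hr_sum hl2 hη hφ
      (h.tendsto_stackNorm hb hr hr0 hg hlam_pos hlam hP hR hη hφ hρ)
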